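/- **Notation.** For $m\ge 0$ consider $4m$ parties $W_i^b,U_i^b$ ($1\le i\le m$, $b\in\{0,1\}$). Bit strings $w,u$ of length $m$ are identified with integers in $\{0,\dots,2^m-1\}$, and $B_{w,u}=\{W_i^{w_i}\}_i\cup\{U_i^{u_i}\}_i$. Let $QR(w,u)=1$ if $\gcd(w,u)=1$ and $w$ is a square modulo $u$, and $QR(w,u)=0$ otherwise. The access structure $\mathrm{NQR}_{4m}$ consists of all sets of parties that contain one of: $\{W_i^0,W_i^1\}$; $\{U_i^0,U_i^1\}$; $B_{w,u}$ with $u\ne 0,1$ and $QR(w,u)=0$; $B_{w,0}$ with $w\neq 1$. Let $\mathrm{NQR}_{4m}:\{0,1\}^{4m}\to\{0,1\}$ also denote its indicator function, and let $\mathrm{NQR}_{4m,(2)}(x,y)=\mathrm{NQR}_{4m}(x\oplus y)$. A family of functions $f:\{0,1\}^n\times\{0,1\}^n\to\{0,1\}$ is in $P_{(2)}$ if $f(x,y)=F(\alpha(x),\beta(y))$ for arbitrary functions $\alpha,\beta$ (depending on $n$) with outputs of length polynomial in $n$ and a polynomial-time computable $F$. In all tasks Alice gets $x$ and Bob gets $y$.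 *CDS* of one bit for $f$ with $\rho$ shared random bits: Alice, holding $s\in\{0,1\}$, sends $m_0(x,s,r)$ and Bob sends $m_1(y,r)$ to a referee, where $r\in\{0,1\}^\rho$ is uniform and shared. It is $\epsilon$-correct if some decoder $D(m_0,x,m_1,y)$ satisfies $\Pr_r[D=s]\ge 1-\epsilon$ for all $s$ and all $(x,y)\in f^{-1}(1)$. It is $\delta$-secure if there are distributions $\mathrm{Sim}_{xy}$ with $\|\mathrm{Sim}_{xy}-P_{m_0m_1|xys}\|_1\le\delta$ for all $s$ and all $(x,y)\in f^{-1}(0)$. *CDQS* of one qubit with $\rho$ shared random bits: Alice, holding a qubit $Q$, and Bob apply local channels depending on their inputs to $Q$ and their copies of the shared bits, and send the outputs $M$ to the referee; this defines channels $\mathcal N^{xy}_{Q\to M}$. It is $\epsilon$-correct if there are channels $\mathcal D^{xy}$ with $\|\mathcal D^{xy}\circ\mathcal N^{xy}-\mathcal I_Q\|_\diamond\le\epsilon$ for all $(x,y)\in f^{-1}(1)$. It is $\delta$-secure if there are states $\sigma^{xy}$ with $\|\sigma^{xy}\operatorname{tr}(\cdot)-\mathcal N^{xy}\|_\diamond\le\delta$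 for all $(x,y)\in f^{-1}(0)$. *$f$-routing* of one qubit with $E$ EPR pairs: Alice and Bob apply local channels depending on their inputs, Alice to $Q$ and her halves of the $E$ shared EPR pairs, Bob to his halves, and exchange one round of messages, after which Bob holds $M$ and Alice holds $M'$. It is $\epsilon$-correct if $Q$ can be recovered by a channel acting on $M$ when $f(x,y)=1$, and by a channel acting on $M'$ when $f(x,y)=0$, up to $\epsilon$ in diamond norm. **Theorem.** 1. There is a constant $C$ such that, for all $m\ge 0$ and $k\ge 1$, with $n=4m$: for the function $\mathrm{NQR}_{4m,(2)}$, CDS of one bit and CDQS of one qubit can be performed $2^{-k}$-correctly and $k2^{-k}$-securely with at most $C\,n(k^2+kn)$ shared random bits, and $f$-routing of one qubit can be performed $Ck2^{-k}$-correctly with at most $C\,n(k^2+kn)$ EPR pairs. 2. Assume the conjecture that the family $\mathrm{NQR}_{4m,(2)}$, $m\ge0$, is not in $P_{(2)}$. Then there are a family of functions $f_n:\{0,1\}^n\times\{0,1\}^n\to\{0,1\}$, $n\ge 0$, that is not in $P_{(2)}$, and a constant $C$ such that, for all $n\ge 0$ and $k\ge 1$: for $f_n$, CDS of one bit and CDQS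 of one qubit can be performed $2^{-k}$-correctly and $k2^{-k}$-securely with at most $C(k^2+kn)$ shared random bits, and $f$-routing of one qubit can be performed $Ck2^{-k}$-correctly with at most $C(k^2+kn)$ EPR pairs. -/

import Mathlib

open scoped ENNReal ComplexOrder

noncomputable section

/-- Bit strings of length `n`. -/
abbrev Bits (n : ℕ) : Type := Fin n → Bool

/-! ### The access structure `NQR` and the function `NQR_{4m,(2)}` -/

/-- Quadratic residuosity: `u` is coprime to `v` and is a square modulo `v`. -/
def QR (u v : ℕ) : Prop := Nat.gcd u v = 1 ∧ ∃ r : ℕ, u ≡ r ^ 2 [MOD v]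

/-- The number in `{0, …, 2 ^ m - 1}` associated with a bit string of length `m`. -/
def bitsVal {m : ℕ} (w : Bits m) : ℕ := ∑ i : Fin m, if w i then 2 ^ (i : ℕ) else 0

/-- The `4 m` parties (shares) `W i b` and `U i b`, with `i < m` and `b` a bit. -/
inductive Party (m : ℕ) : Type where
  | W (i : Fin m) (b : Bool) : Party m
  | U (i : Fin m) (b : Bool) : Party m

/-- The position of a party in an indicator string of length `4 m`: the string is the
concatenation of four blocks of length `m`, for the parties `W i 1`, `W i 0`, `U i 1`, `U i 0`. -/
def Party.pos {m : ℕ} : Party m → Fin (4 * m)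
  | .W i true => ⟨i, by omega⟩
  | .W i false => ⟨m + i, by omega⟩
  | .U i true => ⟨2 * m + i, by omega⟩
  | .U i false => ⟨3 * m + i, by omega⟩

/-- The set `B_{w,u}` of `2 m` parties. -/
def partySet {m : ℕ} (w u : Bits m) : Set (Party m) :=
  {p | (∃ i, p = Party.W i (w i)) ∨ ∃ i, p = Party.U i (u i)}

/-- The minimal authorized sets of the access structure `NQR_{4m}`. -/
inductive NQRMinimal (m : ℕ) : Set (Party m) → Prop where
  | pairW (i : Fin m) : NQRMinimal m {Party.W i false, Party.W i true}
  | pairU (i : Fin m) : NQRMinimal m {Party.U i false, Party.U i true}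
  | nonresidue (w u : Bits m) (h0 : bitsVal u ≠ 0) (h1 : bitsVal u ≠ 1)
      (h : ¬ QR (bitsVal w) (bitsVal u)) : NQRMinimal m (partySet w u)
  | zero (w u : Bits m) (hu : bitsVal u = 0) (hw : bitsVal w ≠ 1) :
      NQRMinimal m (partySet w u)

/-- The access structure `NQR_{4m}`: the sets that contain a minimal authorized set. -/
def NQRAccess (m : ℕ) : Set (Set (Party m)) := {A | ∃ B, NQRMinimal m B ∧ B ⊆ A}

open Classical in
/-- The indicator function of the access structure `NQR_{4m}`. -/
def NQR (m : ℕ) (z : Bits (4 * m)) : Bool := decide ({p | z p.pos = true} ∈ NQRAccess m)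

/-- `NQR_{4m,(2)} (x, y) = NQR_{4m} (x ⊕ y)`. -/
def NQR₂ (m : ℕ) (x y : Bits (4 * m)) : Bool := NQR m fun i => xor (x i) (y i)

/-! ### Polynomial time after local pre-processing -/

/-- The word, over two disjoint copies of the binary alphabet, that represents a pair of
bit strings. -/
def encodePair (p : List Bool × List Bool) : List (Bool ⊕ Bool) :=
  p.1.map Sum.inl ++ p.2.map Sum.inr

/-- The class `P_(2)`: a family of two-party functions `f i` on inputs of `len i` bits per party
has an interaction part `F`, that is `f i x y = F (α i x, β i y)` for arbitrary local functions
`α i`, `β i` with outputs of length polynomial in `len i`, such that `F` is computable in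
polynomial time. -/
def InP₂ (len : ℕ → ℕ) (f : ∀ i, Bits (len i) → Bits (len i) → Bool) : Prop :=
  ∃ (F : List Bool × List Bool → Bool) (q : Polynomial ℕ)
    (α β : ∀ i, Bits (len i) → List Bool),
    Nonempty (Turing.TM2ComputableInPolyTime encodePair Computability.encodeBool F) ∧
    (∀ i x, (α i x).length ≤ q.eval (len i)) ∧
    (∀ i y, (β i y).length ≤ q.eval (len i)) ∧
    ∀ i x y, f i x y = F (α i x, β i y)

/-! ### Conditional disclosure of secrets -/

open Classical in
/-- The probability of an event over a uniformly random string of `ρ` bits. -/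
def probBits (ρ : ℕ) (p : Bits ρ → Prop) : ℝ :=
  ((Finset.univ.filter p).card : ℝ) / 2 ^ ρ

/-- A CDS protocol with inputs of `n` bits per party, secrets in `S` held by Alice, and `ρ` shared
uniformly random bits, consists of the message functions `m₀(x, s, r)` and `m₁(y, r)`. -/
structure CDSProtocol (n ρ : ℕ) (S : Type) where
  M₀ : Type
  M₁ : Type
  [fintypeM₀ : Fintype M₀]
  [fintypeM₁ : Fintype M₁]
  alice : Bits n → S → Bits ρ → M₀
  bob : Bits n → Bits ρ → M₁

attribute [instance] CDSProtocol.fintypeM₀ CDSProtocol.fintypeM₁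

namespace CDSProtocol

variable {n ρ : ℕ} {S : Type}

/-- The distribution `P_{M | x y s}` of the pair of messages. -/
def msgProb (P : CDSProtocol n ρ S) (x y : Bits n) (s : S) (m : P.M₀ × P.M₁) : ℝ :=
  probBits ρ fun r => (P.alice x s r, P.bob y r) = m

/-- `ε`-correctness: on `1`-inputs the referee, who sees the messages and the inputs, decodes every
secret with probability at least `1 - ε`. -/
def Correct (P : CDSProtocol n ρ S) (f : Bits n → Bits n → Bool) (ε : ℝ) : Prop :=
  ∃ D : P.M₀ → Bits n → P.M₁ → Bits n → S, ∀ s x y, f x y = true →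
    1 - ε ≤ probBits ρ fun r => D (P.alice x s r) x (P.bob y r) y = s

/-- `δ`-security: on `0`-inputs the messages can be simulated, without the secret, up to `δ` in
one-norm. -/
def Secure (P : CDSProtocol n ρ S) (f : Bits n → Bits n → Bool) (δ : ℝ) : Prop :=
  ∃ Sim : Bits n → Bits n → P.M₀ × P.M₁ → ℝ,
    (∀ x y, Sim x y ∈ stdSimplex ℝ (P.M₀ × P.M₁)) ∧
    ∀ s x y, f x y = false → ∑ m, |Sim x y m - P.msgProb x y s m| ≤ δ

end CDSProtocol

/-! ### Finite-dimensional quantum systems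

A system is a finite type `a` (a basis); its operators are the matrices over `a`. -/

/-- Operators on the system with basis `a`. -/
abbrev Op (a : Type) : Type := Matrix a a ℂ

section Quantum

variable {a b c d : Type} [Fintype a] [Fintype b] [Fintype c] [Fintype d]
  [DecidableEq a] [DecidableEq b] [DecidableEq c] [DecidableEq d]

/-- Density matrices. -/
def IsDensity (X : Op a) : Prop := X.PosSemidef ∧ X.trace = 1

/-- The trace norm: the sum of the singular values. -/
def traceNorm (X : Op a) : ℝ :=
  ∑ i, Real.sqrt ((Matrix.isHermitian_conjTranspose_mul_self X).eigenvalues i)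

/-- `id_c ⊗ Φ`. -/
def ampLeft (c : Type) (Φ : Op a →ₗ[ℂ] Op b) : Op (c × a) →ₗ[ℂ] Op (c × b) where
  toFun X := Matrix.of fun i j => Φ (Matrix.of fun p q => X (i.1, p) (j.1, q)) i.2 j.2
  map_add' X Y := by
    ext i j
    exact congrFun (congrFun (map_add Φ (Matrix.of fun p q => X (i.1, p) (j.1, q))
      (Matrix.of fun p q => Y (i.1, p) (j.1, q))) i.2) j.2
  map_smul' t X := by
    ext i j
    exact congrFun (congrFun (map_smul Φ t (Matrix.of fun p q => X (i.1, p) (j.1, q))) i.2) j.2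

/-- `Φ ⊗ id_c`. -/
def ampRight (c : Type) (Φ : Op a →ₗ[ℂ] Op b) : Op (a × c) →ₗ[ℂ] Op (b × c) where
  toFun X := Matrix.of fun i j => Φ (Matrix.of fun p q => X (p, i.2) (q, j.2)) i.1 j.1
  map_add' X Y := by
    ext i j
    exact congrFun (congrFun (map_add Φ (Matrix.of fun p q => X (p, i.2) (q, j.2))
      (Matrix.of fun p q => Y (p, i.2) (q, j.2))) i.1) j.1
  map_smul' t X := by
    ext i j
    exact congrFun (congrFun (map_smul Φ t (Matrix.of fun p q => X (p, i.2) (q, j.2))) i.1) j.1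

/-- Quantum channels: completely positive and trace preserving maps. -/
def IsChannel (Φ : Op a →ₗ[ℂ] Op b) : Prop :=
  (∀ (k : ℕ) (X : Op (Fin k × a)), X.PosSemidef → (ampLeft (Fin k) Φ X).PosSemidef) ∧
    ∀ X, (Φ X).trace = X.trace

/-- The diamond norm distance: the supremum, over all reference dimensions `k` and all joint
states, of the trace norm of the difference of the outputs. -/
def diamondDist (Φ Ψ : Op a →ₗ[ℂ] Op b) : ℝ≥0∞ :=
  ⨆ (k : ℕ) (X : Op (Fin k × a)) (_ : IsDensity X),
    ENNReal.ofReal (traceNorm (ampLeft (Fin k) Φ X - ampLeft (Fin k) Ψ X))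

/-- Relabelling of the basis of a system. -/
def relabel (e : a ≃ b) : Op a →ₗ[ℂ] Op b := (Matrix.reindexLinearEquiv ℂ ℂ e e).toLinearMap

/-- Adjoining a system in the state `ω`: the map `X ↦ X ⊗ ω`. -/
def adjoinState (a : Type) (ω : Op b) : Op a →ₗ[ℂ] Op (a × b) :=
  (Matrix.kroneckerBilinear (R := ℂ) (α := ℂ)).flip ω

/-- The partial trace over the second system. -/
def traceRight : Op (a × b) →ₗ[ℂ] Op a where
  toFun X := Matrix.of fun i j => ∑ k, X (i, k) (j, k)
  map_add' X Y := by ext i j; simp [Finset.sum_add_distrib]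
  map_smul' t X := by ext i j; simp [Finset.mul_sum]

/-- The partial trace over the first system. -/
def traceLeft : Op (a × b) →ₗ[ℂ] Op b where
  toFun X := Matrix.of fun i j => ∑ k, X (k, i) (k, j)
  map_add' X Y := by ext i j; simp [Finset.sum_add_distrib]
  map_smul' t X := by ext i j; simp [Finset.mul_sum]

/-- The channel that discards its input and prepares `σ`. -/
def discardPrepare (a : Type) [Fintype a] (σ : Op b) : Op a →ₗ[ℂ] Op b :=
  (Matrix.traceLinearMap a ℂ ℂ).smulRight σ

/-- The state of `ρ` shared uniformly random bits, `2 ^ (-ρ) ∑_r |r⟩⟨r| ⊗ |r⟩⟨r|`. -/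
def sharedBits (ρ : ℕ) : Op (Bits ρ × Bits ρ) :=
  Matrix.of fun i j => if i.1 = i.2 ∧ j = i then ((2 : ℂ) ^ ρ)⁻¹ else 0

/-- The state of `E` shared EPR pairs, `2 ^ (-E) ∑_{r, r'} |r r⟩⟨r' r'|`. -/
def eprPairs (E : ℕ) : Op (Bits E × Bits E) :=
  Matrix.of fun i j => if i.1 = i.2 ∧ j.1 = j.2 then ((2 : ℂ) ^ E)⁻¹ else 0

/-- Alice, holding `Q` and one half of the resource state `ω`, applies `A`, and Bob applies `B` to
the other half: the resulting map from `Q` to the outputs of both. -/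
def localMap {Q L R : Type} (ω : Op (L × R)) (A : Op (Q × L) →ₗ[ℂ] Op a)
    (B : Op R →ₗ[ℂ] Op b) : Op Q →ₗ[ℂ] Op (a × b) :=
  ampLeft a B ∘ₗ ampRight R A ∘ₗ relabel (Equiv.prodAssoc Q L R).symm ∘ₗ adjoinState Q ω

end Quantum

/-! ### Conditional disclosure of quantum secrets -/

/-- The local operations of a CDQS protocol on inputs of `n` bits per party, with secret system
`Q` given to Alice and a resource state on `L` (Alice) and `R` (Bob). -/
structure CDQSProtocol (n : ℕ) (Q L R : Type) [Fintype Q] [Fintype L] [Fintype R] where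
  M₀ : Type
  M₁ : Type
  [fintypeM₀ : Fintype M₀]
  [fintypeM₁ : Fintype M₁]
  [decEqM₀ : DecidableEq M₀]
  [decEqM₁ : DecidableEq M₁]
  alice : Bits n → Op (Q × L) →ₗ[ℂ] Op M₀
  bob : Bits n → Op R →ₗ[ℂ] Op M₁
  alice_channel : ∀ x, IsChannel (alice x)
  bob_channel : ∀ y, IsChannel (bob y)

attribute [instance] CDQSProtocol.fintypeM₀ CDQSProtocol.fintypeM₁
  CDQSProtocol.decEqM₀ CDQSProtocol.decEqM₁

namespace CDQSProtocol

variable {n : ℕ} {Q L R : Type} [Fintype Q] [Fintype L] [Fintype R] [DecidableEq Q]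

/-- The channel `N^{x,y}` from `Q` to `M = M₀ M₁` when the resource state is `ω`. -/
def chan (P : CDQSProtocol n Q L R) (ω : Op (L × R)) (x y : Bits n) :
    Op Q →ₗ[ℂ] Op (P.M₀ × P.M₁) :=
  localMap ω (P.alice x) (P.bob y)

/-- `ε`-correctness: on `1`-inputs the referee can recover `Q` up to `ε` in diamond norm. -/
def Correct (P : CDQSProtocol n Q L R) (ω : Op (L × R)) (f : Bits n → Bits n → Bool)
    (ε : ℝ) : Prop :=
  ∃ D : Bits n → Bits n → Op (P.M₀ × P.M₁) →ₗ[ℂ] Op Q,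
    (∀ x y, IsChannel (D x y)) ∧
    ∀ x y, f x y = true →
      diamondDist (D x y ∘ₗ P.chan ω x y) LinearMap.id ≤ ENNReal.ofReal ε

/-- `δ`-security: on `0`-inputs the referee could have prepared the messages without `Q`, up to `δ`
in diamond norm. -/
def Secure (P : CDQSProtocol n Q L R) (ω : Op (L × R)) (f : Bits n → Bits n → Bool)
    (δ : ℝ) : Prop :=
  ∃ Sim : Bits n → Bits n → Op (P.M₀ × P.M₁),
    (∀ x y, IsDensity (Sim x y)) ∧
    ∀ x y, f x y = false →
      diamondDist (discardPrepare Q (Sim x y)) (P.chan ω x y) ≤ ENNReal.ofReal δ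

end CDQSProtocol

/-! ### `f`-routing -/

/-- The first-round local operations of an `f`-routing protocol. Alice keeps `M₀'` and sends `M₀`
to Bob; Bob keeps `M₁` and sends `M₁'` to Alice. -/
structure RoutingProtocol (n : ℕ) (Q L R : Type) [Fintype Q] [Fintype L] [Fintype R] where
  M₀ : Type
  M₀' : Type
  M₁ : Type
  M₁' : Type
  [fintypeM₀ : Fintype M₀]
  [fintypeM₀' : Fintype M₀']
  [fintypeM₁ : Fintype M₁]
  [fintypeM₁' : Fintype M₁']
  [decEqM₀ : DecidableEq M₀]
  [decEqM₀' : DecidableEq M₀']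
  [decEqM₁ : DecidableEq M₁]
  [decEqM₁' : DecidableEq M₁']
  alice : Bits n → Op (Q × L) →ₗ[ℂ] Op (M₀ × M₀')
  bob : Bits n → Op R →ₗ[ℂ] Op (M₁ × M₁')
  alice_channel : ∀ x, IsChannel (alice x)
  bob_channel : ∀ y, IsChannel (bob y)

attribute [instance] RoutingProtocol.fintypeM₀ RoutingProtocol.fintypeM₀'
  RoutingProtocol.fintypeM₁ RoutingProtocol.fintypeM₁' RoutingProtocol.decEqM₀
  RoutingProtocol.decEqM₀' RoutingProtocol.decEqM₁ RoutingProtocol.decEqM₁'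

namespace RoutingProtocol

variable {n : ℕ} {Q L R : Type} [Fintype Q] [Fintype L] [Fintype R] [DecidableEq Q]

/-- The channel `N^{x,y}` from `Q` to `M M'`, where after the exchange Bob holds `M = M₀ M₁` and
Alice holds `M' = M₀' M₁'`. -/
def chan (P : RoutingProtocol n Q L R) (ω : Op (L × R)) (x y : Bits n) :
    Op Q →ₗ[ℂ] Op ((P.M₀ × P.M₁) × (P.M₀' × P.M₁')) :=
  relabel (Equiv.prodProdProdComm P.M₀ P.M₀' P.M₁ P.M₁') ∘ₗ localMap ω (P.alice x) (P.bob y)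

/-- `ε`-correctness: Bob can recover `Q` from `M` on `1`-inputs, and Alice can recover `Q` from
`M'` on `0`-inputs, up to `ε` in diamond norm. -/
def Correct (P : RoutingProtocol n Q L R) (ω : Op (L × R)) (f : Bits n → Bits n → Bool)
    (ε : ℝ) : Prop :=
  (∃ D : Bits n → Bits n → Op (P.M₀ × P.M₁) →ₗ[ℂ] Op Q,
    (∀ x y, IsChannel (D x y)) ∧
    ∀ x y, f x y = true →
      diamondDist (D x y ∘ₗ traceRight ∘ₗ P.chan ω x y) LinearMap.id ≤ ENNReal.ofReal ε) ∧
  (∃ D' : Bits n → Bits n → Op (P.M₀' × P.M₁') →ₗ[ℂ] Op Q,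
    (∀ x y, IsChannel (D' x y)) ∧
    ∀ x y, f x y = false →
      diamondDist (D' x y ∘ₗ traceLeft ∘ₗ P.chan ω x y) LinearMap.id ≤ ENNReal.ofReal ε)

end RoutingProtocol

/-! ### The tasks for a one-bit or one-qubit secret -/

/-- CDS of one bit for `f` can be performed `ε`-correctly and `δ`-securely with `ρ` shared random
bits. -/
def HasCDS {n : ℕ} (f : Bits n → Bits n → Bool) (ε δ : ℝ) (ρ : ℕ) : Prop :=
  ∃ P : CDSProtocol n ρ Bool, P.Correct f ε ∧ P.Secure f δ

/-- CDQS of one qubit for `f` can be performed `ε`-correctly and `δ`-securely with `ρ` shared random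
bits. -/
def HasCDQS {n : ℕ} (f : Bits n → Bits n → Bool) (ε δ : ℝ) (ρ : ℕ) : Prop :=
  ∃ P : CDQSProtocol n (Fin 2) (Bits ρ) (Bits ρ),
    P.Correct (sharedBits ρ) f ε ∧ P.Secure (sharedBits ρ) f δ

/-- `f`-routing of one qubit can be performed `ε`-correctly with `E` shared EPR pairs. -/
def HasRouting {n : ℕ} (f : Bits n → Bits n → Bool) (ε : ℝ) (E : ℕ) : Prop :=
  ∃ P : RoutingProtocol n (Fin 2) (Bits E) (Bits E), P.Correct (eprPairs E) f ε

end

/-! The whole theorem rests on one classical primitive: a CDS protocol for a two-bit secret and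
`NQR₂ m` with errors 2^(-k) and O(k² + k m²) random bits for m ≥ 1 (`hasCDSTwo_nqr₂`).

Arithmetic core. Take random r < R and κ < K, and put T = r² + uκ for the secret `false` and T = w
r² + uκ for the secret `true`. If w is a unit square t² modulo u, then dividing r by t modulo u and
translating κ carries one case to the other outside a small fraction of the randomness
(`exists_perm_of_qr`). Otherwise one prime divides every r for which r² is w times a square modulo u
(`exists_prime_dvd_of_not_qr`). Hence T fails to be w times a square modulo u for at least 7/16 of
the r when the secret is `false`, and never when it is `true`: a sound certificate for `false`. T is
affine in the binary digits of w and u, so it splits into one masked additive share per digit. A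
missing digit hides everything, and two shares of the same digit reveal the secret through an extra
`ZMod 2` component. One-time pads indexed by input bits release a share exactly where x and y
differ.

Amplification. Running the gadget on a bit and on its negation turns certificates into decoding with
erasures. Then L random bits are disclosed by gadgets and the secret is masked by q random parities
of them. Ambiguity on 1-inputs has probability at most 4 · 2^(-q) (25/16)^L by a union bound
(`rampProtocol_correct`); leakage on 0-inputs is at most 2 · 2^q (17/32)^L by Fourier analysis
(`sum_abs_rampDist_sub_le`). With q and L proportional to k in the ratio 3 : 4 both decay
exponentially. The parity checks cost qL bits, which is the k² term; the gadgets cost L times O(m²).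

Quantum tasks. For CDQS the qubit is encrypted with a Pauli operator whose two-bit key is the CDS
secret. For routing the same protocol is run coherently on EPR pairs. On 0-inputs the messages
hardly depend on the key, so random strings can be matched across the four keys, message by message
(`CDSProtocol.exists_matching`), and within each matched block the retained registers carry the
qubit, recoverable as in teleportation (`teleport_comp`).

Padding. Part 2 places `NQR₂ m` among inputs of length n with m² ≤ n. Quadratic padding preserves
membership in P_(2), because local preprocessing is arbitrary and polynomials compose. -/

noncomputable section

set_option linter.unusedSectionVars false

/-! ### Trace norm estimates -/

open Matrix in
/-- The trace norm of `Y` is attained on a partial isometry and a unitary. -/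
theorem exists_traceNorm_eq {a : Type} [Fintype a] [DecidableEq a] (Y : Op a) :
    ∃ V W : Op a, V * Vᴴ = 1 ∧ (W * Wᴴ) * (W * Wᴴ) = W * Wᴴ ∧
      traceNorm Y = (Wᴴ * Y * V).trace.re := by
  set h := isHermitian_conjTranspose_mul_self Y with hh
  set V : Op a := (h.eigenvectorUnitary : Op a) with hV
  have hVV : Vᴴ * V = 1 := by
    have := Unitary.coe_star_mul_self h.eigenvectorUnitary
    simpa [star_eq_conjTranspose] using this
  have hVV' : V * Vᴴ = 1 := by
    have := Unitary.coe_mul_star_self h.eigenvectorUnitary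
    simpa [star_eq_conjTranspose] using this
  have hdiag : Vᴴ * (Yᴴ * Y) * V = diagonal fun i => (h.eigenvalues i : ℂ) := by
    have := h.spectral_theorem
    rw [Unitary.conjStarAlgAut_apply] at this
    have h2 : Yᴴ * Y = V * (diagonal fun i => (h.eigenvalues i : ℂ)) * Vᴴ := by
      simpa [star_eq_conjTranspose, Function.comp_def] using this
    calc Vᴴ * (Yᴴ * Y) * V
        = Vᴴ * (V * (diagonal fun i => (h.eigenvalues i : ℂ)) * Vᴴ) * V :=
          congrArg (fun T => Vᴴ * T * V) h2
      _ = (Vᴴ * V) * (diagonal fun i => (h.eigenvalues i : ℂ)) * (Vᴴ * V) := by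
            simp only [Matrix.mul_assoc]
      _ = _ := by rw [hVV, one_mul, mul_one]
  have hnn : ∀ i, 0 ≤ h.eigenvalues i := fun i =>
    (posSemidef_conjTranspose_mul_self Y).eigenvalues_nonneg i
  -- The inverse singular values, with 0⁻¹ = 0. Thus `Y * V * D` is the partial isometry of the
  -- polar decomposition (up to `V`) and kills the kernel of `Y`.
  set D : Op a := diagonal fun i => (((Real.sqrt (h.eigenvalues i))⁻¹ : ℝ) : ℂ) with hD
  have hDH : Dᴴ = D := by
    rw [hD, diagonal_conjTranspose]; congr 1; ext i; simp
  refine ⟨V, Y * V * D, hVV', ?_, ?_⟩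
  · have h1 : (Y * V * D)ᴴ * (Y * V * D) = D * (Vᴴ * (Yᴴ * Y) * V) * D := by
      simp only [conjTranspose_mul, hDH, Matrix.mul_assoc]
    have h2 : D * ((Y * V * D)ᴴ * (Y * V * D)) = D := by
      rw [h1, hdiag, hD]
      simp only [diagonal_mul_diagonal]
      congr 1
      ext i
      by_cases h0 : h.eigenvalues i = 0
      · simp [h0]
      · have hs : Real.sqrt (h.eigenvalues i) ≠ 0 :=
          Real.sqrt_ne_zero'.2 (lt_of_le_of_ne (hnn i) (Ne.symm h0))
        have : (h.eigenvalues i : ℂ) = ((Real.sqrt (h.eigenvalues i) : ℝ) : ℂ) ^ 2 := by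
          rw [← Complex.ofReal_pow, Real.sq_sqrt (hnn i)]
        rw [this]
        have hs' : ((Real.sqrt (h.eigenvalues i) : ℝ) : ℂ) ≠ 0 := by exact_mod_cast hs
        push_cast
        field_simp
    calc _ = Y * V * (D * ((Y * V * D)ᴴ * (Y * V * D))) * (Y * V * D)ᴴ := by
          simp only [Matrix.mul_assoc]
      _ = _ := by rw [h2]
  · have h1 : (Y * V * D)ᴴ * Y * V = D * (Vᴴ * (Yᴴ * Y) * V) := by
      simp only [conjTranspose_mul, hDH, Matrix.mul_assoc]
    rw [h1, hdiag, hD, diagonal_mul_diagonal, trace_diagonal, Complex.re_sum]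
    refine Finset.sum_congr rfl fun i _ => ?_
    rw [← Complex.ofReal_mul, Complex.ofReal_re]
    by_cases h0 : h.eigenvalues i = 0
    · simp [h0]
    · have hs : Real.sqrt (h.eigenvalues i) ≠ 0 :=
        Real.sqrt_ne_zero'.2 (lt_of_le_of_ne (hnn i) (Ne.symm h0))
      rw [eq_inv_mul_iff_mul_eq₀ hs, Real.mul_self_sqrt (hnn i)]

-- Cauchy–Schwarz for the form (A, B) ↦ tr(Aᴴ P B): `V` is unitary, and `W * Wᴴ` is a projection, so
-- both diagonal values are at most tr P.
open Matrix in
theorem abs_re_trace_le {a : Type} [Fintype a] [DecidableEq a] {V W P : Op a}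
    (hV : V * Vᴴ = 1) (hW : (W * Wᴴ) * (W * Wᴴ) = W * Wᴴ) (hP : P.PosSemidef) :
    |(Wᴴ * P * V).trace.re| ≤ P.trace.re := by
  have hVt : (Vᴴ * P * V).trace = P.trace := by
    rw [Matrix.trace_mul_comm, ← Matrix.mul_assoc, hV, one_mul]
  have hWt : (Wᴴ * P * W).trace.re ≤ P.trace.re := by
    have h1 := (hP.mul_mul_conjTranspose_same (1 - W * Wᴴ)).trace_nonneg
    have h2 : ((1 - W * Wᴴ) * P * (1 - W * Wᴴ)ᴴ).trace = P.trace - (Wᴴ * P * W).trace := by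
      have e1 : (1 - W * Wᴴ)ᴴ = 1 - W * Wᴴ := by
        simp [conjTranspose_sub, conjTranspose_mul]
      rw [e1, Matrix.trace_mul_comm, ← Matrix.mul_assoc]
      have e2 : (1 - W * Wᴴ) * (1 - W * Wᴴ) = 1 - W * Wᴴ := by
        rw [Matrix.sub_mul, Matrix.mul_sub, Matrix.mul_sub, hW]; simp
      rw [e2, Matrix.sub_mul, one_mul, trace_sub, Matrix.mul_assoc, Matrix.trace_mul_comm W,
        ]
    rw [h2] at h1
    have := (Complex.le_def.1 h1).1
    simp at this
    linarith
  have hconj : (Vᴴ * P * W).trace.re = (Wᴴ * P * V).trace.re := by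
    have : (Vᴴ * P * W) = (Wᴴ * P * V)ᴴ := by
      simp [conjTranspose_mul, hP.1.eq, Matrix.mul_assoc]
    rw [this, trace_conjTranspose]; simp
  have hVt' : (Vᴴ * P * V).trace.re = P.trace.re := by rw [hVt]
  -- Nonnegativity of the form at W - V and at W + V bounds the cross term from both sides.
  have hm := (Complex.le_def.1 (hP.conjTranspose_mul_mul_same (W - V)).trace_nonneg).1
  have hp := (Complex.le_def.1 (hP.conjTranspose_mul_mul_same (W + V)).trace_nonneg).1
  simp only [conjTranspose_sub, conjTranspose_add, Matrix.sub_mul, Matrix.mul_sub, Matrix.add_mul,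
    Matrix.mul_add, trace_sub, trace_add, Complex.sub_re, Complex.add_re, Complex.zero_re] at hm hp
  rw [abs_le]
  constructor <;> linarith

open Matrix in
/-- The triangle inequality for real combinations of positive operators. -/
theorem traceNorm_sum_smul_le {a ι : Type} [Fintype a] [DecidableEq a] [Fintype ι]
    (c : ι → ℝ) (X : ι → Op a) (hX : ∀ i, (X i).PosSemidef) :
    traceNorm (∑ i, (c i : ℂ) • X i) ≤ ∑ i, |c i| * (X i).trace.re := by
  obtain ⟨V, W, hV, hW, h⟩ := exists_traceNorm_eq (∑ i, (c i : ℂ) • X i)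
  rw [h, Matrix.mul_sum, Matrix.sum_mul, trace_sum, Complex.re_sum]
  refine Finset.sum_le_sum fun i _ => ?_
  rw [Matrix.mul_smul, Matrix.smul_mul, trace_smul, smul_eq_mul, Complex.re_ofReal_mul]
  refine (le_abs_self _).trans ?_
  rw [abs_mul]
  exact mul_le_mul_of_nonneg_left (abs_re_trace_le hV hW (hX i)) (abs_nonneg _)

/-! ### Channels in Kraus form -/

section Kraus
variable {a b c d : Type} [Fintype a] [Fintype b] [Fintype c] [Fintype d]
  [DecidableEq a] [DecidableEq b] [DecidableEq c] [DecidableEq d]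

open Matrix

theorem ampLeft_sub (Φ Ψ : Op a →ₗ[ℂ] Op b) : ampLeft c (Φ - Ψ) = ampLeft c Φ - ampLeft c Ψ := rfl

theorem ampLeft_smul (t : ℂ) (Φ : Op a →ₗ[ℂ] Op b) : ampLeft c (t • Φ) = t • ampLeft c Φ := rfl

theorem ampLeft_sum {ι : Type} [Fintype ι] (Φ : ι → Op a →ₗ[ℂ] Op b) :
    ampLeft c (∑ i, Φ i) = ∑ i, ampLeft c (Φ i) := by
  ext X i j
  simp [ampLeft, LinearMap.sum_apply, Matrix.sum_apply]

theorem trace_ampLeft {Φ : Op a →ₗ[ℂ] Op b} (hΦ : ∀ X, (Φ X).trace = X.trace) (X : Op (c × a)) :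
    (ampLeft c Φ X).trace = X.trace := by
  simp only [Matrix.trace, Matrix.diag, ampLeft, LinearMap.coe_mk, AddHom.coe_mk, Matrix.of_apply,
    Fintype.sum_prod_type]
  refine Finset.sum_congr rfl fun i _ => ?_
  exact hΦ (Matrix.of fun p q => X (i, p) (i, q))

/-- If two maps differ by a real combination of channels, the coefficients bound their distance. -/
theorem diamondDist_le_sum_abs {ι : Type} [Fintype ι] (Φ Ψ : Op a →ₗ[ℂ] Op b) (r : ι → ℝ)
    (Ξ : ι → Op a →ₗ[ℂ] Op b) (hΞ : ∀ i, IsChannel (Ξ i))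
    (h : Φ - Ψ = ∑ i, (r i : ℂ) • Ξ i) {ε : ℝ} (hε : ∑ i, |r i| ≤ ε) :
    diamondDist Φ Ψ ≤ ENNReal.ofReal ε := by
  refine iSup_le fun k => iSup_le fun X => iSup_le fun hX => ENNReal.ofReal_le_ofReal ?_
  have h1 : ampLeft (Fin k) Φ X - ampLeft (Fin k) Ψ X
      = ∑ i, (r i : ℂ) • ampLeft (Fin k) (Ξ i) X := by
    rw [← LinearMap.sub_apply, ← ampLeft_sub, h, ampLeft_sum]
    simp [ampLeft_smul]
  rw [h1]
  refine (traceNorm_sum_smul_le r _ fun i => (hΞ i).1 k X hX.1).trans (le_trans ?_ hε)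
  refine Finset.sum_le_sum fun i _ => ?_
  rw [trace_ampLeft (hΞ i).2, hX.2]
  simp

/-- The map `X ↦ K X Kᴴ`. -/
def krausMap (K : Matrix b a ℂ) : Op a →ₗ[ℂ] Op b where
  toFun X := K * X * Kᴴ
  map_add' X Y := by rw [Matrix.mul_add, Matrix.add_mul]
  map_smul' t X := by simp

theorem krausMap_apply (K : Matrix b a ℂ) (X : Op a) (i j : b) :
    krausMap K X i j = ∑ q, ∑ p, K i p * X p q * star (K j q) := by
  simp [krausMap, Matrix.mul_apply, Finset.sum_mul]

theorem krausMap_mul (K : Matrix c b ℂ) (L : Matrix b a ℂ) :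
    krausMap (K * L) = krausMap K ∘ₗ krausMap L := by
  ext1 X; simp [krausMap, Matrix.mul_assoc, conjTranspose_mul]

theorem krausMap_one : krausMap (1 : Matrix a a ℂ) = LinearMap.id := by
  ext1 X; simp [krausMap]

theorem krausMap_zero : krausMap (0 : Matrix b a ℂ) = 0 := by
  ext1 X; simp [krausMap]

theorem krausMap_smul (t : ℂ) (K : Matrix b a ℂ) :
    krausMap (t • K) = (t * star t) • krausMap K := by
  ext1 X; simp [krausMap, smul_smul, mul_comm]

theorem ampLeft_krausMap (K : Matrix b a ℂ) (X : Op (c × a)) :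
    ampLeft c (krausMap K) X
      = (kroneckerMap (· * ·) (1 : Op c) K) * X * (kroneckerMap (· * ·) (1 : Op c) K)ᴴ := by
  ext ⟨i, i'⟩ ⟨j, j'⟩
  simp only [ampLeft, krausMap, LinearMap.coe_mk, AddHom.coe_mk, Matrix.of_apply, Matrix.mul_apply,
    Matrix.conjTranspose_apply, Matrix.kroneckerMap_apply, Fintype.sum_prod_type, Matrix.one_apply]
  simp [apply_ite (starRingEnd ℂ), Finset.sum_ite_irrel, ite_mul]

/-- Every local operation and every decoder below is a channel through this criterion, so that only
the completeness relation of the Kraus operators has to be checked. -/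
theorem isChannel_sum_krausMap {ι : Type} [Fintype ι] (K : ι → Matrix b a ℂ)
    (hK : ∑ i, (K i)ᴴ * K i = 1) : IsChannel (∑ i, krausMap (K i)) := by
  refine ⟨fun k X hX => ?_, fun X => ?_⟩
  · rw [ampLeft_sum, LinearMap.sum_apply]
    refine Matrix.posSemidef_sum _ fun i _ => ?_
    rw [ampLeft_krausMap]
    exact hX.mul_mul_conjTranspose_same _
  · have : ∀ i, (krausMap (K i) X).trace = ((K i)ᴴ * K i * X).trace := fun i => by
      simp only [krausMap, LinearMap.coe_mk, AddHom.coe_mk]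
      rw [Matrix.trace_mul_comm, Matrix.mul_assoc]
    rw [LinearMap.sum_apply, trace_sum, Finset.sum_congr rfl fun i _ => this i, ← trace_sum,
      ← Matrix.sum_mul, hK, one_mul]

theorem isChannel_krausMap (K : Matrix b a ℂ) (hK : Kᴴ * K = 1) : IsChannel (krausMap K) := by
  have := isChannel_sum_krausMap (fun _ : Unit => K) (by simpa using hK)
  simpa using this

theorem isChannel_id : IsChannel (LinearMap.id : Op a →ₗ[ℂ] Op a) := by
  rw [← krausMap_one]; exact isChannel_krausMap _ (by simp)

end Kraus
end

noncomputable section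

set_option linter.unusedSectionVars false

/-! ### Local operations on a shared resource, in Kraus form -/

section LocalMap
variable {a b c d : Type} [Fintype a] [Fintype b] [Fintype c] [Fintype d]
  [DecidableEq a] [DecidableEq b] [DecidableEq c] [DecidableEq d]

open Matrix

theorem ampLeft_krausMap_eq (K : Matrix b a ℂ) :
    ampLeft c (krausMap K) = krausMap (kroneckerMap (· * ·) (1 : Op c) K) := by
  ext1 X; exact ampLeft_krausMap K X

theorem ampRight_krausMap_eq (K : Matrix b a ℂ) :
    ampRight c (krausMap K) = krausMap (kroneckerMap (· * ·) K (1 : Op c)) := by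
  ext1 X
  ext ⟨i, i'⟩ ⟨j, j'⟩
  simp only [ampRight, krausMap, LinearMap.coe_mk, AddHom.coe_mk, Matrix.of_apply, Matrix.mul_apply,
    Matrix.conjTranspose_apply, Matrix.kroneckerMap_apply, Fintype.sum_prod_type, Matrix.one_apply]
  simp [apply_ite (starRingEnd ℂ)]

theorem adjoinState_vecMulVec (v : b → ℂ) :
    adjoinState a (vecMulVec v (star v))
      = krausMap (Matrix.of fun (i : a × b) (q : a) => if i.1 = q then v i.2 else 0) := by
  ext1 X
  ext ⟨i, i'⟩ ⟨j, j'⟩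
  change X i j * (v i' * star (v j')) = _
  simp [krausMap_apply, apply_ite (starRingEnd ℂ), ite_mul]
  ring

theorem relabel_eq (e : a ≃ b) :
    relabel e = krausMap (Matrix.of fun (i : b) (q : a) => if e.symm i = q then (1 : ℂ) else 0) := by
  ext1 X
  ext i j
  simp [relabel, krausMap_apply, apply_ite (starRingEnd ℂ), ite_mul]

variable {Q L R : Type} [Fintype Q] [Fintype L] [Fintype R]
  [DecidableEq Q] [DecidableEq L] [DecidableEq R]

/-- The effect of local Kraus operators on a pure resource state. -/
def jointKraus (v : L × R → ℂ) (A : Matrix a (Q × L) ℂ) (B : Matrix b R ℂ) :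
    Matrix (a × b) Q ℂ :=
  Matrix.of fun i q => ∑ l, ∑ r, A i.1 (q, l) * B i.2 r * v (l, r)

/-- On a pure resource, single local Kraus operators compose to a single Kraus operator. With
bilinearity and the two decompositions of the resource states below, this reduces every protocol to
matrix identities. -/
theorem localMap_vecMulVec (v : L × R → ℂ) (A : Matrix a (Q × L) ℂ) (B : Matrix b R ℂ) :
    localMap (vecMulVec v (star v)) (krausMap A) (krausMap B) = krausMap (jointKraus v A B) := by
  rw [localMap, ampLeft_krausMap_eq, ampRight_krausMap_eq, relabel_eq, adjoinState_vecMulVec,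
    ← krausMap_mul, ← krausMap_mul, ← krausMap_mul]
  congr 1
  ext ⟨i, i'⟩ q
  simp only [jointKraus, Matrix.mul_apply, Matrix.kroneckerMap_apply, Fintype.sum_prod_type,
    Matrix.one_apply, Matrix.of_apply, Equiv.symm_symm, Equiv.prodAssoc_apply, Prod.mk.injEq]
  simp only [ite_mul, mul_ite, one_mul, mul_one, zero_mul, mul_zero, ite_and,
    Finset.sum_ite_irrel, Finset.sum_const_zero, Finset.sum_ite_eq, Finset.sum_ite_eq',
    Finset.mem_univ, if_true, Finset.mul_sum]
  rw [Finset.sum_comm]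
  refine Finset.sum_congr rfl fun l _ => Finset.sum_congr rfl fun r _ => ?_
  ring

theorem localMap_smul (t : ℂ) (ω : Op (L × R)) (A : Op (Q × L) →ₗ[ℂ] Op a)
    (B : Op R →ₗ[ℂ] Op b) : localMap (t • ω) A B = t • localMap ω A B := by
  ext1 X
  simp [localMap, adjoinState]

theorem localMap_sum_state {ι : Type} [Fintype ι] (ω : ι → Op (L × R))
    (A : Op (Q × L) →ₗ[ℂ] Op a) (B : Op R →ₗ[ℂ] Op b) :
    localMap (∑ i, ω i) A B = ∑ i, localMap (ω i) A B := by
  ext1 X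
  simp [localMap, adjoinState, LinearMap.sum_apply]

theorem localMap_sum_left {ι : Type} [Fintype ι] (ω : Op (L × R))
    (A : ι → Op (Q × L) →ₗ[ℂ] Op a) (B : Op R →ₗ[ℂ] Op b) :
    localMap ω (∑ i, A i) B = ∑ i, localMap ω (A i) B := by
  have : ampRight R (∑ i, A i) = ∑ i, ampRight R (A i) := by
    ext X i j
    simp [ampRight, LinearMap.sum_apply, Matrix.sum_apply]
  ext1 X
  simp [localMap, this, LinearMap.sum_apply]

theorem localMap_sum_right {ι : Type} [Fintype ι] (ω : Op (L × R))
    (A : Op (Q × L) →ₗ[ℂ] Op a) (B : ι → Op R →ₗ[ℂ] Op b) :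
    localMap ω A (∑ i, B i) = ∑ i, localMap ω A (B i) := by
  ext1 X
  simp [localMap, ampLeft_sum, LinearMap.sum_apply]

theorem sharedBits_eq (ρ : ℕ) : sharedBits ρ = ((2 : ℂ) ^ ρ)⁻¹ •
    ∑ t : Bits ρ, vecMulVec (Pi.single (t, t) (1 : ℂ)) (star (Pi.single (t, t) (1 : ℂ))) := by
  ext ⟨i, i'⟩ ⟨j, j'⟩
  simp only [sharedBits, Matrix.of_apply, Matrix.smul_apply, Matrix.sum_apply, vecMulVec_apply,
    Pi.star_apply, Pi.single_apply, Prod.mk.injEq, smul_eq_mul]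
  by_cases h : i = i' ∧ j = i ∧ j' = i'
  · obtain ⟨rfl, rfl, rfl⟩ := h
    simp [apply_ite (starRingEnd ℂ)]
  · rw [if_neg h, Finset.sum_eq_zero, mul_zero]
    intro t _
    by_cases h1 : i = t ∧ i' = t
    · rw [if_neg (fun h2 : j = t ∧ j' = t => h ?_), star_zero, mul_zero]
      obtain ⟨rfl, rfl⟩ := h1
      obtain ⟨rfl, h3⟩ := h2
      exact ⟨rfl, rfl, h3⟩
    · rw [if_neg h1, zero_mul]

theorem eprPairs_eq (E : ℕ) : eprPairs E = ((2 : ℂ) ^ E)⁻¹ •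
    vecMulVec (fun i : Bits E × Bits E => if i.1 = i.2 then (1 : ℂ) else 0)
      (star fun i : Bits E × Bits E => if i.1 = i.2 then (1 : ℂ) else 0) := by
  ext ⟨i, i'⟩ ⟨j, j'⟩
  simp only [eprPairs, Matrix.of_apply, Matrix.smul_apply, vecMulVec_apply, Pi.star_apply,
    smul_eq_mul]
  by_cases h : i = i' <;> by_cases h' : j = j' <;> simp [h, h']

end LocalMap

/-! ### The Pauli operators -/

section Pauli
open Matrix

/-- The Pauli operator `X ^ s.1 * Z ^ s.2`. -/
def pauli (s : Bool × Bool) : Matrix (Fin 2) (Fin 2) ℂ :=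
  match s with
  | (false, false) => !![1, 0; 0, 1]
  | (false, true) => !![1, 0; 0, -1]
  | (true, false) => !![0, 1; 1, 0]
  | (true, true) => !![0, -1; 1, 0]

theorem pauli_conjTranspose_mul (s : Bool × Bool) : (pauli s)ᴴ * pauli s = 1 := by
  obtain ⟨_ | _, _ | _⟩ := s <;> ext i j <;> fin_cases i <;> fin_cases j <;>
    simp [pauli, Matrix.mul_apply, Fin.sum_univ_two]

/-- Completeness of the Pauli basis. It yields both the secrecy of the one-time pad
(`sum_pauli_conj`) and the recovery by teleportation (`teleport_comp`). -/
theorem sum_pauli_mul_star (p q p' q' : Fin 2) :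
    ∑ s, pauli s p q * star (pauli s p' q') = if p = p' ∧ q = q' then 2 else 0 := by
  rw [Fintype.sum_prod_type]
  fin_cases p <;> fin_cases q <;> fin_cases p' <;> fin_cases q' <;>
    simp [pauli] <;> norm_num

theorem sum_pauli_entries_mul_star (s s' : Bool × Bool) :
    ∑ p, ∑ q, pauli s p q * star (pauli s' p q) = if s = s' then 2 else 0 := by
  obtain ⟨_ | _, _ | _⟩ := s <;> obtain ⟨_ | _, _ | _⟩ := s' <;>
    simp [pauli, Fin.sum_univ_two] <;> norm_num

theorem sum_pauli_conj (X : Op (Fin 2)) :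
    ∑ s, pauli s * X * (pauli s)ᴴ = (2 * X.trace) • (1 : Op (Fin 2)) := by
  ext i j
  simp only [Matrix.sum_apply, Matrix.mul_apply, Matrix.conjTranspose_apply, Finset.sum_mul]
  rw [Finset.sum_comm]
  have : ∀ y, ∑ x, ∑ z, pauli x i z * X z y * star (pauli x j y)
      = ∑ z, X z y * if i = j ∧ z = y then 2 else 0 := by
    intro y
    rw [Finset.sum_comm]
    refine Finset.sum_congr rfl fun z _ => ?_
    rw [← sum_pauli_mul_star, Finset.mul_sum]
    exact Finset.sum_congr rfl fun x _ => by ring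
  rw [Finset.sum_congr rfl fun y _ => this y]
  by_cases h : i = j <;> simp [h, Matrix.trace]
  ring

end Pauli
end

noncomputable section

set_option linter.unusedSectionVars false

/-- A mixture of channels whose components other than `Ψ` have small weight is close to `Ψ`. -/
theorem diamondDist_mixture_le {a b ι : Type} [Fintype a] [Fintype b] [DecidableEq a]
    [DecidableEq b] [Fintype ι] (p : ι → ℝ) (hp : ∀ i, 0 ≤ p i) (hp1 : ∑ i, p i = 1)
    (Ξ : ι → Op a →ₗ[ℂ] Op b) (hΞ : ∀ i, IsChannel (Ξ i)) (Ψ : Op a →ₗ[ℂ] Op b)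
    (hΨ : IsChannel Ψ) (good : ι → Prop) [DecidablePred good] (hgood : ∀ i, good i → Ξ i = Ψ)
    {η : ℝ} (hη : ∑ i, (if good i then 0 else p i) ≤ η) :
    diamondDist (∑ i, (p i : ℂ) • Ξ i) Ψ ≤ ENNReal.ofReal (2 * η) := by
  set w := ∑ i, (if good i then 0 else p i) with hw
  have hw0 : 0 ≤ w := Finset.sum_nonneg fun i _ => by split_ifs <;> simp [hp]
  -- The extra index carries -w • Ψ, the weight of Ψ missing from the mixture; it has the same size
  -- w as the bad components, whence the factor 2.
  refine diamondDist_le_sum_abs (ι := Option ι) _ _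
    (fun o => o.elim (-w) fun i => if good i then 0 else p i)
    (fun o => o.elim Ψ Ξ) ?_ ?_ ?_
  · rintro (_ | i)
    · exact hΨ
    · exact hΞ i
  · rw [Fintype.sum_option]
    simp only [Option.elim_none, Option.elim_some]
    have h1 : Ψ = ∑ i, (p i : ℂ) • Ψ := by
      rw [← Finset.sum_smul, ← Complex.ofReal_sum, hp1]; simp
    have h2 : ((-w : ℝ) : ℂ) • Ψ = -∑ i, ((if good i then 0 else p i : ℝ) : ℂ) • Ψ := by
      rw [← Finset.sum_smul, ← Complex.ofReal_sum, ← hw, Complex.ofReal_neg]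
      ext X i j; simp
    rw [h2]
    nth_rewrite 1 [h1]
    rw [← Finset.sum_sub_distrib, neg_add_eq_sub, ← Finset.sum_sub_distrib]
    refine Finset.sum_congr rfl fun i _ => ?_
    by_cases hi : good i
    · simp [hi, hgood i hi]
    · simp [hi]
  · rw [Fintype.sum_option]
    simp only [Option.elim_none, Option.elim_some, abs_neg, abs_of_nonneg hw0]
    have : ∀ i, |(if good i then 0 else p i)| = if good i then 0 else p i := fun i =>
      abs_of_nonneg (by split_ifs <;> simp [hp])
    rw [Finset.sum_congr rfl fun i _ => this i]
    linarith

theorem linearMap_sum_comp {U V W ι : Type} [AddCommGroup U] [AddCommGroup V] [AddCommGroup W]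
    [Module ℂ U] [Module ℂ V] [Module ℂ W] [Fintype ι] (f : ι → V →ₗ[ℂ] W) (g : U →ₗ[ℂ] V) :
    (∑ i, f i) ∘ₗ g = ∑ i, f i ∘ₗ g := by
  ext1 X; simp [LinearMap.sum_apply]

theorem linearMap_comp_sum {U V W ι : Type} [AddCommGroup U] [AddCommGroup V] [AddCommGroup W]
    [Module ℂ U] [Module ℂ V] [Module ℂ W] [Fintype ι] (f : V →ₗ[ℂ] W) (g : ι → U →ₗ[ℂ] V) :
    f ∘ₗ (∑ i, g i) = ∑ i, f ∘ₗ g i := by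
  ext1 X; simp [LinearMap.sum_apply]

/-! ### The quantum one-time pad with a classical side message -/

section OneTimePad
variable {M₀ M₁ : Type} [Fintype M₀] [Fintype M₁] [DecidableEq M₀] [DecidableEq M₁] {E : ℕ}

open Matrix

/-- The encrypted qubit together with the classical message `m`. -/
def padKraus (s : Bool × Bool) (m : M₀ × M₁) : Matrix ((Fin 2 × M₀) × M₁) (Fin 2) ℂ :=
  Matrix.of fun i q => if i.1.2 = m.1 ∧ i.2 = m.2 then pauli s i.1.1 q else 0

theorem padKraus_conjTranspose_mul (s : Bool × Bool) (m : M₀ × M₁) :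
    (padKraus s m)ᴴ * padKraus s m = 1 := by
  rw [← pauli_conjTranspose_mul s]
  ext i j
  simp [padKraus, Matrix.mul_apply, Fintype.sum_prod_type, ite_and, apply_ite (starRingEnd ℂ)]

/-- Alice measures the shared bits, encrypts the qubit and produces her classical message. -/
def aliceMeasure (sec : Bits E → Bool × Bool) (α : Bits E → M₀) (t : Bits E) :
    Matrix (Fin 2 × M₀) (Fin 2 × Bits E) ℂ :=
  Matrix.of fun i j => if j.2 = t ∧ i.2 = α t then pauli (sec t) i.1 j.1 else 0

/-- Bob measures the shared bits and produces his classical message. -/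
def bobMeasure (β : Bits E → M₁) (t : Bits E) : Matrix M₁ (Bits E) ℂ :=
  Matrix.of fun i j => if j = t ∧ i = β t then 1 else 0

theorem sum_aliceMeasure (sec : Bits E → Bool × Bool) (α : Bits E → M₀) :
    ∑ t, (aliceMeasure sec α t)ᴴ * aliceMeasure sec α t = 1 := by
  ext ⟨i, u⟩ ⟨j, v⟩
  have h := fun t => congrFun (congrFun (pauli_conjTranspose_mul (sec t)) i) j
  simp only [Matrix.mul_apply, Matrix.conjTranspose_apply] at h
  simp only [aliceMeasure, Matrix.sum_apply, Matrix.mul_apply, Matrix.conjTranspose_apply,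
    Matrix.of_apply, Fintype.sum_prod_type, ite_and, apply_ite star, star_zero, ite_mul, zero_mul,
    mul_ite, mul_zero, Finset.sum_ite_irrel, Finset.sum_const_zero, Finset.sum_ite_eq,
    Finset.sum_ite_eq', Finset.mem_univ, if_true, h]
  by_cases huv : u = v
  · subst huv; simp [Matrix.one_apply]
  · simp [huv]

theorem sum_bobMeasure (β : Bits E → M₁) :
    ∑ t, (bobMeasure β t)ᴴ * bobMeasure β t = 1 := by
  ext u v
  simp only [bobMeasure, Matrix.sum_apply, Matrix.mul_apply, Matrix.conjTranspose_apply,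
    Matrix.of_apply, ite_and, apply_ite star, star_zero, ite_mul, zero_mul, star_one, one_mul,
    Finset.sum_ite_irrel, Finset.sum_const_zero, Finset.sum_ite_eq,
    Finset.sum_ite_eq', Finset.mem_univ, if_true, Matrix.one_apply]
  by_cases huv : u = v
  · subst huv; simp
  · simp [huv, Ne.symm huv]

/-- Measured shared bits agree on both sides, so the terms with different outcomes vanish and a
uniform mixture over one common string remains. -/
theorem localMap_measure (sec : Bits E → Bool × Bool) (α : Bits E → M₀) (β : Bits E → M₁) :
    localMap (sharedBits E) (∑ t, krausMap (aliceMeasure sec α t))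
        (∑ t, krausMap (bobMeasure β t))
      = ((2 : ℂ) ^ E)⁻¹ • ∑ t, krausMap (padKraus (sec t) (α t, β t)) := by
  rw [sharedBits_eq, localMap_smul, localMap_sum_state]
  congr 1
  refine Finset.sum_congr rfl fun u _ => ?_
  rw [localMap_sum_left]
  simp only [localMap_sum_right, localMap_vecMulVec]
  have key : ∀ t t' : Bits E, jointKraus (Pi.single (u, u) 1) (aliceMeasure sec α t)
      (bobMeasure β t') = if t = u then if t' = u then padKraus (sec u) (α u, β u) else 0
        else 0 := by
    intro t t'
    ext ⟨⟨i, m⟩, m'⟩ q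
    have h1 : jointKraus (Pi.single (u, u) 1) (aliceMeasure sec α t) (bobMeasure β t')
        ((i, m), m') q = aliceMeasure sec α t (i, m) (q, u) * bobMeasure β t' m' u := by
      simp only [jointKraus, Matrix.of_apply, Pi.single_apply, Prod.mk.injEq, mul_ite, mul_one,
        mul_zero, ite_and, Finset.sum_ite_irrel, Finset.sum_const_zero, Finset.sum_ite_eq',
        Finset.mem_univ, if_true]
    rw [h1]
    by_cases ht : t = u
    · subst ht
      by_cases ht' : t' = t
      · subst ht'
        simp [aliceMeasure, bobMeasure, padKraus, ite_and]
        split_ifs <;> rfl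
      · simp [bobMeasure, ht', Ne.symm ht']
    · simp [aliceMeasure, ht, Ne.symm ht]
  simp only [key, apply_ite krausMap, krausMap_zero, Finset.sum_ite_irrel, Finset.sum_const_zero,
    Finset.sum_ite_eq', Finset.mem_univ, if_true]

/-- The decoder that reads the classical message and undoes the encryption. -/
def unpadKraus (dec : M₀ × M₁ → Bool × Bool) (m : M₀ × M₁) :
    Matrix (Fin 2) ((Fin 2 × M₀) × M₁) ℂ :=
  Matrix.of fun q i => if i.1.2 = m.1 ∧ i.2 = m.2 then (pauli (dec m))ᴴ q i.1.1 else 0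

theorem pauli_mul_conjTranspose (s : Bool × Bool) : pauli s * (pauli s)ᴴ = 1 :=
  mul_eq_one_comm.1 (pauli_conjTranspose_mul s)

theorem sum_unpadKraus (dec : M₀ × M₁ → Bool × Bool) :
    ∑ m, (unpadKraus dec m)ᴴ * unpadKraus dec m = 1 := by
  ext ⟨⟨i, m⟩, m'⟩ ⟨⟨j, l⟩, l'⟩
  have h := fun m => congrFun (congrFun (pauli_mul_conjTranspose (dec m)) i) j
  simp only [Matrix.mul_apply, Matrix.conjTranspose_apply] at h
  simp only [unpadKraus, Matrix.sum_apply, Matrix.mul_apply, Matrix.conjTranspose_apply,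
    Matrix.of_apply, Fintype.sum_prod_type, ite_and, apply_ite star, star_zero, ite_mul, zero_mul,
    mul_ite, mul_zero, star_star, Finset.sum_ite_irrel, Finset.sum_const_zero, Finset.sum_ite_eq,
    Finset.mem_univ, if_true, h, Matrix.one_apply, Prod.mk.injEq]
  by_cases h1 : m = l <;> by_cases h2 : m' = l' <;> by_cases h3 : i = j <;>
    simp [h1, h2, h3]

theorem unpadKraus_mul_padKraus (dec : M₀ × M₁ → Bool × Bool) (m m' : M₀ × M₁)
    (s : Bool × Bool) : unpadKraus dec m * padKraus s m'
      = if m = m' then (pauli (dec m))ᴴ * pauli s else 0 := by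
  obtain ⟨m0, m1⟩ := m
  obtain ⟨l0, l1⟩ := m'
  by_cases h : (m0, m1) = (l0, l1)
  · rw [if_pos h, ← h]
    ext i j
    simp [unpadKraus, padKraus, Matrix.mul_apply, Fintype.sum_prod_type, ite_and]
  · rw [if_neg h]
    ext i j
    rw [Matrix.mul_apply, Finset.sum_eq_zero, Matrix.zero_apply]
    rintro ⟨⟨k, k0⟩, k1⟩ _
    simp only [unpadKraus, padKraus, Matrix.of_apply]
    split_ifs with h1 h2
    · exact absurd (Prod.ext (h1.1.symm.trans h2.1) (h1.2.symm.trans h2.2)) h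
    all_goals simp

theorem isChannel_unpad_pad (u s : Bool × Bool) :
    IsChannel (krausMap ((pauli u)ᴴ * pauli s)) := by
  refine isChannel_krausMap _ ?_
  rw [conjTranspose_mul, conjTranspose_conjTranspose, Matrix.mul_assoc,
    ← Matrix.mul_assoc (pauli u), pauli_mul_conjTranspose, one_mul, pauli_conjTranspose_mul]

theorem unpad_comp_pad (dec : M₀ × M₁ → Bool × Bool) (m : M₀ × M₁) (s : Bool × Bool) :
    (∑ m', krausMap (unpadKraus dec m')) ∘ₗ krausMap (padKraus s m)
      = krausMap ((pauli (dec m))ᴴ * pauli s) := by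
  rw [linearMap_sum_comp]
  simp only [← krausMap_mul, unpadKraus_mul_padKraus, apply_ite krausMap, krausMap_zero,
    Finset.sum_ite_eq', Finset.mem_univ, if_true]

end OneTimePad

/-! ### From two-bit secrets to quantum secrets -/

/-- CDS of two bits. -/
def HasCDSTwo {n : ℕ} (f : Bits n → Bits n → Bool) (ε δ : ℝ) (ρ : ℕ) : Prop :=
  ∃ P : CDSProtocol n ρ (Bool × Bool), P.Correct f ε ∧ P.Secure f δ

/-- Shared bits are a two-bit key and a string. -/
def keyEquiv (ρ : ℕ) : Bits (ρ + 2) ≃ (Bool × Bool) × Bits ρ :=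
  Fintype.equivOfCardEq (by simp [pow_succ]; ring)

namespace CDSProtocol
variable {n ρ : ℕ} {S : Type} (P : CDSProtocol n ρ S)

theorem probBits_nonneg (ρ : ℕ) (p : Bits ρ → Prop) : 0 ≤ probBits ρ p := by
  unfold probBits; positivity

theorem probBits_eq_sum (ρ : ℕ) (p : Bits ρ → Prop) [DecidablePred p] :
    probBits ρ p = ∑ r, if p r then ((2 : ℝ) ^ ρ)⁻¹ else 0 := by
  unfold probBits
  rw [← Finset.sum_filter, Finset.sum_const, nsmul_eq_mul, div_eq_mul_inv]
  congr!

/-- Averaging over the randomness is averaging over the message distribution. The values lie in an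
arbitrary real vector space because both numbers and linear maps are averaged. -/
theorem sum_smul_comp_msg {V : Type} [AddCommGroup V] [Module ℝ V] (x y : Bits n) (s : S)
    (g : P.M₀ × P.M₁ → V) :
    ∑ r, ((2 : ℝ) ^ ρ)⁻¹ • g (P.alice x s r, P.bob y r) = ∑ m, P.msgProb x y s m • g m := by
  classical
  have : ∀ m, P.msgProb x y s m • g m
      = ∑ r, if (P.alice x s r, P.bob y r) = m then ((2 : ℝ) ^ ρ)⁻¹ • g m else 0 := by
    intro m
    rw [msgProb, probBits_eq_sum, Finset.sum_smul]
    exact Finset.sum_congr rfl fun r _ => by split_ifs <;> simp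
  rw [Finset.sum_congr rfl fun m _ => this m, Finset.sum_comm]
  refine Finset.sum_congr rfl fun r _ => ?_
  rw [Finset.sum_ite_eq]; simp

theorem msgProb_nonneg (x y : Bits n) (s : S) (m : P.M₀ × P.M₁) : 0 ≤ P.msgProb x y s m :=
  probBits_nonneg _ _

theorem sum_msgProb_mul (x y : Bits n) (s : S) (g : P.M₀ × P.M₁ → ℝ) :
    ∑ m, P.msgProb x y s m * g m = ∑ r, ((2 : ℝ) ^ ρ)⁻¹ * g (P.alice x s r, P.bob y r) :=
  (P.sum_smul_comp_msg x y s g).symm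

theorem sum_msgProb (x y : Bits n) (s : S) : ∑ m, P.msgProb x y s m = 1 := by
  have := P.sum_msgProb_mul x y s fun _ => 1
  simpa using this

theorem sum_msgProb_dec (x y : Bits n) (s : S) (D : P.M₀ × P.M₁ → S) [DecidableEq S] :
    ∑ m, (if D m = s then 0 else P.msgProb x y s m)
      = 1 - probBits ρ fun r => D (P.alice x s r, P.bob y r) = s := by
  rw [eq_sub_iff_add_eq, probBits_eq_sum, ← P.sum_msgProb x y s]
  have h := P.sum_msgProb_mul x y s fun m => if D m = s then 1 else 0
  simp only [mul_ite, mul_one, mul_zero] at h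
  rw [← h, ← Finset.sum_add_distrib]
  refine Finset.sum_congr rfl fun m _ => ?_
  split_ifs <;> simp

end CDSProtocol
end

noncomputable section

set_option linter.unusedSectionVars false

open Matrix

namespace CDSProtocol
variable {n ρ : ℕ} (P : CDSProtocol n ρ (Bool × Bool))

/-- The state of the referee after the quantum secret has been encrypted with a random key that is
the secret of the protocol. -/
def encChan [DecidableEq P.M₀] [DecidableEq P.M₁] (x y : Bits n) :
    Op (Fin 2) →ₗ[ℂ] Op ((Fin 2 × P.M₀) × P.M₁) :=
  ∑ i : (Bool × Bool) × (P.M₀ × P.M₁),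
    ((4⁻¹ * P.msgProb x y i.1 i.2 : ℝ) : ℂ) • krausMap (padKraus i.1 i.2)

theorem sum_padKraus_key [DecidableEq P.M₀] [DecidableEq P.M₁] (x y : Bits n) :
    ((2 : ℂ) ^ (ρ + 2))⁻¹ • ∑ t, krausMap (padKraus (keyEquiv ρ t).1
        (P.alice x (keyEquiv ρ t).1 (keyEquiv ρ t).2, P.bob y (keyEquiv ρ t).2))
      = P.encChan x y := by
  rw [encChan, Equiv.sum_comp (keyEquiv ρ) fun u => krausMap (padKraus (M₀ := P.M₀) (M₁ := P.M₁) u.1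
    (P.alice x u.1 u.2, P.bob y u.2)), Fintype.sum_prod_type (α₁ := Bool × Bool) (α₂ := Bits ρ),
    Fintype.sum_prod_type (α₁ := Bool × Bool) (α₂ := P.M₀ × P.M₁), Finset.smul_sum]
  refine Finset.sum_congr rfl fun s _ => ?_
  dsimp only
  have h := P.sum_smul_comp_msg x y s fun m => krausMap (padKraus s m)
  have h2 : ∀ m, ((4⁻¹ * P.msgProb x y s m : ℝ) : ℂ) • krausMap (padKraus s m)
      = (4⁻¹ : ℂ) • (P.msgProb x y s m • krausMap (padKraus s m)) := by
    intro m
    ext X i j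
    simp
    ring
  simp only [h2]
  rw [← Finset.smul_sum, ← h, Finset.smul_sum, Finset.smul_sum]
  refine Finset.sum_congr rfl fun r _ => ?_
  ext X i j
  simp [pow_add]
  norm_num
  ring

/-- A correctly decoded key undoes the encryption exactly, so the decoded channel is a mixture in
which every component except the identity comes from a decoding error. The factor 2 is that of
`diamondDist_mixture_le`. -/
theorem diamondDist_decode [DecidableEq P.M₀] [DecidableEq P.M₁] (x y : Bits n)
    (D : P.M₀ × P.M₁ → Bool × Bool) {ε : ℝ}
    (h : ∀ s, 1 - ε ≤ probBits ρ fun r => D (P.alice x s r, P.bob y r) = s) :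
    diamondDist ((∑ m, krausMap (unpadKraus D m)) ∘ₗ P.encChan x y) LinearMap.id
      ≤ ENNReal.ofReal (2 * ε) := by
  rw [encChan, linearMap_comp_sum]
  simp only [LinearMap.comp_smul, unpad_comp_pad]
  refine diamondDist_mixture_le _ (fun i => ?_) ?_ _ (fun i => isChannel_unpad_pad _ _) _
    isChannel_id (fun i : (Bool × Bool) × (P.M₀ × P.M₁) => D i.2 = i.1) (fun i hi => ?_) ?_
  · exact mul_nonneg (by norm_num) (P.msgProb_nonneg _ _ _ _)
  · rw [Fintype.sum_prod_type]
    simp [← Finset.mul_sum, P.sum_msgProb]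
  · rw [hi, pauli_conjTranspose_mul, krausMap_one]
  · rw [Fintype.sum_prod_type]
    have : ∀ s, ∑ m, (if D m = s then 0 else 4⁻¹ * P.msgProb x y s m) ≤ 4⁻¹ * ε := by
      intro s
      have h1 := P.sum_msgProb_dec x y s D
      have h2 : ∑ m, (if D m = s then 0 else 4⁻¹ * P.msgProb x y s m)
          = 4⁻¹ * ∑ m, (if D m = s then 0 else P.msgProb x y s m) := by
        rw [Finset.mul_sum]
        exact Finset.sum_congr rfl fun m _ => by split_ifs <;> simp
      rw [h2, h1]
      have := h s
      linarith
    refine (Finset.sum_le_sum fun s _ => this s).trans (le_of_eq ?_)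
    simp

theorem isDensity_simulator [DecidableEq P.M₀] [DecidableEq P.M₁] {q : P.M₀ × P.M₁ → ℝ}
    (hq : q ∈ stdSimplex ℝ (P.M₀ × P.M₁)) :
    IsDensity (Matrix.diagonal fun i : (Fin 2 × P.M₀) × P.M₁ => ((q (i.1.2, i.2) / 2 : ℝ) : ℂ)) := by
  constructor
  · refine Matrix.PosSemidef.diagonal fun i => ?_
    have := hq.1 (i.1.2, i.2)
    exact Complex.zero_le_real.2 (by positivity)
  · rw [Matrix.trace_diagonal, ← Complex.ofReal_sum, Fintype.sum_prod_type, Fintype.sum_prod_type]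
    have h := hq.2
    rw [Fintype.sum_prod_type] at h
    simp only [Finset.sum_const, ← Finset.sum_div, h]
    simp

/-- If the message were independent of the key, averaging over the four Pauli operators would leave
the qubit maximally mixed; hence the simulator has the weights q / 2. -/
theorem discardPrepare_simulator [DecidableEq P.M₀] [DecidableEq P.M₁] (q : P.M₀ × P.M₁ → ℝ) :
    discardPrepare (Fin 2)
        (Matrix.diagonal fun i : (Fin 2 × P.M₀) × P.M₁ => ((q (i.1.2, i.2) / 2 : ℝ) : ℂ))
      = ∑ i : (Bool × Bool) × (P.M₀ × P.M₁),
          ((4⁻¹ * q i.2 : ℝ) : ℂ) • krausMap (padKraus i.1 i.2) := by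
  ext1 X
  have h1 : ∀ m : P.M₀ × P.M₁, ∑ s, krausMap (padKraus s m) X
      = (2 * X.trace) • Matrix.of fun i j =>
        if i.1.2 = m.1 ∧ i.2 = m.2 ∧ j = i then (1 : ℂ) else 0 := by
    intro m
    ext ⟨⟨i, m0⟩, m1⟩ ⟨⟨j, l0⟩, l1⟩
    have h := congrFun (congrFun (sum_pauli_conj X) i) j
    rw [Matrix.sum_apply]
    simp only [krausMap_apply, padKraus, Matrix.of_apply]
    by_cases h2 : m0 = m.1 ∧ m1 = m.2
    · by_cases h3 : l0 = m.1 ∧ l1 = m.2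
      · obtain ⟨rfl, rfl⟩ := h2
        obtain ⟨rfl, rfl⟩ := h3
        simp only [Matrix.sum_apply, Matrix.mul_apply, Matrix.conjTranspose_apply,
          Finset.sum_mul, Matrix.smul_apply, Matrix.one_apply, smul_eq_mul] at h
        simp only [and_self, if_true, Matrix.smul_apply, Matrix.of_apply, smul_eq_mul, true_and,
          Prod.mk.injEq, and_true]
        refine Eq.trans ?_ (h.trans (by simp [eq_comm]))
        rfl
      · have h4 : ¬ (l0 = m0 ∧ l1 = m1) := by
          rintro ⟨rfl, rfl⟩; exact h3 h2
        have h5 : ¬ ((l0 = m0) ∧ l1 = m1) := h4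
        simp only [if_neg h3, star_zero, mul_zero, Finset.sum_const_zero, Matrix.smul_apply,
          Matrix.of_apply, Prod.mk.injEq, smul_eq_mul]
        rw [if_neg, mul_zero]
        rintro ⟨-, -, ⟨-, h6⟩, h7⟩
        exact h4 ⟨h6, h7⟩
    · simp only [if_neg h2, zero_mul, Finset.sum_const_zero, Matrix.smul_apply, Matrix.of_apply,
        smul_eq_mul]
      rw [if_neg, mul_zero]
      rintro ⟨h6, h7, -⟩
      exact h2 ⟨h6, h7⟩
  rw [LinearMap.sum_apply, Fintype.sum_prod_type, Finset.sum_comm]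
  simp only [LinearMap.smul_apply, ← Finset.smul_sum, h1]
  ext i j
  simp only [discardPrepare, LinearMap.smulRight_apply, Matrix.traceLinearMap_apply,
    Matrix.smul_apply, Matrix.sum_apply, Matrix.of_apply, smul_eq_mul, Fintype.sum_prod_type,
    Matrix.diagonal_apply]
  by_cases hij : i = j
  · subst hij
    simp [ite_and]
    ring
  · simp [hij, Ne.symm hij]

/-- The simulated and the real channel are combinations of the same Kraus maps, so the classical
one-norm error, averaged over the key, bounds the diamond distance with no loss. -/
theorem diamondDist_simulator [DecidableEq P.M₀] [DecidableEq P.M₁] (x y : Bits n)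
    (q : P.M₀ × P.M₁ → ℝ) {δ : ℝ} (h : ∀ s, ∑ m, |q m - P.msgProb x y s m| ≤ δ) :
    diamondDist (discardPrepare (Fin 2)
        (Matrix.diagonal fun i : (Fin 2 × P.M₀) × P.M₁ => ((q (i.1.2, i.2) / 2 : ℝ) : ℂ)))
      (P.encChan x y) ≤ ENNReal.ofReal δ := by
  refine diamondDist_le_sum_abs _ _
    (fun i : (Bool × Bool) × (P.M₀ × P.M₁) => 4⁻¹ * (q i.2 - P.msgProb x y i.1 i.2))
    (fun i => krausMap (padKraus i.1 i.2))
    (fun i => isChannel_krausMap _ (padKraus_conjTranspose_mul _ _)) ?_ ?_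
  · rw [discardPrepare_simulator, encChan, ← Finset.sum_sub_distrib]
    refine Finset.sum_congr rfl fun i _ => ?_
    ext X i j
    simp
    ring
  · rw [Fintype.sum_prod_type]
    have : ∀ s, ∑ m, |4⁻¹ * (q m - P.msgProb x y s m)| ≤ 4⁻¹ * δ := by
      intro s
      simp only [abs_mul, ← Finset.mul_sum]
      rw [abs_of_nonneg (by norm_num : (0 : ℝ) ≤ 4⁻¹)]
      exact mul_le_mul_of_nonneg_left (h s) (by norm_num)
    refine (Finset.sum_le_sum fun s _ => this s).trans (le_of_eq ?_)
    simp

end CDSProtocol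

/-- CDQS from CDS of a two-bit key. -/
theorem HasCDSTwo.hasCDQS {n : ℕ} {f : Bits n → Bits n → Bool} {ε δ : ℝ} {ρ : ℕ}
    (h : HasCDSTwo f ε δ ρ) : HasCDQS f (2 * ε) δ (ρ + 2) := by
  classical
  obtain ⟨P, ⟨D, hD⟩, Sim, hSim, hS⟩ := h
  let R : CDQSProtocol n (Fin 2) (Bits (ρ + 2)) (Bits (ρ + 2)) :=
    { M₀ := Fin 2 × P.M₀
      M₁ := P.M₁
      alice := fun x => ∑ t, krausMap (aliceMeasure (fun t => (keyEquiv ρ t).1)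
        (fun t => P.alice x (keyEquiv ρ t).1 (keyEquiv ρ t).2) t)
      bob := fun y => ∑ t, krausMap (bobMeasure (fun t => P.bob y (keyEquiv ρ t).2) t)
      alice_channel := fun x => isChannel_sum_krausMap _ (sum_aliceMeasure _ _)
      bob_channel := fun y => isChannel_sum_krausMap _ (sum_bobMeasure _) }
  have hR : ∀ x y, R.chan (sharedBits (ρ + 2)) x y = P.encChan x y := fun x y =>
    (localMap_measure _ _ _).trans (P.sum_padKraus_key x y)
  refine ⟨R, ⟨fun x y => ∑ m, krausMap (unpadKraus (fun m => D m.1 x m.2 y) m), fun x y =>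
    isChannel_sum_krausMap _ (sum_unpadKraus _), fun x y hxy => ?_⟩,
    fun x y => Matrix.diagonal fun i => ((Sim x y (i.1.2, i.2) / 2 : ℝ) : ℂ),
    fun x y => P.isDensity_simulator (hSim x y), fun x y hxy => ?_⟩
  · rw [hR]
    exact P.diamondDist_decode x y _ fun s => hD s x y hxy
  · rw [hR]
    exact P.diamondDist_simulator x y _ fun s => hS s x y hxy

end

noncomputable section

set_option linter.unusedSectionVars false
set_option linter.unusedSimpArgs false

open Matrix

/-! ### Coherent protocols on EPR pairs -/

section Routing

theorem traceRight_comp_krausMap {a b c : Type} [Fintype a] [Fintype b] [Fintype c]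
    [DecidableEq a] [DecidableEq b] [DecidableEq c] (K : Matrix (a × b) c ℂ) :
    traceRight ∘ₗ krausMap K = ∑ k, krausMap (Matrix.of fun i q => K (i, k) q) := by
  ext X i j
  simp [traceRight, krausMap_apply, LinearMap.sum_apply, Matrix.sum_apply]

theorem traceLeft_comp_krausMap {a b c : Type} [Fintype a] [Fintype b] [Fintype c]
    [DecidableEq a] [DecidableEq b] [DecidableEq c] (K : Matrix (a × b) c ℂ) :
    traceLeft ∘ₗ krausMap K = ∑ k, krausMap (Matrix.of fun i q => K (k, i) q) := by
  ext X i j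
  simp [traceLeft, krausMap_apply, LinearMap.sum_apply, Matrix.sum_apply]

variable {M₀ M₁ : Type} [Fintype M₀] [Fintype M₁] [DecidableEq M₀] [DecidableEq M₁] {E : ℕ}

/-- Alice coherently encrypts the qubit, computes her message, and keeps her register. -/
def aliceIsometry (sec : Bits E → Bool × Bool) (α : Bits E → M₀) :
    Matrix ((Fin 2 × M₀) × Bits E) (Fin 2 × Bits E) ℂ :=
  Matrix.of fun i j => if i.2 = j.2 ∧ i.1.2 = α j.2 then pauli (sec j.2) i.1.1 j.1 else 0

/-- Bob coherently computes his message and hands over his register. -/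
def bobIsometry (β : Bits E → M₁) : Matrix (M₁ × Bits E) (Bits E) ℂ :=
  Matrix.of fun i j => if i.2 = j ∧ i.1 = β j then 1 else 0

theorem aliceIsometry_conjTranspose_mul (sec : Bits E → Bool × Bool) (α : Bits E → M₀) :
    (aliceIsometry sec α)ᴴ * aliceIsometry sec α = 1 := by
  ext ⟨i, u⟩ ⟨j, v⟩
  have h := fun t => congrFun (congrFun (pauli_conjTranspose_mul (sec t)) i) j
  simp only [Matrix.mul_apply, Matrix.conjTranspose_apply] at h
  simp only [aliceIsometry, Matrix.mul_apply, Matrix.conjTranspose_apply,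
    Matrix.of_apply, Fintype.sum_prod_type, ite_and, apply_ite star, star_zero, ite_mul, zero_mul,
    mul_ite, mul_zero, Finset.sum_ite_irrel, Finset.sum_const_zero, Finset.sum_ite_eq,
    Finset.sum_ite_eq', Finset.mem_univ, if_true]
  by_cases huv : u = v
  · subst huv; simpa [Matrix.one_apply] using h u
  · simp [Matrix.one_apply, huv, Ne.symm huv]

theorem bobIsometry_conjTranspose_mul (β : Bits E → M₁) :
    (bobIsometry β)ᴴ * bobIsometry β = 1 := by
  ext u v
  simp only [bobIsometry, Matrix.mul_apply, Matrix.conjTranspose_apply,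
    Matrix.of_apply, Fintype.sum_prod_type, ite_and, apply_ite star, star_zero, ite_mul, zero_mul,
    star_one, one_mul, Finset.sum_ite_irrel, Finset.sum_const_zero, Finset.sum_ite_eq,
    Finset.sum_ite_eq', Finset.mem_univ, if_true, Matrix.one_apply]
  by_cases huv : u = v
  · subst huv; simp
  · simp [huv]

/-- The unnormalized isometry of the whole routing protocol. -/
def routingKraus (sec : Bits E → Bool × Bool) (α : Bits E → M₀) (β : Bits E → M₁) :
    Matrix (((Fin 2 × M₀) × M₁) × (Bits E × Bits E)) (Fin 2) ℂ :=
  Matrix.of fun i q => if i.2.1 = i.2.2 then padKraus (sec i.2.1) (α i.2.1, β i.2.1) i.1 q else 0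

theorem localMap_isometry (sec : Bits E → Bool × Bool) (α : Bits E → M₀) (β : Bits E → M₁) :
    relabel (Equiv.prodProdProdComm (Fin 2 × M₀) (Bits E) M₁ (Bits E)) ∘ₗ
        localMap (eprPairs E) (krausMap (aliceIsometry sec α)) (krausMap (bobIsometry β))
      = ((2 : ℂ) ^ E)⁻¹ • krausMap (routingKraus sec α β) := by
  rw [eprPairs_eq, localMap_smul, localMap_vecMulVec, LinearMap.comp_smul, relabel_eq,
    ← krausMap_mul]
  congr 2
  ext ⟨⟨⟨i, m0⟩, m1⟩, ⟨t1, t2⟩⟩ q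
  simp only [jointKraus, Matrix.mul_apply, Matrix.of_apply, ite_mul, one_mul, zero_mul,
    Finset.sum_ite_eq, Finset.mem_univ, if_true, Equiv.prodProdProdComm_symm,
    Equiv.prodProdProdComm_apply, mul_ite, mul_one, mul_zero, Finset.sum_ite_eq']
  simp only [aliceIsometry, bobIsometry, routingKraus, padKraus, Matrix.of_apply, ite_and, ite_mul,
    mul_ite, mul_one, mul_zero, zero_mul, Finset.sum_ite_irrel, Finset.sum_const_zero,
    Finset.sum_ite_eq, Finset.sum_ite_eq', Finset.mem_univ, if_true]
  by_cases h : t1 = t2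
  · subst h
    simp
    split_ifs <;> rfl
  · simp [h, Ne.symm h]

/-- Tracing out the retained registers dephases the shared string. Bob therefore sees what the CDQS
referee sees, and the same decoder serves on 1-inputs. -/
theorem traceRight_comp_routingKraus (sec : Bits E → Bool × Bool) (α : Bits E → M₀)
    (β : Bits E → M₁) : traceRight ∘ₗ krausMap (routingKraus sec α β)
      = ∑ t, krausMap (padKraus (sec t) (α t, β t)) := by
  rw [traceRight_comp_krausMap, Fintype.sum_prod_type]
  refine Finset.sum_congr rfl fun t _ => ?_
  have : ∀ t', krausMap (Matrix.of fun i q => routingKraus sec α β (i, (t, t')) q)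
      = if t = t' then krausMap (padKraus (sec t) (α t, β t)) else 0 := by
    intro t'
    split_ifs with h
    · subst h
      congr 1
      ext i q
      simp [routingKraus]
    · rw [← krausMap_zero]
      congr 1
      ext i q
      simp [routingKraus, h]
  simp [this]

/-! #### Recovering the qubit from the purification -/

variable {J : Type} [Fintype J]

/-- The basis states in the block `j` of the matching. -/
def blockProj (τ : J → Bool × Bool → Bits E) (j : J) :
    Matrix (Bool × Bool) (Bits E × Bits E) ℂ :=
  Matrix.of fun s i => if i = (τ j s, τ j s) then 1 else 0

/-- The part of the teleportation unitary that recovers the qubit from the key register. -/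
def teleportKraus (a : Fin 2) : Matrix (Fin 2) (Bool × Bool) ℂ :=
  Matrix.of fun p s => (((Real.sqrt 2)⁻¹ : ℝ) : ℂ) * star (pauli s a p)

/-- Replacing an unmatched basis state by a fixed one. -/
def resetKraus (U : Finset (Bits E × Bits E)) (k : Bits E × Bits E) :
    Matrix (Fin 2) (Bits E × Bits E) ℂ :=
  Matrix.of fun p i => if k ∈ U ∧ i = k ∧ p = 0 then 1 else 0

open Classical in
/-- The unmatched basis states. -/
def unmatched (τ : J → Bool × Bool → Bits E) : Finset (Bits E × Bits E) :=
  Finset.univ.filter fun i => ¬ ∃ u : J × (Bool × Bool), i = (τ u.1 u.2, τ u.1 u.2)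

theorem inv_sqrt_two_mul_self : (((Real.sqrt 2)⁻¹ : ℝ) : ℂ) * (((Real.sqrt 2)⁻¹ : ℝ) : ℂ) = 2⁻¹ := by
  rw [← Complex.ofReal_mul, ← mul_inv, Real.mul_self_sqrt (by norm_num)]
  norm_num

theorem sum_teleportKraus : ∑ a, (teleportKraus a)ᴴ * teleportKraus a = 1 := by
  ext s s'
  have h : star (((Real.sqrt 2)⁻¹ : ℝ) : ℂ) = (((Real.sqrt 2)⁻¹ : ℝ) : ℂ) := Complex.conj_ofReal _
  simp only [Matrix.sum_apply, Matrix.mul_apply, Matrix.conjTranspose_apply, teleportKraus,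
    Matrix.of_apply, star_mul', star_star, h]
  calc _ = 2⁻¹ * ∑ a, ∑ p, pauli s a p * star (pauli s' a p) := by
        simp only [Finset.mul_sum]
        refine Finset.sum_congr rfl fun a _ => Finset.sum_congr rfl fun p _ => ?_
        rw [← inv_sqrt_two_mul_self]; ring
    _ = _ := by
        rw [sum_pauli_entries_mul_star, Matrix.one_apply]
        split_ifs <;> simp

/-- Alice's recovery operation. -/
def recovery (τ : J → Bool × Bool → Bits E) : Op (Bits E × Bits E) →ₗ[ℂ] Op (Fin 2) :=
  ∑ k : J × Fin 2 ⊕ Bits E × Bits E, krausMap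
    (Sum.elim (fun k => teleportKraus k.2 * blockProj τ k.1) (resetKraus (unmatched τ)) k)

/-- Injectivity makes the blocks disjoint. They exhaust the matched diagonal basis states, and the
reset operators account for all others, including the off-diagonal ones. -/
theorem isChannel_recovery (τ : J → Bool × Bool → Bits E)
    (hτ : Function.Injective fun u : J × (Bool × Bool) => τ u.1 u.2) :
    IsChannel (recovery τ) := by
  classical
  refine isChannel_sum_krausMap _ ?_
  rw [Fintype.sum_sum_type]
  simp only [Sum.elim_inl, Sum.elim_inr]
  have h1 : ∑ k : J × Fin 2, (teleportKraus k.2 * blockProj τ k.1)ᴴ *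
      (teleportKraus k.2 * blockProj τ k.1)
      = Matrix.diagonal fun i => if i ∈ unmatched τ then 0 else 1 := by
    have e1 : ∀ j, ∑ a, (teleportKraus a * blockProj τ j)ᴴ * (teleportKraus a * blockProj τ j)
        = (blockProj τ j)ᴴ * blockProj τ j := by
      intro j
      calc _ = (blockProj τ j)ᴴ * (∑ a, (teleportKraus a)ᴴ * teleportKraus a) * blockProj τ j := by
            simp only [Matrix.mul_sum, Matrix.sum_mul, conjTranspose_mul, Matrix.mul_assoc]
        _ = _ := by rw [sum_teleportKraus, Matrix.mul_one]
    rw [Fintype.sum_prod_type, Finset.sum_congr rfl fun j _ => e1 j]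
    ext i i'
    simp only [Matrix.sum_apply, Matrix.mul_apply, blockProj, Matrix.conjTranspose_apply,
      Matrix.of_apply, apply_ite star, star_one, star_zero, ite_mul, one_mul, zero_mul]
    rw [← Fintype.sum_prod_type' (f := fun j s => if i = (τ j s, τ j s) then
      if i' = (τ j s, τ j s) then (1 : ℂ) else 0 else 0), Matrix.diagonal_apply]
    by_cases hi : i ∈ unmatched τ
    · rw [if_pos hi, ite_self, Finset.sum_eq_zero]
      intro u _
      rw [if_neg]
      intro h
      exact (Finset.mem_filter.1 hi).2 ⟨u, h⟩
    · have : ∃ u : J × (Bool × Bool), i = (τ u.1 u.2, τ u.1 u.2) := by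
        by_contra hc
        exact hi (Finset.mem_filter.2 ⟨Finset.mem_univ _, hc⟩)
      obtain ⟨u, hu⟩ := this
      rw [if_neg hi, Finset.sum_eq_single u]
      · rw [if_pos hu, hu]; simp [eq_comm]
      · intro v _ hv
        rw [if_neg]
        intro h
        exact hv (hτ (Prod.ext_iff.1 (h.symm.trans hu)).1)
      · simp
  have h2 : ∑ k, (resetKraus (unmatched τ) k)ᴴ * resetKraus (unmatched τ) k
      = Matrix.diagonal fun i => if i ∈ unmatched τ then 1 else 0 := by
    ext i i'
    simp only [Matrix.sum_apply, Matrix.mul_apply, resetKraus, Matrix.conjTranspose_apply,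
      Matrix.of_apply, Matrix.diagonal_apply]
    rw [Finset.sum_eq_single i]
    · by_cases hi : i ∈ unmatched τ <;> by_cases hii : i = i' <;> simp [hi, hii, eq_comm]
    · intro k _ hk
      simp [Ne.symm hk]
    · simp
  rw [h1, h2, Matrix.diagonal_add, ← Matrix.diagonal_one]
  congr 1
  ext i
  split_ifs <;> simp

/-- In a block the message is `μ j` for all four keys, so it carries no information on the key.
Completeness of the Pauli operators leaves √2 times the identity on the qubit, for the single
outcome with b = a. Two values of `a` with weight |√2|² = 2 give 4, one unit for each string of the
block. -/
theorem teleport_comp (τ : J → Bool × Bool → Bits E) (sec : Bits E → Bool × Bool)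
    (α : Bits E → M₀) (β : Bits E → M₁) (μ : J → M₀ × M₁)
    (hsec : ∀ j s, sec (τ j s) = s) (hμ : ∀ j s, (α (τ j s), β (τ j s)) = μ j) (j : J) :
    ∑ a, ∑ k, krausMap (teleportKraus a * blockProj τ j *
        Matrix.of fun i q => routingKraus sec α β (k, i) q) = (4 : ℂ) • LinearMap.id := by
  have h : ∀ a (k : (Fin 2 × M₀) × M₁), teleportKraus a * blockProj τ j *
        (Matrix.of fun i q => routingKraus sec α β (k, i) q)
      = if k = ((a, (μ j).1), (μ j).2) then (Real.sqrt 2 : ℂ) • (1 : Op (Fin 2)) else 0 := by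
    rintro a ⟨⟨b, m0⟩, m1⟩
    have e1 : blockProj τ j * (Matrix.of fun i q => routingKraus sec α β (((b, m0), m1), i) q)
        = Matrix.of fun s q => if m0 = (μ j).1 ∧ m1 = (μ j).2 then pauli s b q else 0 := by
      ext s q
      have := hμ j s
      rw [Prod.ext_iff] at this
      dsimp only at this
      simp only [blockProj, Matrix.mul_apply, Matrix.of_apply, ite_mul, one_mul, zero_mul,
        Finset.sum_ite_eq', Finset.mem_univ, if_true, routingKraus, padKraus, this.1, this.2,
        hsec]
    rw [Matrix.mul_assoc, e1]
    ext p q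
    have e2 := sum_pauli_mul_star b q a p
    by_cases hm : m0 = (μ j).1 ∧ m1 = (μ j).2
    · simp only [Matrix.mul_apply, teleportKraus, Matrix.of_apply, if_pos hm, mul_assoc,
        ← Finset.mul_sum]
      rw [Finset.sum_congr rfl fun s _ => mul_comm (star (pauli s a p)) (pauli s b q), e2]
      have e3 : (((Real.sqrt 2)⁻¹ : ℝ) : ℂ) * 2 = Real.sqrt 2 := by
        rw [show (2 : ℂ) = ((2 : ℝ) : ℂ) by norm_num, ← Complex.ofReal_mul]
        congr 1
        rw [inv_mul_eq_iff_eq_mul₀ (by positivity), Real.mul_self_sqrt (by norm_num)]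
      obtain ⟨rfl, rfl⟩ := hm
      by_cases hb : b = a
      · subst hb
        by_cases hq : p = q
        · subst hq; simpa using e3
        · simp [hq, Ne.symm hq]
      · simp [hb]
    · rw [if_neg]
      · simp [Matrix.mul_apply, hm]
      · intro h
        simp only [Prod.mk.injEq] at h
        exact hm ⟨h.1.2, h.2⟩
  simp only [h, apply_ite krausMap, krausMap_zero, Finset.sum_ite_eq', Finset.mem_univ, if_true,
    krausMap_smul, krausMap_one]
  have : (Real.sqrt 2 : ℂ) * star (Real.sqrt 2 : ℂ) = 2 := by
    rw [show star (Real.sqrt 2 : ℂ) = (Real.sqrt 2 : ℂ) from Complex.conj_ofReal _,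
      ← Complex.ofReal_mul, Real.mul_self_sqrt (by norm_num)]
    norm_num
  rw [this, Fin.sum_univ_two]
  ext X p q
  simp
  ring

/-- Discarding a qubit and preparing a basis state. -/
theorem sum_reset_pauli (s : Bool × Bool) :
    IsChannel (∑ b : Fin 2, krausMap (Matrix.of fun p q : Fin 2 =>
      if p = 0 then pauli s b q else 0)) := by
  refine isChannel_sum_krausMap _ ?_
  rw [← pauli_conjTranspose_mul s]
  ext i j
  simp [Matrix.mul_apply, Matrix.sum_apply, apply_ite (starRingEnd ℂ)]

/-- The unmatched part contributes some channel that destroys the qubit; only its weight will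
matter. -/
theorem reset_comp (U : Finset (Bits E × Bits E)) (sec : Bits E → Bool × Bool)
    (α : Bits E → M₀) (β : Bits E → M₁) (t t' : Bits E) :
    ∑ k, krausMap (resetKraus U (t, t') * Matrix.of fun i q => routingKraus sec α β (k, i) q)
      = if (t, t') ∈ U ∧ t = t' then ∑ b : Fin 2, krausMap (Matrix.of fun p q : Fin 2 =>
          if p = 0 then pauli (sec t) b q else 0) else 0 := by
  have h : ∀ k, resetKraus U (t, t') * (Matrix.of fun i q => routingKraus sec α β (k, i) q)
      = if (t, t') ∈ U ∧ t = t' ∧ k.1.2 = α t ∧ k.2 = β t then (Matrix.of fun p q : Fin 2 =>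
          if p = 0 then pauli (sec t) k.1.1 q else 0) else 0 := by
    intro k
    ext p q
    have e : (resetKraus U (t, t') * (Matrix.of fun i q => routingKraus sec α β (k, i) q)) p q
        = if (t, t') ∈ U ∧ p = 0 then routingKraus sec α β (k, (t, t')) q else 0 := by
      rw [Matrix.mul_apply, Finset.sum_eq_single (t, t')]
      · simp [resetKraus]
      · intro i _ hi
        simp [resetKraus, hi]
      · simp
    rw [e]
    by_cases h1 : (t, t') ∈ U
    · by_cases h2 : t = t'
      · subst h2
        by_cases h3 : k.1.2 = α t ∧ k.2 = β t
        · simp [routingKraus, padKraus, h1, h3]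
        · simp [routingKraus, padKraus, h1, h3]
      · simp [routingKraus, h1, h2]
    · simp [h1]
  simp only [h]
  by_cases h1 : (t, t') ∈ U ∧ t = t'
  · simp only [h1, true_and, if_true, Fintype.sum_prod_type, apply_ite krausMap, krausMap_zero,
      ite_and, Finset.sum_ite_eq', Finset.mem_univ, Finset.sum_ite_irrel, Finset.sum_const_zero]
  · rw [if_neg h1, Finset.sum_eq_zero]
    intro k _
    rw [if_neg, krausMap_zero]
    rintro ⟨h2, h3, -⟩
    exact h1 ⟨h2, h3⟩

end Routing
end

noncomputable section

set_option linter.unusedSectionVars false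

open Matrix

/-! ### Routing on 0-inputs by matching the randomness -/

section Recovery
variable {M₀ M₁ : Type} [Fintype M₀] [Fintype M₁] [DecidableEq M₀] [DecidableEq M₁] {E : ℕ}
  {J : Type} [Fintype J]

/-- Each block acts as the identity with weight 4 / 2^E, so the recovered channel is the identity
except on the fraction of strings left unmatched. -/
theorem diamondDist_recovery (τ : J → Bool × Bool → Bits E)
    (hτ : Function.Injective fun u : J × (Bool × Bool) => τ u.1 u.2) (sec : Bits E → Bool × Bool)
    (α : Bits E → M₀) (β : Bits E → M₁) (μ : J → M₀ × M₁)
    (hsec : ∀ j s, sec (τ j s) = s) (hμ : ∀ j s, (α (τ j s), β (τ j s)) = μ j) {η : ℝ}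
    (hη : 1 - 4 * Fintype.card J / 2 ^ E ≤ η) :
    diamondDist (recovery τ ∘ₗ traceLeft ∘ₗ (((2 : ℂ) ^ E)⁻¹ • krausMap (routingKraus sec α β)))
      LinearMap.id ≤ ENNReal.ofReal (2 * η) := by
  classical
  have hsum : recovery τ ∘ₗ traceLeft ∘ₗ (((2 : ℂ) ^ E)⁻¹ • krausMap (routingKraus sec α β))
      = ∑ i : J ⊕ Bits E, ((i.elim (fun _ => 4 * ((2 : ℝ) ^ E)⁻¹)
          (fun t => if (t, t) ∈ unmatched τ then ((2 : ℝ) ^ E)⁻¹ else 0) : ℝ) : ℂ) •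
          (i.elim (fun _ => LinearMap.id) (fun t => ∑ b : Fin 2, krausMap
            (Matrix.of fun p q : Fin 2 => if p = 0 then pauli (sec t) b q else 0)) :
            Op (Fin 2) →ₗ[ℂ] Op (Fin 2)) := by
    rw [LinearMap.comp_smul, LinearMap.comp_smul, traceLeft_comp_krausMap, recovery,
      linearMap_sum_comp, Fintype.sum_sum_type, Fintype.sum_sum_type]
    simp only [linearMap_comp_sum, ← krausMap_mul, Sum.elim_inl, Sum.elim_inr]
    rw [Fintype.sum_prod_type (α₁ := J) (α₂ := Fin 2)]
    simp only [teleport_comp τ sec α β μ hsec hμ]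
    rw [Fintype.sum_prod_type (α₁ := Bits E) (α₂ := Bits E)]
    simp only [reset_comp]
    rw [smul_add, Finset.smul_sum, Finset.smul_sum]
    congr 1
    · refine Finset.sum_congr rfl fun j _ => ?_
      ext X p q
      simp
      ring
    · refine Finset.sum_congr rfl fun t _ => ?_
      rw [Finset.sum_eq_single t]
      · by_cases h : (t, t) ∈ unmatched τ
        · ext X p q
          simp [h]
        · ext X p q
          simp [h]
      · intro t' _ ht'
        rw [if_neg]
        exact fun h => ht' h.2.symm
      · simp
  have hcard : ∑ t, (if (t, t) ∈ unmatched τ then ((2 : ℝ) ^ E)⁻¹ else 0)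
      = 1 - 4 * Fintype.card J / 2 ^ E := by
    have h1 : ∀ t, (if (t, t) ∈ unmatched τ then ((2 : ℝ) ^ E)⁻¹ else 0)
        = ((2 : ℝ) ^ E)⁻¹ - if t ∈ Finset.univ.image
          (fun u : J × (Bool × Bool) => τ u.1 u.2) then ((2 : ℝ) ^ E)⁻¹ else 0 := by
      intro t
      have : (t, t) ∈ unmatched τ ↔ ¬ t ∈ Finset.univ.image
          (fun u : J × (Bool × Bool) => τ u.1 u.2) := by
        simp only [unmatched, Finset.mem_filter, Finset.mem_univ, true_and, Finset.mem_image,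
          Prod.mk.injEq, and_self, eq_comm]
      by_cases h : t ∈ Finset.univ.image (fun u : J × (Bool × Bool) => τ u.1 u.2)
      · rw [if_neg (fun h' => this.1 h' h), if_pos h, sub_self]
      · rw [if_pos (this.2 h), if_neg h, sub_zero]
    rw [Finset.sum_congr rfl fun t _ => h1 t, Finset.sum_sub_distrib, ← Finset.sum_filter,
      Finset.filter_mem_eq_inter, Finset.univ_inter, Finset.sum_const, Finset.sum_const,
      Finset.card_image_of_injective _ hτ]
    simp [Fintype.card_prod]
    ring
  rw [hsum]
  refine diamondDist_mixture_le _ ?_ ?_ _ ?_ _ isChannel_id (fun i => i.isLeft = true) ?_ ?_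
  · rintro (j | t)
    · simp only [Sum.elim_inl]; positivity
    · simp only [Sum.elim_inr]; split_ifs <;> positivity
  · rw [Fintype.sum_sum_type]
    simp only [Sum.elim_inl, Sum.elim_inr, hcard]
    simp
    ring
  · rintro (j | t)
    · exact isChannel_id
    · exact sum_reset_pauli _
  · rintro (j | t) h
    · rfl
    · simp at h
  · rw [Fintype.sum_sum_type]
    simpa [hcard] using hη

end Recovery

/-- Few keys are excluded when the randomness is matched across the keys, message by message. -/
theorem CDSProtocol.exists_matching {n ρ : ℕ} (P : CDSProtocol n ρ (Bool × Bool)) (x y : Bits n)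
    (q : P.M₀ × P.M₁ → ℝ) (hq : ∑ m, q m = 1) {δ : ℝ}
    (h : ∀ s, ∑ m, |q m - P.msgProb x y s m| ≤ δ) :
    ∃ (J : Type) (_ : Fintype J) (μ : J → P.M₀ × P.M₁) (r : J → Bool × Bool → Bits ρ),
      (∀ s, Function.Injective fun j => r j s) ∧
      (∀ j s, (P.alice x s (r j s), P.bob y (r j s)) = μ j) ∧
      1 - 4 * δ ≤ Fintype.card J / 2 ^ ρ := by
  classical
  let R : Bool × Bool → P.M₀ × P.M₁ → Finset (Bits ρ) := fun s m =>
    Finset.univ.filter fun r => (P.alice x s r, P.bob y r) = m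
  have hR : ∀ s m, P.msgProb x y s m = ((R s m).card : ℝ) / 2 ^ ρ := by
    intro s m
    unfold msgProb probBits
    congr!
  have hmin : ∀ m, ∃ s, ∀ s', (R s m).card ≤ (R s' m).card := by
    intro m
    obtain ⟨s, -, hs⟩ := Finset.exists_min_image Finset.univ (fun s => (R s m).card)
      ⟨(false, false), Finset.mem_univ _⟩
    exact ⟨s, fun s' => hs s' (Finset.mem_univ _)⟩
  choose σ hσ using hmin
  -- For each message, the key `σ m` that produces it least often fixes how many disjoint quadruples
  -- of strings, one per key, can be formed.
  refine ⟨Σ m, Fin (R (σ m) m).card, inferInstance, fun j => j.1,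
    fun j s => ((R s j.1).equivFin.symm (Fin.castLE (hσ j.1 s) j.2)).1, ?_, ?_, ?_⟩
  · rintro s ⟨m, i⟩ ⟨m', i'⟩ hij
    dsimp only at hij
    have h1 := (Finset.mem_filter.1 ((R s m).equivFin.symm (Fin.castLE (hσ m s) i)).2).2
    have h2 := (Finset.mem_filter.1 ((R s m').equivFin.symm (Fin.castLE (hσ m' s) i')).2).2
    rw [hij, h2] at h1
    subst h1
    have := (R s m').equivFin.symm.injective (Subtype.ext hij)
    rw [Fin.castLE_inj] at this
    rw [this]
  · rintro ⟨m, i⟩ s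
    exact (Finset.mem_filter.1 ((R s m).equivFin.symm (Fin.castLE (hσ m s) i)).2).2
  · rw [Fintype.card_sigma]
    simp only [Fintype.card_fin, Nat.cast_sum, Finset.sum_div, ← hR]
    -- The deviation at the minimizing key is bounded by the sum over all four keys, which costs the
    -- factor 4 in 4δ.
    have h1 : ∀ m, q m - ∑ s, |q m - P.msgProb x y s m| ≤ P.msgProb x y (σ m) m := by
      intro m
      have h2 := Finset.single_le_sum (f := fun s => |q m - P.msgProb x y s m|)
        (fun s _ => abs_nonneg _) (Finset.mem_univ (σ m))
      have h3 := le_abs_self (q m - P.msgProb x y (σ m) m)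
      linarith
    have h4 := Finset.sum_le_sum fun m (_ : m ∈ Finset.univ) => h1 m
    rw [Finset.sum_sub_distrib, hq, Finset.sum_comm] at h4
    have h5 := Finset.sum_le_sum fun s (_ : s ∈ Finset.univ) => h s
    simp at h5
    have h6 : ∑ s : Bool × Bool, ∑ m, |q m - P.msgProb x y s m| ≤ 4 * δ := by
      refine (Finset.sum_le_sum fun s _ => h s).trans (le_of_eq ?_)
      simp
    linarith

open Classical in
/-- The routing protocol that encrypts the qubit with the key and hides the key with `P`. -/
def CDSProtocol.routing {n ρ : ℕ} (P : CDSProtocol n ρ (Bool × Bool)) :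
    RoutingProtocol n (Fin 2) (Bits (ρ + 2)) (Bits (ρ + 2)) where
  M₀ := Fin 2 × P.M₀
  M₀' := Bits (ρ + 2)
  M₁ := P.M₁
  M₁' := Bits (ρ + 2)
  alice x := krausMap (aliceIsometry (fun t => (keyEquiv ρ t).1)
    (fun t => P.alice x (keyEquiv ρ t).1 (keyEquiv ρ t).2))
  bob y := krausMap (bobIsometry (fun t => P.bob y (keyEquiv ρ t).2))
  alice_channel _ := isChannel_krausMap _ (aliceIsometry_conjTranspose_mul _ _)
  bob_channel _ := isChannel_krausMap _ (bobIsometry_conjTranspose_mul _)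

open Classical in
theorem CDSProtocol.routing_chan {n ρ : ℕ} (P : CDSProtocol n ρ (Bool × Bool)) (x y : Bits n) :
    P.routing.chan (eprPairs (ρ + 2)) x y = ((2 : ℂ) ^ (ρ + 2))⁻¹ •
      krausMap (routingKraus (fun t => (keyEquiv ρ t).1)
        (fun t => P.alice x (keyEquiv ρ t).1 (keyEquiv ρ t).2)
        (fun t => P.bob y (keyEquiv ρ t).2)) :=
  localMap_isometry (fun t => (keyEquiv ρ t).1)
    (fun t => P.alice x (keyEquiv ρ t).1 (keyEquiv ρ t).2) (fun t => P.bob y (keyEquiv ρ t).2)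

/-- `f`-routing from CDS of a two-bit key. -/
theorem HasCDSTwo.hasRouting {n : ℕ} {f : Bits n → Bits n → Bool} {ε δ γ : ℝ} {ρ : ℕ}
    (h : HasCDSTwo f ε δ ρ) (hε : 2 * ε ≤ γ) (hδ : 8 * δ ≤ γ) : HasRouting f γ (ρ + 2) := by
  classical
  obtain ⟨P, ⟨D, hD⟩, Sim, hSim, hS⟩ := h
  refine ⟨P.routing, ⟨fun x y => ∑ m, krausMap (unpadKraus (fun m => D m.1 x m.2 y) m), fun x y =>
    isChannel_sum_krausMap _ (sum_unpadKraus _), fun x y hxy => ?_⟩, ?_⟩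
  · have h1 := (P.diamondDist_decode x y (fun m => D m.1 x m.2 y)
      fun s => hD s x y hxy).trans (ENNReal.ofReal_le_ofReal hε)
    rw [← P.sum_padKraus_key, ← traceRight_comp_routingKraus, ← LinearMap.comp_smul] at h1
    rw [P.routing_chan]
    exact h1
  · have key : ∀ x y, ∃ D' : Op (Bits (ρ + 2) × Bits (ρ + 2)) →ₗ[ℂ] Op (Fin 2), IsChannel D' ∧
        (f x y = false → diamondDist (D' ∘ₗ traceLeft ∘ₗ P.routing.chan (eprPairs (ρ + 2)) x y)
          LinearMap.id ≤ ENNReal.ofReal γ) := by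
      intro x y
      by_cases hxy : f x y = false
      · obtain ⟨J, _, μ, r, hr, hμ, hJ⟩ := P.exists_matching x y (Sim x y) (hSim x y).2
          fun s => hS s x y hxy
        have hinj : Function.Injective fun u : J × (Bool × Bool) =>
            (keyEquiv ρ).symm (u.2, r u.1 u.2) := by
          rintro ⟨j, s⟩ ⟨j', s'⟩ h
          have h1 := (keyEquiv ρ).symm.injective h
          simp only [Prod.mk.injEq] at h1
          obtain ⟨rfl, h2⟩ := h1
          rw [hr s h2]
        refine ⟨recovery fun j s => (keyEquiv ρ).symm (s, r j s), isChannel_recovery _ hinj,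
          fun _ => ?_⟩
        rw [P.routing_chan]
        refine (diamondDist_recovery _ hinj _ _ _ μ (by simp) (by simpa using hμ)
          (η := 4 * δ) ?_).trans (ENNReal.ofReal_le_ofReal (by linarith))
        have : 4 * (Fintype.card J : ℝ) / 2 ^ (ρ + 2) = Fintype.card J / 2 ^ ρ := by
          rw [pow_add]; field_simp; ring
        rw [this]
        linarith
      -- On 1-inputs any channel will do; with no blocks at all, the recovery merely resets the
      -- qubit.
      · exact ⟨recovery fun (j : Empty) => j.elim, isChannel_recovery _ fun u => u.1.elim,
          fun h => absurd h hxy⟩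
    choose D' h1 h2 using key
    exact ⟨D', h1, h2⟩

/-- CDS of one bit from CDS of two bits. -/
theorem HasCDSTwo.hasCDS {n : ℕ} {f : Bits n → Bits n → Bool} {ε δ : ℝ} {ρ : ℕ}
    (h : HasCDSTwo f ε δ ρ) : HasCDS f ε δ ρ := by
  obtain ⟨P, ⟨D, hD⟩, Sim, hSim, hS⟩ := h
  let P' : CDSProtocol n ρ Bool :=
    { M₀ := P.M₀
      M₁ := P.M₁
      alice := fun x s r => P.alice x (s, false) r
      bob := P.bob }
  refine ⟨P', ⟨fun m₀ x m₁ y => (D m₀ x m₁ y).1, fun s x y hxy => ?_⟩, Sim, hSim,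
    fun s x y hxy => hS (s, false) x y hxy⟩
  refine (hD (s, false) x y hxy).trans ?_
  unfold probBits
  gcongr
  intro hr
  exact congrArg Prod.fst hr

end

noncomputable section

/-! ### Squares modulo `u` -/

theorem qr_of_coprime_mul {w a b : ℕ} (hab : Nat.Coprime a b) (ha : QR w a) (hb : QR w b) :
    QR w (a * b) := by
  obtain ⟨ha1, r, hr⟩ := ha
  obtain ⟨hb1, s, hs⟩ := hb
  refine ⟨Nat.Coprime.mul_right ha1 hb1, ?_⟩
  obtain ⟨k, hk1, hk2⟩ := Nat.chineseRemainder hab r s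
  exact ⟨k, (Nat.modEq_and_modEq_iff_modEq_mul hab).1
    ⟨hr.trans (hk1.symm.pow 2), hs.trans (hk2.symm.pow 2)⟩⟩

/-- A non-residue modulo `u` is a non-residue modulo a prime power dividing `u`. -/
theorem exists_prime_pow_not_qr {w u : ℕ} (hu : u ≠ 0) (h : ¬ QR w u) :
    ∃ p k, p.Prime ∧ k ≠ 0 ∧ p ^ k ∣ u ∧ ¬ QR w (p ^ k) := by
  induction u using Nat.recOnPosPrimePosCoprime with
  | prime_pow p n hp hn => exact ⟨p, n, hp, hn.ne', dvd_rfl, h⟩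
  | zero => exact absurd rfl hu
  | one => exact absurd ⟨Nat.gcd_one_right w, 0, Nat.modEq_one⟩ h
  | coprime a b ha hb hab iha ihb =>
    by_cases h1 : QR w a
    · by_cases h2 : QR w b
      · exact absurd (qr_of_coprime_mul hab h1 h2) h
      · obtain ⟨p, k, hp, hk, hd, hq⟩ := ihb (by omega) h2
        exact ⟨p, k, hp, hk, hd.mul_left a, hq⟩
    · obtain ⟨p, k, hp, hk, hd, hq⟩ := iha (by omega) h1
      exact ⟨p, k, hp, hk, hd.mul_right b, hq⟩

/-- If `w` is not a unit square modulo `u`, then some prime divides every `r` for which `r ^ 2` is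
`w` times a square modulo `u`. -/
theorem exists_prime_dvd_of_not_qr {w u : ℕ} (h : ¬ QR w u) :
    ∃ p, p.Prime ∧ ∀ r r' : ℕ, r ^ 2 ≡ w * r' ^ 2 [MOD u] → p ∣ r := by
  by_cases hg : Nat.gcd w u = 1
  · have hu : u ≠ 0 := by
      rintro rfl
      rw [Nat.gcd_zero_right] at hg
      subst hg
      exact h ⟨by simp, 1, rfl⟩
    obtain ⟨p, k, hp, hk, hd, hq⟩ := exists_prime_pow_not_qr hu h
    refine ⟨p, hp, fun r r' hr => ?_⟩
    -- If p does not divide r, then r is a unit modulo p ^ k, hence so are w and r', and w = (r /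
    -- r')² is a square there after all.
    by_contra hpr
    apply hq
    have hr' := hr.of_dvd hd
    have hpk : Nat.Coprime r (p ^ k) :=
      ((Nat.Prime.coprime_iff_not_dvd hp).2 hpr).symm.pow_right k
    have h1 : Nat.Coprime (w * r' ^ 2) (p ^ k) := by
      have h2 : Nat.Coprime (r ^ 2) (p ^ k) := hpk.pow_left 2
      rwa [Nat.Coprime, hr'.gcd_eq] at h2
    have hw : Nat.Coprime w (p ^ k) := h1.coprime_mul_right
    have hr1 : Nat.Coprime r' (p ^ k) := by
      have := h1.coprime_mul_left
      exact (Nat.coprime_pow_left_iff (by norm_num) _ _).1 this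
    refine ⟨hw, ?_⟩
    rcases Nat.eq_or_lt_of_le (Nat.one_le_iff_ne_zero.2 (pow_ne_zero k hp.ne_zero)) with h1k | h1k
    · exact ⟨0, by rw [← h1k]; exact Nat.modEq_one⟩
    obtain ⟨c, hc⟩ := Nat.exists_mul_mod_eq_one_of_coprime hr1 h1k
    have hc' : r' * c ≡ 1 [MOD p ^ k] := by
      rw [Nat.ModEq, hc.2, Nat.mod_eq_of_lt h1k]
    refine ⟨r * c, ?_⟩
    have e1 : w * (r' * c) ^ 2 ≡ w * 1 ^ 2 [MOD p ^ k] := (hc'.pow 2).mul_left w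
    have e2 : r ^ 2 * c ^ 2 ≡ w * r' ^ 2 * c ^ 2 [MOD p ^ k] := hr'.mul_right _
    have : w * (r' * c) ^ 2 = w * r' ^ 2 * c ^ 2 := by ring
    rw [this] at e1
    have e3 := e2.trans e1
    rw [mul_pow]
    simpa using e3.symm
  · obtain ⟨p, hp, hpd⟩ := Nat.exists_prime_and_dvd hg
    refine ⟨p, hp, fun r r' hr => ?_⟩
    have h1 := hr.of_dvd (hpd.trans (Nat.gcd_dvd_right w u))
    have h2 : p ∣ w * r' ^ 2 := (hpd.trans (Nat.gcd_dvd_left w u)).mul_right _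
    have h3 : p ∣ r ^ 2 := (h1.dvd_iff dvd_rfl).2 h2
    exact hp.dvd_of_dvd_pow h3

-- The offending r are multiples of one prime p ≥ 2, at most R / 2 + 1 of them; this is at most 9R /
-- 16 once R ≥ 16.
open Classical in
theorem card_square_multiples_le {w u R : ℕ} (h : ¬ QR w u) (hR : 16 ≤ R) :
    (Finset.univ.filter fun r : Fin R => ∃ r' : ℕ, (r : ℕ) ^ 2 ≡ w * r' ^ 2 [MOD u]).card * 16
      ≤ 9 * R := by
  obtain ⟨p, hp, hd⟩ := exists_prime_dvd_of_not_qr h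
  have h1 : (Finset.univ.filter fun r : Fin R =>
      ∃ r' : ℕ, (r : ℕ) ^ 2 ≡ w * r' ^ 2 [MOD u]).card
      ≤ ((Finset.range R).filter (p ∣ ·)).card := by
    refine Finset.card_le_card_of_injOn (fun r => (r : ℕ)) (fun r hr => ?_)
      (fun _ _ _ _ => Fin.ext)
    obtain ⟨r', hr'⟩ := (Finset.mem_filter.1 hr).2
    exact Finset.mem_coe.2 (Finset.mem_filter.2 ⟨Finset.mem_range.2 r.2, hd _ _ hr'⟩)
  have h2 : ((Finset.range R).filter (p ∣ ·)).card ≤ (R / 2) + 1 := by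
    have h3 : ((Finset.range R).filter (p ∣ ·)).card ≤ (Finset.range (R / 2 + 1)).card := by
      refine Finset.card_le_card_of_injOn (fun r => r / p) (fun r hr => ?_) (fun a ha b hb hab => ?_)
      · have := Finset.mem_range.1 (Finset.mem_filter.1 hr).1
        have h4 : r / p ≤ r / 2 := Nat.div_le_div_left hp.two_le (by norm_num)
        have h5 : r / 2 ≤ R / 2 := Nat.div_le_div_right this.le
        exact Finset.mem_coe.2 (Finset.mem_range.2 (by simp only; omega))
      · have ha' := (Finset.mem_filter.1 ha).2
        have hb' := (Finset.mem_filter.1 hb).2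
        exact (Nat.div_left_inj ha' hb').1 hab
    simpa using h3
  omega

/-- Multiplication by `a` modulo `u` on the complete blocks of length `u` below `R`. -/
def blockMul (u a R r : ℕ) : ℕ :=
  if r < u * (R / u) then u * (r / u) + (a * (r % u)) % u else r

theorem blockMul_lt {u a R r : ℕ} (hu : 0 < u) (hr : r < R) : blockMul u a R r < R := by
  unfold blockMul
  split_ifs with h
  · have h1 : r / u < R / u := Nat.div_lt_of_lt_mul h
    have h2 := Nat.mod_lt (a * (r % u)) hu
    have h3 : u * (r / u + 1) ≤ u * (R / u) := Nat.mul_le_mul_left u h1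
    have h4 := Nat.mul_div_le R u
    rw [mul_add] at h3
    omega
  · exact hr

/-- The map is multiplication by a unit inside each complete block and the identity on the
remainder, and it preserves these two regions. -/
theorem blockMul_injective {u a R : ℕ} (hu : 0 < u) (ha : Nat.Coprime u a) :
    Function.Injective (blockMul u a R) := by
  have key : ∀ r, r < u * (R / u) → blockMul u a R r < u * (R / u) := by
    intro r h
    have h1 : r / u < R / u := Nat.div_lt_of_lt_mul h
    have h2 := Nat.mod_lt (a * (r % u)) hu
    have h3 : u * (r / u + 1) ≤ u * (R / u) := Nat.mul_le_mul_left u h1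
    rw [blockMul, if_pos h]
    rw [mul_add] at h3
    omega
  intro r s hrs
  by_cases hr : r < u * (R / u) <;> by_cases hs : s < u * (R / u)
  · simp only [blockMul, if_pos hr, if_pos hs] at hrs
    have e1 := congrArg (· / u) hrs
    have e2 := congrArg (· % u) hrs
    simp only [Nat.mul_add_div hu, Nat.mul_add_mod,
      Nat.div_eq_of_lt (Nat.mod_lt _ hu), add_zero, Nat.mod_mod] at e1 e2
    have e3 : r % u ≡ s % u [MOD u] := Nat.ModEq.cancel_left_of_coprime ha e2
    have e4 : r % u = s % u := by simpa [Nat.ModEq] using e3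
    rw [← Nat.div_add_mod r u, ← Nat.div_add_mod s u, e1, e4]
  · have := key r hr
    rw [hrs, blockMul, if_neg hs] at this
    exact absurd this hs
  · have := key s hs
    rw [← hrs, blockMul, if_neg hr] at this
    exact absurd this hr
  · simpa only [blockMul, if_neg hr, if_neg hs] using hrs

theorem blockMul_modEq {u a t R r : ℕ} (hat : t * a ≡ 1 [MOD u]) (hr : r < u * (R / u)) :
    t * blockMul u a R r ≡ r [MOD u] := by
  rw [blockMul, if_pos hr]
  calc t * (u * (r / u) + a * (r % u) % u) ≡ t * (0 + a * r) [MOD u] := by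
        refine Nat.ModEq.mul_left _ (Nat.ModEq.add ?_ ?_)
        · exact (Nat.modEq_zero_iff_dvd).2 (dvd_mul_right u _)
        · exact (Nat.mod_modEq _ _).trans ((Nat.mod_modEq _ _).mul_left a)
    _ = (t * a) * r := by ring
    _ ≡ 1 * r [MOD u] := hat.mul_right r
    _ = r := one_mul r

/-- Few residues leave an interval under a translation by `d`. -/
theorem card_translate_ne_le {K : ℕ} [NeZero K] (d : ℤ) :
    (Finset.univ.filter fun κ : ZMod K => ((κ + (d : ZMod K)).val : ℤ) ≠ κ.val + d).card
      ≤ d.natAbs := by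
  have hK : (0 : ℤ) < K := by exact_mod_cast Nat.pos_of_ne_zero (NeZero.ne K)
  have hval : ∀ κ : ZMod K, 0 ≤ (κ.val : ℤ) + d → (κ.val : ℤ) + d < K →
      ((κ + (d : ZMod K)).val : ℤ) = κ.val + d := by
    intro κ h1 h2
    have h3 : κ + (d : ZMod K) = (((κ.val : ℤ) + d : ℤ) : ZMod K) := by
      push_cast; rw [ZMod.natCast_zmod_val]
    rw [h3, ZMod.val_intCast, Int.emod_eq_of_lt h1 h2]
  rcases le_total 0 d with hd | hd
  · have : (Finset.univ.filter fun κ : ZMod K => ((κ + (d : ZMod K)).val : ℤ) ≠ κ.val + d).card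
        ≤ (Finset.Ico ((K : ℤ) - d) K).card := by
      refine Finset.card_le_card_of_injOn (fun κ => (κ.val : ℤ)) (fun κ hκ => ?_)
        (fun a _ b _ hab => ZMod.val_injective K (Int.ofNat_injective hab))
      have h1 := (Finset.mem_filter.1 hκ).2
      have h2 : ¬ ((κ.val : ℤ) + d < K) := fun h => h1 (hval κ (by positivity) h)
      have h3 : (κ.val : ℤ) < K := by exact_mod_cast ZMod.val_lt κ
      simp only [Finset.coe_Ico, Set.mem_Ico]
      omega
    rw [Int.card_Ico] at this
    omega
  · have : (Finset.univ.filter fun κ : ZMod K => ((κ + (d : ZMod K)).val : ℤ) ≠ κ.val + d).card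
        ≤ (Finset.Ico (0 : ℤ) (-d)).card := by
      refine Finset.card_le_card_of_injOn (fun κ => (κ.val : ℤ)) (fun κ hκ => ?_)
        (fun a _ b _ hab => ZMod.val_injective K (Int.ofNat_injective hab))
      have h1 := (Finset.mem_filter.1 hκ).2
      have h3 : (κ.val : ℤ) < K := by exact_mod_cast ZMod.val_lt κ
      have h2 : ¬ (0 ≤ (κ.val : ℤ) + d) := fun h => h1 (hval κ h (by omega))
      simp only [Finset.coe_Ico, Set.mem_Ico]
      omega
    rw [Int.card_Ico] at this
    omega

/-- With w = t² modulo u and a the inverse of t, the map r ↦ r' = a r makes r² - w r'² divisible by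
u, and a shift of κ by the quotient restores equality. It fails on the incomplete block of fewer
than M values of r, and when κ wraps around, for at most M R² values of κ per r. Each failure takes
at most a fraction 1/64. -/
theorem exists_perm_of_qr {w u M R K : ℕ} [NeZero K] (hw : w < M) (hu : u < M)
    (hRM : 64 * M ≤ R) (hKM : 64 * (M * R ^ 2) ≤ K) (h : QR w u) :
    ∃ ψ : Equiv.Perm (Fin R × ZMod K),
      (Finset.univ.filter fun z => ((z.1 : ℕ) ^ 2 + u * z.2.val
        ≠ w * ((ψ z).1 : ℕ) ^ 2 + u * (ψ z).2.val)).card * 32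
        ≤ R * K := by
  obtain ⟨hg, t, ht⟩ := h
  -- For u = 0 the gcd condition forces w = 1, and the two expressions coincide.
  rcases Nat.eq_zero_or_pos u with rfl | hu0
  · rw [Nat.gcd_zero_right] at hg
    subst hg
    exact ⟨Equiv.refl _, by simp⟩
  have hcop : Nat.Coprime t u := by
    have h1 : Nat.gcd (t ^ 2) u = 1 := by rw [← ht.gcd_eq]; exact hg
    exact (Nat.coprime_pow_left_iff (by norm_num) _ _).1 h1
  obtain ⟨a, ha⟩ : ∃ a, t * a ≡ 1 [MOD u] := by
    rcases Nat.eq_or_lt_of_le (Nat.one_le_iff_ne_zero.2 hu0.ne') with h1 | h1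
    · exact ⟨0, by rw [← h1]; exact Nat.modEq_one⟩
    · obtain ⟨c, hc⟩ := Nat.exists_mul_mod_eq_one_of_coprime hcop h1
      exact ⟨c, by rw [Nat.ModEq, hc.2, Nat.mod_eq_of_lt h1]⟩
  have hau : Nat.Coprime u a := by
    have h1 : Nat.gcd (t * a) u = 1 := by rw [ha.gcd_eq]; simp
    exact (Nat.Coprime.coprime_mul_left (k := t) h1).symm
  let π : Equiv.Perm (Fin R) := Equiv.ofBijective
    (fun r => ⟨blockMul u a R r, blockMul_lt hu0 r.2⟩)
    (Finite.injective_iff_bijective.1 fun r s hrs => Fin.ext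
      (blockMul_injective hu0 hau (Fin.mk.inj hrs)))
  -- This quotient is exact only on the complete blocks; elsewhere just its size matters.
  let d : Fin R → ℤ := fun r => (((r : ℕ) : ℤ) ^ 2 - w * ((π r : ℕ) : ℤ) ^ 2) / u
  have hd : ∀ r : Fin R, (r : ℕ) < u * (R / u) →
      (u : ℤ) * d r = ((r : ℕ) : ℤ) ^ 2 - w * ((π r : ℕ) : ℤ) ^ 2 := by
    intro r hr
    refine Int.mul_ediv_cancel' ?_
    have e1 : t * (π r : ℕ) ≡ r [MOD u] := blockMul_modEq ha hr
    have e2 : w * (π r : ℕ) ^ 2 ≡ (r : ℕ) ^ 2 [MOD u] := by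
      refine (ht.mul_right _).trans ?_
      rw [← mul_pow]
      exact e1.pow 2
    have := (Nat.modEq_iff_dvd.1 e2)
    push_cast at this
    exact this
  have hdabs : ∀ r, (d r).natAbs ≤ M * R ^ 2 := by
    intro r
    have h1 : (d r).natAbs ≤ (((r : ℕ) : ℤ) ^ 2 - w * ((π r : ℕ) : ℤ) ^ 2).natAbs :=
      Int.natAbs_ediv_le_natAbs _ _
    have h2 : (r : ℕ) ^ 2 ≤ M * R ^ 2 := by
      calc (r : ℕ) ^ 2 ≤ R ^ 2 := Nat.pow_le_pow_left r.2.le 2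
        _ ≤ _ := Nat.le_mul_of_pos_left _ (by omega)
    have h3 : w * (π r : ℕ) ^ 2 ≤ M * R ^ 2 :=
      Nat.mul_le_mul hw.le (Nat.pow_le_pow_left (π r).2.le 2)
    zify at h2 h3 h1 ⊢
    refine h1.trans (abs_le.2 ⟨?_, ?_⟩)
    · have : (0 : ℤ) ≤ ((r : ℕ) : ℤ) ^ 2 := by positivity
      linarith
    · have : (0 : ℤ) ≤ (w : ℤ) * ((π r : ℕ) : ℤ) ^ 2 := by positivity
      linarith
  refine ⟨Equiv.prodShear π fun r => Equiv.addRight ((d r : ℤ) : ZMod K), ?_⟩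
  classical
  have hsub : (Finset.univ.filter fun z : Fin R × ZMod K => ((z.1 : ℕ) ^ 2 + u * z.2.val
        ≠ w * ((Equiv.prodShear π (fun r => Equiv.addRight ((d r : ℤ) : ZMod K)) z).1 : ℕ) ^ 2
          + u * (Equiv.prodShear π (fun r => Equiv.addRight ((d r : ℤ) : ZMod K)) z).2.val))
      ⊆ ((Finset.univ.filter fun r : Fin R => u * (R / u) ≤ r) ×ˢ Finset.univ) ∪
        Finset.univ.biUnion fun r : Fin R => (Finset.univ.filter fun κ : ZMod K =>
          ((κ + (d r : ZMod K)).val : ℤ) ≠ κ.val + d r).image fun κ => (r, κ) := by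
    rintro ⟨r, κ⟩ hz
    have hz := (Finset.mem_filter.1 hz).2
    rw [Finset.mem_union]
    by_cases hr : u * (R / u) ≤ r
    · left; simp [hr]
    · right
      rw [Finset.mem_biUnion]
      refine ⟨r, Finset.mem_univ _, Finset.mem_image.2 ⟨κ, Finset.mem_filter.2
        ⟨Finset.mem_univ _, fun hκ => hz ?_⟩, rfl⟩⟩
      simp only [Equiv.prodShear_apply, Equiv.coe_addRight]
      have h1 := hd r (not_le.1 hr)
      zify
      rw [hκ]
      linear_combination -h1
  have h1 : (Finset.univ.filter fun r : Fin R => u * (R / u) ≤ r).card ≤ M := by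
    have : (Finset.univ.filter fun r : Fin R => u * (R / u) ≤ r).card
        ≤ (Finset.Ico (u * (R / u)) R).card := by
      refine Finset.card_le_card_of_injOn (fun r => (r : ℕ)) (fun r hr => ?_)
        (fun _ _ _ _ => Fin.ext)
      exact Finset.mem_coe.2 (Finset.mem_Ico.2 ⟨(Finset.mem_filter.1 hr).2, r.2⟩)
    rw [Nat.card_Ico] at this
    have h2 := Nat.div_add_mod R u
    have h3 := Nat.mod_lt R hu0
    omega
  have h2 : (Finset.univ.biUnion fun r : Fin R => (Finset.univ.filter fun κ : ZMod K =>
          ((κ + (d r : ZMod K)).val : ℤ) ≠ κ.val + d r).image fun κ => (r, κ)).card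
      ≤ R * (M * R ^ 2) := by
    refine Finset.card_biUnion_le.trans ((Finset.sum_le_sum fun r _ =>
      Finset.card_image_le.trans ((card_translate_ne_le (d r)).trans (hdabs r))).trans ?_)
    simp
  have h3 := (Finset.card_le_card hsub).trans (Finset.card_union_le _ _)
  rw [Finset.card_product, Finset.card_univ, ZMod.card] at h3
  have h4 := Nat.mul_le_mul_right K h1
  have e1 := Nat.mul_le_mul_right K hRM
  have e2 := Nat.mul_le_mul_left R hKM
  have e3 : R * (64 * (M * R ^ 2)) = 64 * (R * (M * R ^ 2)) := by ring
  rw [mul_assoc] at e1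
  omega

end

noncomputable section

set_option linter.unusedSectionVars false

/-! ### Authorized and unauthorized sets -/

/-- The pairs of parties are indexed by the digits of `w` and `u`. -/
abbrev Digit (m : ℕ) : Type := Fin m ⊕ Fin m

/-- The party for the value `b` of a digit. -/
def Digit.party {m : ℕ} (i : Digit m) (b : Bool) : Party m :=
  i.elim (fun i => Party.W i b) (fun i => Party.U i b)

/-- The share of the party is released on the inputs `x`, `y`. -/
def Released {m : ℕ} (x y : Bits (4 * m)) (i : Digit m) (b : Bool) : Prop :=
  x (i.party b).pos ≠ y (i.party b).pos

/-- The number `w` encoded by the digits. -/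
def wVal {m : ℕ} (v : Digit m → Bool) : ℕ := bitsVal fun i => v (Sum.inl i)

/-- The number `u` encoded by the digits. -/
def uVal {m : ℕ} (v : Digit m → Bool) : ℕ := bitsVal fun i => v (Sum.inr i)

theorem bitsVal_lt {m : ℕ} (w : Bits m) : bitsVal w < 2 ^ m := by
  have h : bitsVal w ≤ ∑ i : Fin m, 2 ^ (i : ℕ) :=
    Finset.sum_le_sum fun i _ => by split_ifs <;> simp
  rw [Fin.sum_univ_eq_sum_range (fun i => 2 ^ i) m] at h
  have := Nat.geomSum_eq (le_refl 2) m
  have h2 : 0 < 2 ^ m := by positivity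
  omega

theorem released_iff {m : ℕ} (x y : Bits (4 * m)) (i : Digit m) (b : Bool) :
    Released x y i b ↔ i.party b ∈ {p : Party m | xor (x p.pos) (y p.pos) = true} := by
  simp [Released]

theorem nqr₂_eq_true_iff {m : ℕ} (x y : Bits (4 * m)) : NQR₂ m x y = true ↔
    {p : Party m | xor (x p.pos) (y p.pos) = true} ∈ NQRAccess m := by
  simp [NQR₂, NQR]

/-- Since gcd(w, 0) = w, the separate rule for u = 0 in the access structure is again the failure of
`QR`, and both rules can be treated together. -/
theorem not_qr_of_ne_one {w : ℕ} (hw : w ≠ 1) : ¬ QR w 0 := fun h => hw (by simpa using h.1)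

theorem exists_of_nqr₂_true {m : ℕ} {x y : Bits (4 * m)} (h : NQR₂ m x y = true) :
    (∃ i, Released x y i false ∧ Released x y i true) ∨
      ∃ v : Digit m → Bool, (∀ i, Released x y i (v i)) ∧ ¬ QR (wVal v) (uVal v) := by
  obtain ⟨B, hB, hsub⟩ := (nqr₂_eq_true_iff x y).1 h
  have hset : ∀ w u : Bits m, partySet w u ⊆ {p : Party m | xor (x p.pos) (y p.pos) = true} →
      ∀ i, Released x y i (Sum.elim w u i) := by
    rintro w u h (i | i)
    · exact (released_iff x y _ _).2 (h (Or.inl ⟨i, rfl⟩))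
    · exact (released_iff x y _ _).2 (h (Or.inr ⟨i, rfl⟩))
  cases hB with
  | pairW i => exact Or.inl ⟨Sum.inl i, (released_iff x y _ _).2 (hsub (by simp [Digit.party])),
      (released_iff x y _ _).2 (hsub (by simp [Digit.party]))⟩
  | pairU i => exact Or.inl ⟨Sum.inr i, (released_iff x y _ _).2 (hsub (by simp [Digit.party])),
      (released_iff x y _ _).2 (hsub (by simp [Digit.party]))⟩
  | nonresidue w u h0 h1 hq => exact Or.inr ⟨Sum.elim w u, hset w u hsub, hq⟩
  | zero w u hu hw =>
    refine Or.inr ⟨Sum.elim w u, hset w u hsub, ?_⟩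
    change ¬ QR (bitsVal w) (bitsVal u)
    rw [hu]
    exact not_qr_of_ne_one hw

/-- If no digit is missing and none is released twice, the released shares are exactly those of
B_{w,u}, which must not be authorized. The exempted case u = 1 causes no trouble, as every w is a
square modulo 1. -/
theorem exists_of_nqr₂_false {m : ℕ} {x y : Bits (4 * m)} (h : NQR₂ m x y = false) :
    (∀ i, ¬ (Released x y i false ∧ Released x y i true)) ∧
      ((∃ i, ∀ b, ¬ Released x y i b) ∨
        ∃ v : Digit m → Bool, (∀ i b, Released x y i b ↔ b = v i) ∧ QR (wVal v) (uVal v)) := by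
  have hn : ¬ {p : Party m | xor (x p.pos) (y p.pos) = true} ∈ NQRAccess m := by
    rw [← nqr₂_eq_true_iff, h]; simp
  have hpair : ∀ i, ¬ (Released x y i false ∧ Released x y i true) := by
    rintro (i | i) ⟨h0, h1⟩
    · refine hn ⟨_, NQRMinimal.pairW i, Set.pair_subset ?_ ?_⟩
      · exact (released_iff x y _ _).1 h0
      · exact (released_iff x y _ _).1 h1
    · refine hn ⟨_, NQRMinimal.pairU i, Set.pair_subset ?_ ?_⟩
      · exact (released_iff x y _ _).1 h0
      · exact (released_iff x y _ _).1 h1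
  refine ⟨hpair, ?_⟩
  by_cases hc : ∃ i, ∀ b, ¬ Released x y i b
  · exact Or.inl hc
  right
  push Not at hc
  choose v hv using hc
  refine ⟨v, fun i b => ⟨fun hb => ?_, fun hb => hb ▸ hv i⟩, ?_⟩
  · by_contra hne
    have h1 := hv i
    have h2 := hpair i
    cases b <;> cases hvi : v i <;> simp_all
  · by_contra hq
    have hsub : partySet (fun i => v (Sum.inl i)) (fun i => v (Sum.inr i)) ⊆
        {p : Party m | xor (x p.pos) (y p.pos) = true} := by
      rintro p (⟨i, rfl⟩ | ⟨i, rfl⟩)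
      · exact (released_iff x y (Sum.inl i) _).1 (hv _)
      · exact (released_iff x y (Sum.inr i) _).1 (hv _)
    by_cases h0 : uVal v = 0
    · refine hn ⟨_, NQRMinimal.zero _ _ h0 fun h1 => hq ?_, hsub⟩
      change wVal v = 1 at h1
      rw [h0, h1]
      exact ⟨by simp, 1, rfl⟩
    · by_cases h1 : uVal v = 1
      · rw [h1] at hq
        exact hq ⟨by simp, 0, Nat.modEq_one⟩
      · exact hn ⟨_, NQRMinimal.nonresidue _ _ h0 h1 hq, hsub⟩

/-! ### A CDS protocol for `NQR₂` with one-sided certificates and constant error -/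

section Instance
variable {m R K N : ℕ} [NeZero K] [NeZero N]

/-- The shares live in this group. -/
abbrev ShareGroup (N : ℕ) : Type := ZMod N × ZMod 2

/-- The shared randomness: the numbers `r` and `κ`, the shares of zero, and the one-time pads. -/
abbrev ShareRand (m R K N : ℕ) : Type :=
  (Fin R × ZMod K) × (Digit m → ShareGroup N) × (Digit m → Bool → Bool → ShareGroup N)

/-- The contribution of a digit with value `1`. -/
def weight (N : ℕ) (s : Bool) (z : Fin R × ZMod K) : Digit m → ShareGroup N
  | Sum.inl i => if s then (((2 ^ (i : ℕ) * (z.1 : ℕ) ^ 2 : ℕ) : ZMod N), 1) else 0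
  | Sum.inr i => (((2 ^ (i : ℕ) * z.2.val : ℕ) : ZMod N), if s then 1 else 0)

/-- Alice's message. -/
def shareAlice (x : Bits (4 * m)) (s : Bool) (ω : ShareRand m R K N) :
    ZMod N × (Digit m → Bool → ShareGroup N) :=
  ((if s then 0 else (((ω.1.1 : ℕ) ^ 2 : ℕ) : ZMod N)) - ∑ i, (ω.2.1 i).1,
    fun i b => ω.2.1 i + (if b then weight N s ω.1 i else 0) + ω.2.2 i b (x (i.party b).pos))

/-- Bob's message. -/
def shareBob (y : Bits (4 * m)) (ω : ShareRand m R K N) : Digit m → Bool → ShareGroup N :=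
  fun i b => ω.2.2 i b (!(y (i.party b).pos))

/-- When x and y differ at the party, Bob sends the very pad that Alice used; otherwise he sends the
other one and the share stays hidden. -/
theorem share_released {x y : Bits (4 * m)} {i : Digit m} {b : Bool} (h : Released x y i b)
    (s : Bool) (ω : ShareRand m R K N) :
    (shareAlice x s ω).2 i b - shareBob y ω i b
      = ω.2.1 i + if b then weight N s ω.1 i else 0 := by
  have : (!(y (i.party b).pos)) = x (i.party b).pos := by
    unfold Released at h
    revert h
    cases x (i.party b).pos <;> cases y (i.party b).pos <;> simp
  simp only [shareAlice, shareBob, this, add_sub_cancel_right]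

theorem sum_weight (v : Digit m → Bool) (s : Bool) (z : Fin R × ZMod K) :
    ∑ i, (if v i then weight N s z i else 0).1
      = (((if s then wVal v * (z.1 : ℕ) ^ 2 else 0) + uVal v * z.2.val : ℕ) : ZMod N) := by
  rw [Fintype.sum_sum_type, Nat.cast_add]
  congr 1
  · cases s
    · simp [weight]
    · simp only [wVal, bitsVal, weight, if_true, Nat.cast_mul, Nat.cast_sum, Finset.sum_mul]
      refine Finset.sum_congr rfl fun i _ => ?_
      split_ifs <;> simp
  · simp only [uVal, bitsVal, weight, Nat.cast_mul, Nat.cast_sum, Finset.sum_mul]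
    refine Finset.sum_congr rfl fun i _ => ?_
    split_ifs <;> simp

/-- The masks cancel against Alice's first component, which also contributes the r² that replaces
the sum over the digits of w when the secret is `false`. -/
theorem share_total {x y : Bits (4 * m)} {v : Digit m → Bool} (h : ∀ i, Released x y i (v i))
    (s : Bool) (ω : ShareRand m R K N) :
    (shareAlice x s ω).1 + ∑ i, ((shareAlice x s ω).2 i (v i) - shareBob y ω i (v i)).1
      = (((if s then wVal v else 1) * (ω.1.1 : ℕ) ^ 2 + uVal v * ω.1.2.val : ℕ) : ZMod N) := by
  simp only [share_released (h _), Prod.fst_add, Finset.sum_add_distrib, sum_weight]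
  simp only [shareAlice]
  cases s <;> simp <;> ring

open Classical in
/-- On authorized inputs there is a certificate that the secret is `false`, which is sound and
usually exists. -/
theorem exists_certificate (hR : 16 ≤ R) (hN : 2 ^ m * R ^ 2 + 2 ^ m * K ≤ N)
    {x y : Bits (4 * m)} (hxy : NQR₂ m x y = true) :
    ∃ cert : (ZMod N × (Digit m → Bool → ShareGroup N)) × (Digit m → Bool → ShareGroup N) → Prop,
      (∀ ω : ShareRand m R K N, ¬ cert (shareAlice x true ω, shareBob y ω)) ∧
      (Finset.univ.filter fun ω : ShareRand m R K N =>
        ¬ cert (shareAlice x false ω, shareBob y ω)).card * 16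
        ≤ 9 * Fintype.card (ShareRand m R K N) := by
  rcases exists_of_nqr₂_true hxy with ⟨i, h0, h1⟩ | ⟨v, hv, hq⟩
  · refine ⟨fun M => ((M.1.2 i true - M.2 i true) - (M.1.2 i false - M.2 i false)).2 = 0,
      fun ω => ?_, ?_⟩
    · simp only [share_released h0, share_released h1]
      rcases i with i | i <;> simp [weight]
    · have h : ∀ ω : ShareRand m R K N, (((shareAlice x false ω).2 i true - shareBob y ω i true) -
          ((shareAlice x false ω).2 i false - shareBob y ω i false)).2 = 0 := by
        intro ω
        rw [share_released h0, share_released h1]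
        rcases i with i | i <;> simp [weight]
      simp [h]
  -- The certificate is that the total is not w times a square modulo u, which never happens for the
  -- secret `true`.
  · refine ⟨fun M => ¬ ∃ r' : ℕ, (M.1.1 + ∑ i, (M.1.2 i (v i) - M.2 i (v i)).1).val
      ≡ wVal v * r' ^ 2 [MOD uVal v], fun ω => not_not.2 ⟨ω.1.1, ?_⟩, ?_⟩
    · dsimp only
      -- `N` exceeds every possible total, so the residue modulo `N` is the integer itself and may
      -- be reduced modulo u.
      rw [share_total hv, ZMod.val_natCast_of_lt]
      · simp [Nat.ModEq]
      · refine lt_of_lt_of_le ?_ hN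
        have e1 : wVal v < 2 ^ m := bitsVal_lt _
        have e2 : uVal v < 2 ^ m := bitsVal_lt _
        have e3 : ((ω.1.1 : ℕ)) ^ 2 ≤ R ^ 2 := Nat.pow_le_pow_left ω.1.1.2.le 2
        have e4 := ZMod.val_lt ω.1.2
        have e5 : wVal v * ((ω.1.1 : ℕ)) ^ 2 ≤ 2 ^ m * R ^ 2 := Nat.mul_le_mul e1.le e3
        have e6 : uVal v * ω.1.2.val < 2 ^ m * K :=
          Nat.mul_lt_mul_of_le_of_lt e2.le e4 (by positivity)
        simp only [if_true]
        omega
    · have e : ∀ ω : ShareRand m R K N, (¬ ¬ ∃ r' : ℕ, ((shareAlice x false ω).1 +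
          ∑ i, ((shareAlice x false ω).2 i (v i) - shareBob y ω i (v i)).1).val
          ≡ wVal v * r' ^ 2 [MOD uVal v]) ↔
          ∃ r' : ℕ, (ω.1.1 : ℕ) ^ 2 ≡ wVal v * r' ^ 2 [MOD uVal v] := by
        intro ω
        rw [not_not, share_total hv, ZMod.val_natCast_of_lt]
        · simp [Nat.ModEq]
        · refine lt_of_lt_of_le ?_ hN
          have e2 : uVal v < 2 ^ m := bitsVal_lt _
          have e3 : ((ω.1.1 : ℕ)) ^ 2 ≤ R ^ 2 := Nat.pow_le_pow_left ω.1.1.2.le 2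
          have e4 := ZMod.val_lt ω.1.2
          have e5 : 1 * ((ω.1.1 : ℕ)) ^ 2 ≤ 2 ^ m * R ^ 2 := Nat.mul_le_mul Nat.one_le_two_pow e3
          have e6 : uVal v * ω.1.2.val < 2 ^ m * K :=
            Nat.mul_lt_mul_of_le_of_lt e2.le e4 (by positivity)
          simpa using Nat.add_lt_add_of_le_of_lt e5 e6
      simp only [e]
      have h1 : (Finset.univ.filter fun ω : ShareRand m R K N =>
          ∃ r' : ℕ, (ω.1.1 : ℕ) ^ 2 ≡ wVal v * r' ^ 2 [MOD uVal v])
          = ((Finset.univ.filter fun r : Fin R =>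
            ∃ r' : ℕ, (r : ℕ) ^ 2 ≡ wVal v * r' ^ 2 [MOD uVal v]) ×ˢ Finset.univ) ×ˢ
            Finset.univ := by
        ext ω; simp
      have h2 := card_square_multiples_le hq hR
      rw [h1, Finset.card_product, Finset.card_product, Fintype.card_prod, Fintype.card_prod,
        Fintype.card_fin, Finset.card_univ, Finset.card_univ]
      calc _ = (Finset.univ.filter fun r : Fin R =>
            ∃ r' : ℕ, (r : ℕ) ^ 2 ≡ wVal v * r' ^ 2 [MOD uVal v]).card * 16 *
            (Fintype.card (ZMod K) * Fintype.card ((Digit m → ShareGroup N) ×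
              (Digit m → Bool → Bool → ShareGroup N))) := by ring
        _ ≤ 9 * R * _ := Nat.mul_le_mul_right _ h2
        _ = _ := by ring

/-- The messages for the secrets `false` and `true` agree after a permutation of the randomness,
provided the correction terms satisfy linear conditions. -/
theorem share_eq_of_corrections {x y : Bits (4 * m)} (ψ : Equiv.Perm (Fin R × ZMod K))
    (D : Fin R × ZMod K → Digit m → ShareGroup N)
    (hD : ∀ z i b, Released x y i b →
      D z i = (if b then weight N false z i else 0) - if b then weight N true (ψ z) i else 0) :
    ∃ φ : Equiv.Perm (ShareRand m R K N), ∀ ω,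
      (∑ i, (D ω.1 i).1 = -(((ω.1.1 : ℕ) ^ 2 : ℕ) : ZMod N)) →
      (shareAlice x false ω, shareBob y ω) = (shareAlice x true (φ ω), shareBob y (φ ω)) := by
  -- The pad used by Alice absorbs the change of her share. If Bob reveals that pad, the share is
  -- released and `hD` makes this correction vanish.
  let F : Fin R × ZMod K → Digit m → Bool → Bool → ShareGroup N := fun z i b c =>
    if c = x (i.party b).pos then
      (if b then weight N false z i else 0) - (if b then weight N true (ψ z) i else 0) - D z i
    else 0
  refine ⟨Equiv.prodShear ψ fun z => (Equiv.addRight (D z)).prodCongr (Equiv.addRight (F z)),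
    fun ω hω => Prod.ext (Prod.ext ?_ ?_) ?_⟩
  · simp only [shareAlice, Equiv.prodShear_apply, Equiv.prodCongr_apply, Prod.map,
      Equiv.coe_addRight, Pi.add_apply, Prod.fst_add, Finset.sum_add_distrib, hω, if_true]
    simp
    ring
  · ext1 i
    ext1 b
    simp only [shareAlice, Equiv.prodShear_apply, Equiv.prodCongr_apply, Prod.map,
      Equiv.coe_addRight, Pi.add_apply, F, if_true]
    abel
  · ext1 i
    ext1 b
    simp only [shareBob, Equiv.prodShear_apply, Equiv.prodCongr_apply, Prod.map,
      Equiv.coe_addRight, Pi.add_apply, F]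
    split_ifs with h1 h2
    · have hrel : Released x y i b := by
        unfold Released
        rw [← h1]; simp
      have := hD ω.1 i b hrel
      rw [if_pos h2, if_pos h2] at this
      rw [this]; abel
    · have hrel : Released x y i b := by
        unfold Released
        rw [← h1]; simp
      have := hD ω.1 i b hrel
      rw [if_neg h2, if_neg h2] at this
      rw [this]; abel
    · simp

open Classical in
/-- On unauthorized inputs the secret is hidden up to a small error. -/
theorem exists_share_perm (hRM : 64 * 2 ^ m ≤ R) (hKM : 64 * (2 ^ m * R ^ 2) ≤ K)
    {x y : Bits (4 * m)} (hxy : NQR₂ m x y = false) :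
    ∃ φ : Equiv.Perm (ShareRand m R K N),
      (Finset.univ.filter fun ω : ShareRand m R K N => (shareAlice x false ω, shareBob y ω)
        ≠ (shareAlice x true (φ ω), shareBob y (φ ω))).card * 32
        ≤ Fintype.card (ShareRand m R K N) := by
  obtain ⟨hpair, ⟨i₀, hi₀⟩ | ⟨v, hv, hq⟩⟩ := exists_of_nqr₂_false hxy
  · let D₀ : Fin R × ZMod K → Digit m → ShareGroup N := fun z i =>
      if Released x y i true then weight N false z i - weight N true z i else 0
    -- The missing digit `i₀` is unconstrained, so its mask absorbs the whole discrepancy; secrecy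
    -- is perfect in this case.
    let D : Fin R × ZMod K → Digit m → ShareGroup N := fun z => Function.update (D₀ z) i₀
      (-(((z.1 : ℕ) ^ 2 : ℕ) : ZMod N) - ∑ i ∈ Finset.univ.erase i₀, (D₀ z i).1, 0)
    obtain ⟨φ, hφ⟩ := share_eq_of_corrections (x := x) (y := y) (N := N)
      (Equiv.refl (Fin R × ZMod K)) D (by
        intro z i b hb
        have hne : i ≠ i₀ := by rintro rfl; exact hi₀ b hb
        simp only [D, Function.update_of_ne hne, D₀]
        cases b
        · rw [if_neg fun h => hpair i ⟨hb, h⟩]; simp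
        · rw [if_pos hb]; simp)
    refine ⟨φ, ?_⟩
    rw [Finset.card_eq_zero.2, zero_mul]
    · exact Nat.zero_le _
    · refine Finset.eq_empty_of_forall_notMem fun ω hω => (Finset.mem_filter.1 hω).2 (hφ ω ?_)
      rw [← Finset.add_sum_erase _ _ (Finset.mem_univ i₀)]
      have : ∑ i ∈ Finset.univ.erase i₀, (D ω.1 i).1
          = ∑ i ∈ Finset.univ.erase i₀, (D₀ ω.1 i).1 := by
        refine Finset.sum_congr rfl fun i hi => ?_
        simp only [D, Function.update_of_ne (Finset.ne_of_mem_erase hi)]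
      rw [this]
      simp [D]
  · obtain ⟨ψ, hψ⟩ := exists_perm_of_qr (bitsVal_lt _) (bitsVal_lt _) hRM hKM hq
    obtain ⟨φ, hφ⟩ := share_eq_of_corrections (x := x) (y := y) (N := N) ψ
      (fun z i => (if v i then weight N false z i else 0) -
        if v i then weight N true (ψ z) i else 0) (by
        intro z i b hb
        rw [(hv i b).1 hb])
    refine ⟨φ, ?_⟩
    have hsub : (Finset.univ.filter fun ω : ShareRand m R K N =>
        (shareAlice x false ω, shareBob y ω) ≠ (shareAlice x true (φ ω), shareBob y (φ ω))) ⊆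
        (Finset.univ.filter fun z : Fin R × ZMod K => ((z.1 : ℕ) ^ 2 + uVal v * z.2.val
        ≠ wVal v * ((ψ z).1 : ℕ) ^ 2 + uVal v * (ψ z).2.val)) ×ˢ Finset.univ := by
      intro ω hω
      have hω := (Finset.mem_filter.1 hω).2
      refine Finset.mem_product.2 ⟨Finset.mem_filter.2 ⟨Finset.mem_univ _, fun he => hω (hφ ω ?_)⟩,
        Finset.mem_univ _⟩
      simp only [Prod.fst_sub, Finset.sum_sub_distrib, sum_weight]
      have he' := congrArg (Nat.cast : ℕ → ZMod N) he
      push_cast at he' ⊢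
      linear_combination he'
    refine (Nat.mul_le_mul_right 32 (Finset.card_le_card hsub)).trans ?_
    rw [Finset.card_product, Finset.card_univ, Fintype.card_prod (Fin R × ZMod K),
      Fintype.card_prod (Fin R), Fintype.card_fin, ZMod.card, mul_right_comm]
    exact Nat.mul_le_mul_right _ hψ

end Instance
end

noncomputable section

set_option linter.unusedSectionVars false

/-! ### Characters of `𝔽₂ ^ q` -/

/-- The nontrivial character of `ZMod 2`. -/
def signChar (a : ZMod 2) : ℝ := if a = 0 then 1 else -1

theorem signChar_add (a b : ZMod 2) : signChar (a + b) = signChar a * signChar b := by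
  revert a b
  unfold signChar
  have : ∀ a : ZMod 2, a = 0 ∨ a = 1 := by decide
  intro a b
  rcases this a with rfl | rfl <;> rcases this b with rfl | rfl
  · simp
  · simp
  · simp
  · have h : (1 : ZMod 2) + 1 = 0 := by decide
    rw [h]; simp

@[simp] theorem signChar_zero : signChar 0 = 1 := by simp [signChar]

theorem abs_signChar (a : ZMod 2) : |signChar a| = 1 := by
  unfold signChar; split_ifs <;> simp

theorem signChar_sum {ι : Type} (s : Finset ι) (f : ι → ZMod 2) :
    signChar (∑ i ∈ s, f i) = ∏ i ∈ s, signChar (f i) := by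
  classical
  induction s using Finset.induction_on with
  | empty => simp
  | insert a s ha ih => rw [Finset.sum_insert ha, Finset.prod_insert ha, signChar_add, ih]

theorem sum_zmod_two {β : Type} [AddCommMonoid β] (g : ZMod 2 → β) : ∑ a, g a = g 0 + g 1 :=
  Fin.sum_univ_two g

theorem zmod_two_cases (a : ZMod 2) : a = 0 ∨ a = 1 := by
  revert a; decide

theorem sum_prod_pi {ι κ : Type} [Fintype ι] [DecidableEq ι] [Fintype κ] {β : Type}
    [CommSemiring β] (g : ι → κ → β) : ∑ f : ι → κ, ∏ j, g j (f j) = ∏ j, ∑ a, g j a := by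
  rw [Finset.prod_univ_sum, Fintype.piFinset_univ]

theorem sum_signChar_dot {q : ℕ} (v : Fin q → ZMod 2) :
    ∑ l : Fin q → ZMod 2, signChar (l ⬝ᵥ v) = if v = 0 then 2 ^ q else 0 := by
  simp only [dotProduct, signChar_sum]
  rw [sum_prod_pi fun i a => signChar (a * v i)]
  simp only [sum_zmod_two, zero_mul, one_mul, signChar_zero]
  split_ifs with h
  · subst h; norm_num
  · obtain ⟨i, hi⟩ := Function.ne_iff.1 h
    refine Finset.prod_eq_zero (Finset.mem_univ i) ?_
    rw [(zmod_two_cases (v i)).resolve_left hi]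
    simp [signChar]

/-! ### Hiding a secret behind random parities of partially hidden bits -/

section Ramp
variable {q L : ℕ} {M : Type} [Fintype M]

/-- The syndrome of `R` for the parity-check columns `B`. -/
def syndrome (B : Fin L → Fin q → ZMod 2) (R : Fin L → ZMod 2) : Fin q → ZMod 2 :=
  ∑ j, R j • B j

theorem dot_syndrome (l : Fin q → ZMod 2) (B : Fin L → Fin q → ZMod 2) (R : Fin L → ZMod 2) :
    l ⬝ᵥ syndrome B R = ∑ j, R j * (l ⬝ᵥ B j) := by
  simp [syndrome, dotProduct_sum, dotProduct_smul]

/-- The distribution of the masked secret together with noisy views of the bits. -/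
def rampDist (p : ZMod 2 → M → ℝ) (s : Fin q → ZMod 2) (B : Fin L → Fin q → ZMod 2)
    (c : Fin q → ZMod 2) (μ : Fin L → M) : ℝ :=
  ((2 : ℝ) ^ (q * L))⁻¹ * ((2 : ℝ) ^ L)⁻¹ *
    ∑ R : Fin L → ZMod 2, if syndrome B R + s = c then ∏ j, p (R j) (μ j) else 0

/-- Fourier expansion of the indicator of the syndrome condition: each character factors over the
positions, and the secret enters only through a sign. -/
theorem rampDist_eq (p : ZMod 2 → M → ℝ) (s : Fin q → ZMod 2) (B : Fin L → Fin q → ZMod 2)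
    (c : Fin q → ZMod 2) (μ : Fin L → M) :
    rampDist p s B c μ = ((2 : ℝ) ^ (q * L))⁻¹ * ((2 : ℝ) ^ q)⁻¹ *
      ∑ l : Fin q → ZMod 2, signChar (l ⬝ᵥ s) * signChar (l ⬝ᵥ c) *
        ∏ j, ((p 0 (μ j) + signChar (l ⬝ᵥ B j) * p 1 (μ j)) / 2) := by
  have h1 : ∀ R : Fin L → ZMod 2, (if syndrome B R + s = c then ∏ j, p (R j) (μ j) else 0)
      = ((2 : ℝ) ^ q)⁻¹ * ∑ l : Fin q → ZMod 2, signChar (l ⬝ᵥ s) * signChar (l ⬝ᵥ c) *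
        ∏ j, (signChar (R j * (l ⬝ᵥ B j)) * p (R j) (μ j)) := by
    intro R
    have h2 : ∀ l : Fin q → ZMod 2, signChar (l ⬝ᵥ s) * signChar (l ⬝ᵥ c) *
        ∏ j, (signChar (R j * (l ⬝ᵥ B j)) * p (R j) (μ j))
        = signChar (l ⬝ᵥ (syndrome B R + s - c)) * ∏ j, p (R j) (μ j) := by
      intro l
      have h3 : syndrome B R + s - c = syndrome B R + s + c := by
        ext i
        have : ∀ a b : ZMod 2, a - b = a + b := by decide
        exact this _ _
      rw [Finset.prod_mul_distrib, ← signChar_sum, ← dot_syndrome, h3, dotProduct_add,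
        dotProduct_add, signChar_add, signChar_add]
      ring
    simp only [h2, ← Finset.sum_mul, sum_signChar_dot, sub_eq_zero]
    split_ifs
    · rw [← mul_assoc, inv_mul_cancel₀ (by positivity), one_mul]
    · simp
  simp only [rampDist, h1]
  rw [← Finset.mul_sum, Finset.sum_comm]
  have h4 : ∀ l : Fin q → ZMod 2, ∑ R : Fin L → ZMod 2, signChar (l ⬝ᵥ s) * signChar (l ⬝ᵥ c) *
        ∏ j, (signChar (R j * (l ⬝ᵥ B j)) * p (R j) (μ j))
      = (2 : ℝ) ^ L * (signChar (l ⬝ᵥ s) * signChar (l ⬝ᵥ c) *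
        ∏ j, ((p 0 (μ j) + signChar (l ⬝ᵥ B j) * p 1 (μ j)) / 2)) := by
    intro l
    rw [← Finset.mul_sum, sum_prod_pi fun j a => signChar (a * (l ⬝ᵥ B j)) * p a (μ j)]
    simp only [sum_zmod_two, zero_mul, one_mul, signChar_zero]
    rw [Finset.prod_div_distrib]
    simp only [Finset.prod_const, Finset.card_univ, Fintype.card_fin]
    field_simp
  simp only [h4, ← Finset.mul_sum]
  field_simp

/-- For a nonzero character l the bits l ⬝ᵥ B j are independent and uniform. A position contributes
at most 1 when its bit is 0 and δ when it is 1, hence (1 + δ) / 2 on average. One factor 2^q remains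
after summing over c and l against the normalization. -/
theorem sum_abs_rampDist_sub_le (p : ZMod 2 → M → ℝ) (hp : ∀ a m, 0 ≤ p a m)
    (hp1 : ∀ a, ∑ m, p a m = 1) {δ : ℝ} (hδ : ∑ m, |p 0 m - p 1 m| ≤ 2 * δ)
    (s s' : Fin q → ZMod 2) :
    ∑ B : Fin L → Fin q → ZMod 2, ∑ c, ∑ μ, |rampDist p s B c μ - rampDist p s' B c μ|
      ≤ 2 * 2 ^ q * ((1 + δ) / 2) ^ L := by
  have hδ0 : 0 ≤ δ := by
    have : 0 ≤ ∑ m, |p 0 m - p 1 m| := Finset.sum_nonneg fun _ _ => abs_nonneg _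
    linarith
  let e : ZMod 2 → ℝ := fun a => (1 + δ) / 2 + (1 - δ) / 2 * signChar a
  have he : ∀ a, ∑ m, |(p 0 m + signChar a * p 1 m) / 2| ≤ e a := by
    intro a
    rcases zmod_two_cases a with rfl | rfl
    · have : ∀ m, |(p 0 m + signChar 0 * p 1 m) / 2| = p 0 m / 2 + p 1 m / 2 := by
        intro m
        rw [abs_of_nonneg]
        · simp; ring
        · have := hp 0 m
          have := hp 1 m
          simp; positivity
      rw [Finset.sum_congr rfl fun m _ => this m, Finset.sum_add_distrib, ← Finset.sum_div,
        ← Finset.sum_div, hp1, hp1]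
      simp only [e, signChar_zero]
      linarith
    · have : ∀ m, |(p 0 m + signChar 1 * p 1 m) / 2| = |p 0 m - p 1 m| / 2 := by
        intro m
        rw [abs_div, abs_two]
        simp [signChar, sub_eq_add_neg]
      simp only [this, ← Finset.sum_div, e]
      simp [signChar]
      linarith
  have hsum : ∀ l : Fin q → ZMod 2, l ≠ 0 →
      ∑ B : Fin L → Fin q → ZMod 2, ∏ j, e (l ⬝ᵥ B j) = (2 ^ q * ((1 + δ) / 2)) ^ L := by
    intro l hl
    rw [sum_prod_pi fun _ v => e (l ⬝ᵥ v)]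
    have h1 : ∑ v : Fin q → ZMod 2, e (l ⬝ᵥ v) = 2 ^ q * ((1 + δ) / 2) := by
      simp only [e, Finset.sum_add_distrib, ← Finset.mul_sum]
      have h2 : ∑ v : Fin q → ZMod 2, signChar (l ⬝ᵥ v) = 0 := by
        simp only [dotProduct_comm l]
        rw [sum_signChar_dot, if_neg hl]
      rw [h2]
      simp
    simp [h1]
  have hpt : ∀ (B : Fin L → Fin q → ZMod 2) (c : Fin q → ZMod 2) (μ : Fin L → M),
      |rampDist p s B c μ - rampDist p s' B c μ|
      ≤ ((2 : ℝ) ^ (q * L))⁻¹ * ((2 : ℝ) ^ q)⁻¹ * ∑ l ∈ Finset.univ.erase (0 : Fin q → ZMod 2),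
        2 * ∏ j, |(p 0 (μ j) + signChar (l ⬝ᵥ B j) * p 1 (μ j)) / 2| := by
    intro B c μ
    rw [rampDist_eq, rampDist_eq, ← mul_sub, abs_mul, abs_of_nonneg (by positivity),
      ← Finset.sum_sub_distrib]
    refine mul_le_mul_of_nonneg_left ?_ (by positivity)
    -- The trivial character does not see the secret, so its term cancels in the difference.
    rw [← Finset.add_sum_erase _ _ (Finset.mem_univ (0 : Fin q → ZMod 2))]
    simp only [zero_dotProduct, sub_self, zero_add]
    refine (Finset.abs_sum_le_sum_abs _ _).trans (Finset.sum_le_sum fun l _ => ?_)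
    rw [← sub_mul, ← sub_mul, abs_mul, abs_mul, abs_signChar, mul_one, Finset.abs_prod]
    refine mul_le_mul_of_nonneg_right ?_ (Finset.prod_nonneg fun _ _ => abs_nonneg _)
    refine (abs_sub _ _).trans ?_
    rw [abs_signChar, abs_signChar]; norm_num
  have hμ : ∀ B : Fin L → Fin q → ZMod 2, ∀ c : Fin q → ZMod 2,
      ∑ μ, |rampDist p s B c μ - rampDist p s' B c μ|
      ≤ ((2 : ℝ) ^ (q * L))⁻¹ * ((2 : ℝ) ^ q)⁻¹ * ∑ l ∈ Finset.univ.erase (0 : Fin q → ZMod 2),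
        2 * ∏ j, e (l ⬝ᵥ B j) := by
    intro B c
    refine (Finset.sum_le_sum fun μ _ => hpt B c μ).trans ?_
    rw [← Finset.mul_sum, Finset.sum_comm]
    refine mul_le_mul_of_nonneg_left (Finset.sum_le_sum fun l _ => ?_) (by positivity)
    rw [← Finset.mul_sum, sum_prod_pi fun j m => |(p 0 m + signChar (l ⬝ᵥ B j) * p 1 m) / 2|]
    refine mul_le_mul_of_nonneg_left (Finset.prod_le_prod (fun j _ =>
      Finset.sum_nonneg fun _ _ => abs_nonneg _) fun j _ => he _) (by norm_num)
  refine (Finset.sum_le_sum fun B _ => Finset.sum_le_sum fun c _ => hμ B c).trans ?_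
  simp only [Finset.sum_const, Finset.card_univ, Fintype.card_fun, ZMod.card, Fintype.card_fin,
    nsmul_eq_mul, Nat.cast_pow, Nat.cast_ofNat]
  rw [← Finset.mul_sum, ← Finset.mul_sum, Finset.sum_comm]
  have h5 : ∀ l ∈ Finset.univ.erase (0 : Fin q → ZMod 2),
      ∑ B : Fin L → Fin q → ZMod 2, 2 * ∏ j, e (l ⬝ᵥ B j) = 2 * (2 ^ q * ((1 + δ) / 2)) ^ L := by
    intro l hl
    rw [← Finset.mul_sum, hsum l (Finset.ne_of_mem_erase hl)]
  rw [Finset.sum_congr rfl h5, Finset.sum_const, nsmul_eq_mul]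
  have h6 : ((Finset.univ.erase (0 : Fin q → ZMod 2)).card : ℝ) ≤ 2 ^ q := by
    have : (Finset.univ.erase (0 : Fin q → ZMod 2)).card ≤ 2 ^ q := by
      refine (Finset.card_erase_le).trans (le_of_eq ?_)
      simp [Finset.card_univ, ZMod.card]
    exact_mod_cast this
  calc _ ≤ (2 : ℝ) ^ q * ((2 ^ (q * L))⁻¹ * (2 ^ q)⁻¹ *
        (2 ^ q * (2 * (2 ^ q * ((1 + δ) / 2)) ^ L))) := by gcongr
    _ = _ := by
      rw [mul_pow ((2 : ℝ) ^ q), ← pow_mul]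
      field_simp

/-- Random parity checks rarely admit a prescribed syndrome on the erased positions. -/
theorem card_syndrome_eq_le (v : Fin q → ZMod 2) {e : Fin L → ZMod 2} (he : e ≠ 0) :
    (Finset.univ.filter fun B : Fin L → Fin q → ZMod 2 => syndrome B e = v).card * 2 ^ q
      ≤ 2 ^ (q * L) := by
  obtain ⟨j, hj⟩ := Function.ne_iff.1 he
  have hj1 : e j = 1 := (zmod_two_cases (e j)).resolve_left hj
  have hsyn : ∀ (B : Fin L → Fin q → ZMod 2) (w : Fin q → ZMod 2),
      syndrome (B + Pi.single j w) e = syndrome B e + w := by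
    intro B w
    simp only [syndrome, Pi.add_apply, smul_add, Finset.sum_add_distrib]
    congr 1
    rw [Finset.sum_eq_single j]
    · simp [hj1]
    · intro i _ hi; simp [hi]
    · simp
  have h : (Finset.univ.filter fun B : Fin L → Fin q → ZMod 2 => syndrome B e = v).card *
      (Finset.univ : Finset (Fin q → ZMod 2)).card
      ≤ (Finset.univ : Finset (Fin L → Fin q → ZMod 2)).card := by
    rw [← Finset.card_product]
    -- Adding w to a column where e is 1 translates the syndrome by w, so all syndromes are equally
    -- frequent.
    refine Finset.card_le_card_of_injOn (fun z => z.1 + Pi.single j z.2)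
      (fun _ _ => Finset.mem_coe.2 (Finset.mem_univ _)) ?_
    rintro ⟨B, w⟩ hB ⟨B', w'⟩ hB' h
    have h1 := (Finset.mem_filter.1 (Finset.mem_product.1 (Finset.mem_coe.1 hB)).1).2
    have h2 := (Finset.mem_filter.1 (Finset.mem_product.1 (Finset.mem_coe.1 hB')).1).2
    dsimp only at h h1 h2
    have h3 := congrArg (fun B => syndrome B e) h
    simp only [hsyn, h1, h2, add_right_inj] at h3
    subst h3
    simpa using h
  simpa [Finset.card_univ, ZMod.card, ← pow_mul] using h

end Ramp
end

noncomputable section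

set_option linter.unusedSectionVars false

theorem probBits_comp_equiv {ρ : ℕ} {T : Type} [Fintype T] (e : Bits ρ ≃ T) (p : T → Prop)
    [DecidablePred p] :
    probBits ρ (fun r => p (e r)) = ((Finset.univ.filter p).card : ℝ) / 2 ^ ρ := by
  classical
  unfold probBits
  congr 2
  refine Finset.card_bij (fun r _ => e r) (fun r hr => ?_) (fun _ _ _ _ h => e.injective h)
    fun t ht => ⟨e.symm t, ?_, by simp⟩
  · simpa using hr
  · simpa using ht

theorem card_filter_pi {ι κ : Type} [Fintype ι] [DecidableEq ι] [Fintype κ]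
    (P : ι → κ → Prop) [∀ j, DecidablePred (P j)] [DecidablePred fun w : ι → κ => ∀ j, P j (w j)] :
    (Finset.univ.filter fun w : ι → κ => ∀ j, P j (w j)).card
      = ∏ j, (Finset.univ.filter (P j)).card := by
  rw [← Fintype.card_piFinset]
  congr 1
  ext w
  simp [Fintype.mem_piFinset]

/-! ### Amplification by random parities -/

section Amplify
variable {n q L ω : ℕ} {Ω M₀ M₁ : Type} [Fintype Ω] [Fintype M₀] [Fintype M₁]

/-- The randomness of the amplified protocol: parity checks, bits, and the randomness with which
the bits are disclosed. -/
abbrev RampRand (q L : ℕ) (Ω : Type) : Type :=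
  (Fin L → Fin q → ZMod 2) × (Fin L → ZMod 2) × (Fin L → Ω)

theorem card_rampRand (hΩ : Fintype.card Ω = 2 ^ ω) :
    Fintype.card (RampRand q L Ω) = 2 ^ (q * L + L + L * ω) := by
  rw [Fintype.card_prod, Fintype.card_prod, Fintype.card_fun, Fintype.card_fun, Fintype.card_fun,
    Fintype.card_fun, hΩ]
  simp only [ZMod.card, Fintype.card_fin, ← pow_mul]
  rw [pow_add, pow_add, mul_comm ω L, mul_assoc]

/-- The bits of the randomness. -/
def rampEquiv (q L : ℕ) (hΩ : Fintype.card Ω = 2 ^ ω) :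
    Bits (q * L + L + L * ω) ≃ RampRand q L Ω :=
  Fintype.equivOfCardEq (by rw [card_rampRand hΩ]; simp)

/-- The two-bit secret as a syndrome. -/
def embedSecret (q : ℕ) (s : Bool × Bool) : Fin q → ZMod 2 := fun i =>
  if (i : ℕ) = 0 then (if s.1 then 1 else 0) else if (i : ℕ) = 1 then (if s.2 then 1 else 0) else 0

theorem embedSecret_injective (hq : 2 ≤ q) : Function.Injective (embedSecret q) := by
  rintro ⟨a, b⟩ ⟨a', b'⟩ h
  have h0 := congrFun h ⟨0, by omega⟩
  have h1 := congrFun h ⟨1, by omega⟩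
  simp only [embedSecret, if_true, one_ne_zero, if_false] at h0 h1
  revert h0 h1
  cases a <;> cases b <;> cases a' <;> cases b' <;> simp

/-- The amplified protocol discloses random bits with the given protocol, and masks the secret by a
random linear image of the bits. -/
def rampProtocol (q L : ℕ) (hΩ : Fintype.card Ω = 2 ^ ω) (alice : Bits n → ZMod 2 → Ω → M₀)
    (bob : Bits n → Ω → M₁) : CDSProtocol n (q * L + L + L * ω) (Bool × Bool) where
  M₀ := (Fin L → Fin q → ZMod 2) × (Fin q → ZMod 2) × (Fin L → M₀)
  M₁ := Fin L → M₁
  alice x s r := ((rampEquiv q L hΩ r).1,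
    syndrome (rampEquiv q L hΩ r).1 (rampEquiv q L hΩ r).2.1 + embedSecret q s,
    fun j => alice x ((rampEquiv q L hΩ r).2.1 j) ((rampEquiv q L hΩ r).2.2 j))
  bob y r := fun j => bob y ((rampEquiv q L hΩ r).2.2 j)

variable (hΩ : Fintype.card Ω = 2 ^ ω) (alice : Bits n → ZMod 2 → Ω → M₀) (bob : Bits n → Ω → M₁)

open Classical in
/-- The message distribution of the given protocol. -/
def gadgetDist (ω : ℕ) (alice : Bits n → ZMod 2 → Ω → M₀) (bob : Bits n → Ω → M₁) (x y : Bits n)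
    (b : ZMod 2) (m : M₀ × M₁) : ℝ :=
  ((Finset.univ.filter fun w : Ω => (alice x b w, bob y w) = m).card : ℝ) / 2 ^ ω

theorem sum_gadgetDist (hΩ : Fintype.card Ω = 2 ^ ω) (x y : Bits n) (b : ZMod 2) :
    ∑ m, gadgetDist ω alice bob x y b m = 1 := by
  classical
  simp only [gadgetDist]
  rw [← Finset.sum_div, ← Nat.cast_sum, div_eq_one_iff_eq (by positivity),
    ← Finset.card_eq_sum_card_fiberwise (fun _ _ => Finset.mem_coe.2 (Finset.mem_univ _)), Finset.card_univ, hΩ]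
  simp

theorem rampProtocol_msgProb (x y : Bits n) (s : Bool × Bool) (B : Fin L → Fin q → ZMod 2)
    (c : Fin q → ZMod 2) (μ : Fin L → M₀ × M₁) :
    (rampProtocol q L hΩ alice bob).msgProb x y s
        ((B, c, fun j => (μ j).1), fun j => (μ j).2)
      = rampDist (gadgetDist ω alice bob x y) (embedSecret q s) B c μ := by
  classical
  have h1 : (rampProtocol q L hΩ alice bob).msgProb x y s
        ((B, c, fun j => (μ j).1), fun j => (μ j).2)
      = ((Finset.univ.filter fun t : RampRand q L Ω =>
        ((t.1, syndrome t.1 t.2.1 + embedSecret q s, fun j => alice x (t.2.1 j) (t.2.2 j)),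
          fun j => bob y (t.2.2 j)) = ((B, c, fun j => (μ j).1), fun j => (μ j).2)).card : ℝ)
        / 2 ^ (q * L + L + L * ω) :=
    probBits_comp_equiv (rampEquiv q L hΩ) fun t : RampRand q L Ω =>
        ((t.1, syndrome t.1 t.2.1 + embedSecret q s, fun j => alice x (t.2.1 j) (t.2.2 j)),
          fun j => bob y (t.2.2 j)) = ((B, c, fun j => (μ j).1), fun j => (μ j).2)
  have h2 : (Finset.univ.filter fun t : RampRand q L Ω =>
        ((t.1, syndrome t.1 t.2.1 + embedSecret q s, fun j => alice x (t.2.1 j) (t.2.2 j)),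
          fun j => bob y (t.2.2 j)) = ((B, c, fun j => (μ j).1), fun j => (μ j).2)).card
      = ∑ R : Fin L → ZMod 2, if syndrome B R + embedSecret q s = c then
          ∏ j, (Finset.univ.filter fun w : Ω => (alice x (R j) w, bob y w) = μ j).card else 0 := by
    rw [Finset.card_filter, Fintype.sum_prod_type, Finset.sum_eq_single B]
    · rw [Fintype.sum_prod_type]
      refine Finset.sum_congr rfl fun R _ => ?_
      rw [← card_filter_pi (fun j (w : Ω) => (alice x (R j) w, bob y w) = μ j), Finset.card_filter]
      simp only [true_and, funext_iff, Prod.ext_iff, forall_and]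
      split_ifs with h
      · refine Finset.sum_congr rfl fun w _ => ?_
        simp only [h, true_and, implies_true]
      · refine Finset.sum_eq_zero fun w _ => ?_
        rw [if_neg]
        exact fun h' => h h'.1.1
    · intro B' _ hB'
      refine Finset.sum_eq_zero fun z _ => ?_
      rw [if_neg]
      simp [hB']
    · simp
  rw [h1, h2, rampDist, Nat.cast_sum, Finset.sum_div, Finset.mul_sum]
  refine Finset.sum_congr rfl fun R _ => ?_
  split_ifs
  · simp only [gadgetDist, Finset.prod_div_distrib, Finset.prod_const, Finset.card_univ,
      Fintype.card_fin, Nat.cast_prod]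
    rw [pow_add, pow_add, mul_comm L ω, pow_mul 2 ω L]
    field_simp
  · simp

theorem rampProtocol_secure {f : Bits n → Bits n → Bool}
    (h : ∀ x y, f x y = false →
      ∑ m, |gadgetDist ω alice bob x y 0 m - gadgetDist ω alice bob x y 1 m| ≤ 1 / 8) :
    (rampProtocol q L hΩ alice bob).Secure f (2 * 2 ^ q * (17 / 32) ^ L) := by
  refine ⟨fun x y => (rampProtocol q L hΩ alice bob).msgProb x y (false, false), fun x y =>
    ⟨fun m => CDSProtocol.msgProb_nonneg _ _ _ _ _, CDSProtocol.sum_msgProb _ _ _ _⟩,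
    fun s x y hxy => ?_⟩
  let e : ((Fin L → Fin q → ZMod 2) × (Fin q → ZMod 2) × (Fin L → M₀ × M₁)) ≃
      ((Fin L → Fin q → ZMod 2) × (Fin q → ZMod 2) × (Fin L → M₀)) × (Fin L → M₁) :=
    { toFun := fun z => ((z.1, z.2.1, fun j => (z.2.2 j).1), fun j => (z.2.2 j).2)
      invFun := fun z => (z.1.1, z.1.2.1, fun j => (z.1.2.2 j, z.2 j))
      left_inv := fun _ => rfl
      right_inv := fun _ => rfl }
  have h1 := sum_abs_rampDist_sub_le (q := q) (L := L) (gadgetDist ω alice bob x y)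
    (fun b m => by unfold gadgetDist; positivity) (sum_gadgetDist alice bob hΩ x y) (δ := 1 / 16)
    ((h x y hxy).trans (by norm_num)) (embedSecret q (false, false)) (embedSecret q s)
  norm_num at h1
  refine le_trans (le_of_eq ?_) h1
  refine (Equiv.sum_comp e _).symm.trans ?_
  rw [Fintype.sum_prod_type]
  refine Finset.sum_congr rfl fun B _ => ?_
  rw [Fintype.sum_prod_type]
  refine Finset.sum_congr rfl fun c _ => Finset.sum_congr rfl fun μ _ => ?_
  rw [← rampProtocol_msgProb hΩ, ← rampProtocol_msgProb hΩ]
  rfl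

open Classical in
/-- The randomness for which the erased positions contain a codeword that changes the secret. -/
theorem card_ambiguous_le (hΩ : Fintype.card Ω = 2 ^ ω) (dec : ZMod 2 → Ω → Prop)
    (hdec : ∀ b, (Finset.univ.filter fun w : Ω => dec b w).card * 16 ≤ 9 * Fintype.card Ω)
    (v : Fin q → ZMod 2) (hv : v ≠ 0) :
    ((Finset.univ.filter fun t : RampRand q L Ω => ∃ e : Fin L → ZMod 2,
      (∀ j, e j = 0 ∨ dec (t.2.1 j) (t.2.2 j)) ∧ syndrome t.1 e = v).card : ℝ)
      ≤ (2 ^ q)⁻¹ * (25 / 16) ^ L * 2 ^ (q * L + L + L * ω) := by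
  let G : (Fin L → ZMod 2) → Finset ((Fin L → ZMod 2) × (Fin L → Ω)) := fun e =>
    Finset.univ.filter fun z => ∀ j, e j = 0 ∨ dec (z.1 j) (z.2 j)
  -- Summing over error patterns factors over positions: e j = 0 is always allowed, e j = 1 only at
  -- an erasure, giving 1 + 9/16 = 25/16 per position.
  have hG : ∑ e, ((G e).card : ℝ) ≤ (2 * 2 ^ ω * (25 / 16)) ^ L := by
    have h1 : ∀ e, ((G e).card : ℝ) = ∑ R : Fin L → ZMod 2, ∏ j,
        ((Finset.univ.filter fun w : Ω => e j = 0 ∨ dec (R j) w).card : ℝ) := by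
      intro e
      rw [Finset.card_filter, Fintype.sum_prod_type, Nat.cast_sum]
      refine Finset.sum_congr rfl fun R _ => ?_
      rw [← Finset.card_filter, card_filter_pi (fun j w => e j = 0 ∨ dec (R j) w), Nat.cast_prod]
    have h2 : ∀ e : Fin L → ZMod 2, ∑ R : Fin L → ZMod 2, ∏ j,
        ((Finset.univ.filter fun w : Ω => e j = 0 ∨ dec (R j) w).card : ℝ)
        = ∏ j, ∑ b, ((Finset.univ.filter fun w : Ω => e j = 0 ∨ dec b w).card : ℝ) := fun e =>
      sum_prod_pi fun j b => ((Finset.univ.filter fun w : Ω => e j = 0 ∨ dec b w).card : ℝ)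
    have h0 := sum_prod_pi fun (_ : Fin L) (a : ZMod 2) =>
      ∑ b, ((Finset.univ.filter fun w : Ω => a = 0 ∨ dec b w).card : ℝ)
    rw [Finset.sum_congr rfl fun e _ => (h1 e).trans (h2 e), h0]
    rw [Finset.prod_const, Finset.card_fin]
    refine pow_le_pow_left₀ (Finset.sum_nonneg fun _ _ => Finset.sum_nonneg fun _ _ =>
      Nat.cast_nonneg _) ?_ L
    rw [sum_zmod_two, sum_zmod_two, sum_zmod_two]
    have h3 := fun b => (Nat.cast_le (α := ℝ)).2 (hdec b)
    have h30 := h3 0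
    have h31 := h3 1
    rw [hΩ] at h30 h31
    push_cast at h30 h31
    have h4 : ∀ b, (Finset.univ.filter fun w : Ω => (0 : ZMod 2) = 0 ∨ dec b w).card = 2 ^ ω := by
      intro b
      rw [Finset.filter_true_of_mem fun _ _ => Or.inl rfl, Finset.card_univ (α := Ω), hΩ]
    have h5 : ∀ b, (Finset.univ.filter fun w : Ω => (1 : ZMod 2) = 0 ∨ dec b w)
        = Finset.univ.filter fun w : Ω => dec b w := fun b =>
      Finset.filter_congr fun w _ => by simp
    rw [h4, h4, h5, h5]
    push_cast
    linarith
  have hsub : (Finset.univ.filter fun t : RampRand q L Ω => ∃ e : Fin L → ZMod 2,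
      (∀ j, e j = 0 ∨ dec (t.2.1 j) (t.2.2 j)) ∧ syndrome t.1 e = v)
      ⊆ (Finset.univ.filter fun e : Fin L → ZMod 2 => e ≠ 0).biUnion fun e =>
        (Finset.univ.filter fun B : Fin L → Fin q → ZMod 2 => syndrome B e = v) ×ˢ G e := by
    intro t ht
    obtain ⟨e, he, hs⟩ := (Finset.mem_filter.1 ht).2
    refine Finset.mem_biUnion.2 ⟨e, Finset.mem_filter.2 ⟨Finset.mem_univ _, ?_⟩,
      Finset.mem_product.2 ⟨Finset.mem_filter.2 ⟨Finset.mem_univ _, hs⟩,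
        Finset.mem_filter.2 ⟨Finset.mem_univ _, he⟩⟩⟩
    rintro rfl
    apply hv
    rw [← hs]
    simp [syndrome]
  have hB : ∀ e : Fin L → ZMod 2, e ≠ 0 →
      ((Finset.univ.filter fun B : Fin L → Fin q → ZMod 2 => syndrome B e = v).card : ℝ)
        ≤ (2 ^ q)⁻¹ * 2 ^ (q * L) := by
    intro e he
    have := (Nat.cast_le (α := ℝ)).2 (card_syndrome_eq_le v he)
    push_cast at this
    rw [inv_mul_eq_div, le_div_iff₀ (by positivity)]
    convert this
  have h4 := (Nat.cast_le (α := ℝ)).2 ((Finset.card_le_card hsub).trans Finset.card_biUnion_le)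
  refine h4.trans ?_
  rw [Nat.cast_sum]
  calc _ ≤ ∑ e ∈ Finset.univ.filter (fun e : Fin L → ZMod 2 => e ≠ 0),
        (2 ^ q)⁻¹ * 2 ^ (q * L) * ((G e).card : ℝ) := by
        refine Finset.sum_le_sum fun e he => ?_
        rw [Finset.card_product, Nat.cast_mul]
        exact mul_le_mul_of_nonneg_right (hB e (Finset.mem_filter.1 he).2) (Nat.cast_nonneg _)
    _ ≤ ∑ e, (2 ^ q)⁻¹ * 2 ^ (q * L) * ((G e).card : ℝ) :=
        Finset.sum_le_sum_of_subset_of_nonneg (Finset.filter_subset _ _) fun _ _ _ => by positivity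
    _ ≤ (2 ^ q)⁻¹ * 2 ^ (q * L) * (2 * 2 ^ ω * (25 / 16)) ^ L := by
        rw [← Finset.mul_sum]
        exact mul_le_mul_of_nonneg_left hG (by positivity)
    _ = _ := by
        rw [mul_pow, mul_pow, pow_add, pow_add, mul_comm L ω, pow_mul 2 ω L]
        ring

/-- The decoder picks any secret consistent with the unerased bits. The true one is consistent;
another consistent secret yields a pattern supported on the erasures whose syndrome is the
difference of the two secrets. The factor 4 is the union bound over secrets. -/
theorem rampProtocol_correct (hq : 2 ≤ q) {f : Bits n → Bits n → Bool}
    (h : ∀ x y, f x y = true → ∃ dec : M₀ × M₁ → Option (ZMod 2),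
      (∀ b w, dec (alice x b w, bob y w) = none ∨ dec (alice x b w, bob y w) = some b) ∧
      ∀ b, (Finset.univ.filter fun w => dec (alice x b w, bob y w) = none).card * 16
        ≤ 9 * Fintype.card Ω) :
    (rampProtocol q L hΩ alice bob).Correct f (4 * ((2 ^ q)⁻¹ * (25 / 16) ^ L)) := by
  classical
  have h' : ∀ x y, ∃ dec : M₀ × M₁ → Option (ZMod 2), f x y = true →
      (∀ b w, dec (alice x b w, bob y w) = none ∨ dec (alice x b w, bob y w) = some b) ∧
      ∀ b, (Finset.univ.filter fun w => dec (alice x b w, bob y w) = none).card * 16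
        ≤ 9 * Fintype.card Ω := by
    intro x y
    by_cases hxy : f x y = true
    · obtain ⟨dec, hdec⟩ := h x y hxy
      exact ⟨dec, fun _ => hdec⟩
    · exact ⟨fun _ => none, fun h => absurd h hxy⟩
  choose dec hdec using h'
  let cons : (x y : Bits n) → ((Fin L → Fin q → ZMod 2) × (Fin q → ZMod 2) × (Fin L → M₀)) →
      (Fin L → M₁) → Bool × Bool → Prop := fun x y m₀ m₁ s =>
    ∃ R : Fin L → ZMod 2, (∀ j b, dec x y (m₀.2.2 j, m₁ j) = some b → R j = b) ∧
      syndrome m₀.1 R + embedSecret q s = m₀.2.1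
  refine ⟨fun m₀ x m₁ y => if hs : ∃ s, cons x y m₀ m₁ s then hs.choose else (false, false),
    fun s x y hxy => ?_⟩
  obtain ⟨hd1, hd2⟩ := hdec x y hxy
  obtain ⟨E, hE⟩ : ∃ E : ZMod 2 → Ω → Prop, ∀ b w,
      E b w ↔ dec x y (alice x b w, bob y w) = none := ⟨_, fun _ _ => Iff.rfl⟩
  let bad : Bool × Bool → RampRand q L Ω → Prop := fun s' t => s' ≠ s ∧ ∃ e : Fin L → ZMod 2,
      (∀ j, e j = 0 ∨ E (t.2.1 j) (t.2.2 j)) ∧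
      syndrome t.1 e = embedSecret q s + embedSecret q s'
  have hsub2 : ∀ a b : ZMod 2, a + b = 0 → a = b := by decide
  have hbad : ∀ s', ((Finset.univ.filter (bad s')).card : ℝ)
      ≤ (2 ^ q)⁻¹ * (25 / 16) ^ L * 2 ^ (q * L + L + L * ω) := by
    intro s'
    by_cases hs : s' = s
    · have : Finset.univ.filter (bad s') = ∅ :=
        Finset.eq_empty_of_forall_notMem fun t ht => (Finset.mem_filter.1 ht).2.1 hs
      rw [this]
      simp only [Finset.card_empty, Nat.cast_zero]
      positivity
    · have hv : embedSecret q s + embedSecret q s' ≠ 0 := by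
        intro h0
        apply hs
        refine (embedSecret_injective hq (funext fun i => hsub2 _ _ (congrFun h0 i))).symm
      refine le_trans (Nat.cast_le.2 (Finset.card_le_card fun t ht => ?_)) (card_ambiguous_le hΩ
        E (fun b => ?_) _ hv)
      · exact Finset.mem_filter.2 ⟨Finset.mem_univ _, (Finset.mem_filter.1 ht).2.2⟩
      · simp only [hE]
        convert hd2 b
  let good : RampRand q L Ω → Prop := fun t =>
    (if hs : ∃ s', cons x y (t.1, syndrome t.1 t.2.1 + embedSecret q s,
      fun j => alice x (t.2.1 j) (t.2.2 j)) (fun j => bob y (t.2.2 j)) s' then hs.choose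
      else (false, false)) = s
  have hgood : ∀ t, ¬ good t → ∃ s', bad s' t := by
    intro t ht
    have hex : ∃ s', cons x y (t.1, syndrome t.1 t.2.1 + embedSecret q s,
        fun j => alice x (t.2.1 j) (t.2.2 j)) (fun j => bob y (t.2.2 j)) s' := by
      refine ⟨s, t.2.1, fun j b hb => ?_, rfl⟩
      dsimp only at hb
      rcases hd1 (t.2.1 j) (t.2.2 j) with h0 | h0
      · rw [h0] at hb; simp at hb
      · rw [h0] at hb; simpa using hb
    have ht' : hex.choose ≠ s := by
      intro h0
      apply ht
      simp only [good]
      rw [dif_pos hex, h0]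
    obtain ⟨R, hR1, hR2⟩ := hex.choose_spec
    refine ⟨hex.choose, ht', R + t.2.1, fun j => ?_, ?_⟩
    · rcases hd1 (t.2.1 j) (t.2.2 j) with h0 | h0
      · exact Or.inr ((hE _ _).2 h0)
      · left
        rw [Pi.add_apply, hR1 j _ h0]
        have : ∀ a : ZMod 2, a + a = 0 := by decide
        exact this _
    · dsimp only at hR2
      have h3 : syndrome t.1 (R + t.2.1) = syndrome t.1 R + syndrome t.1 t.2.1 := by
        simp [syndrome, add_smul, Finset.sum_add_distrib]
      rw [h3]
      have h4 : ∀ a b c d : ZMod 2, a + b = c + d → a + c = d + b := by decide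
      exact funext fun i => h4 _ _ _ _ (congrFun hR2 i)
  have hprob : (probBits (q * L + L + L * ω) fun r => good (rampEquiv q L hΩ r))
      = ((Finset.univ.filter good).card : ℝ) / 2 ^ (q * L + L + L * ω) :=
    probBits_comp_equiv _ _
  refine le_trans ?_ (le_of_eq hprob.symm)
  have h5 : (Finset.univ.filter fun t => ¬ good t) ⊆
      Finset.univ.biUnion fun s' => Finset.univ.filter (bad s') := by
    intro t ht
    obtain ⟨s', hs'⟩ := hgood t (Finset.mem_filter.1 ht).2
    exact Finset.mem_biUnion.2 ⟨s', Finset.mem_univ _, Finset.mem_filter.2 ⟨Finset.mem_univ _, hs'⟩⟩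
  have h6 := (Nat.cast_le (α := ℝ)).2 ((Finset.card_le_card h5).trans Finset.card_biUnion_le)
  rw [Nat.cast_sum] at h6
  have h7 := h6.trans (Finset.sum_le_sum fun s' _ => hbad s')
  have h8 := Finset.card_filter_add_card_filter_not (s := Finset.univ) good
  rw [Finset.card_univ, card_rampRand hΩ] at h8
  have h9 := congrArg (Nat.cast : ℕ → ℝ) h8
  push_cast at h9
  simp only [Finset.sum_const, Finset.card_univ, Fintype.card_prod, Fintype.card_bool,
    nsmul_eq_mul] at h7
  rw [le_div_iff₀ (by positivity)]
  push_cast at h7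
  linarith

end Amplify

/-- Amplification of a one-bit protocol with constant errors. -/
theorem hasCDSTwo_of_gadget {n ω : ℕ} {f : Bits n → Bits n → Bool} {Ω M₀ M₁ : Type} [Fintype Ω]
    [Fintype M₀] [Fintype M₁] (hΩ : Fintype.card Ω = 2 ^ ω)
    (alice : Bits n → ZMod 2 → Ω → M₀) (bob : Bits n → Ω → M₁)
    (hc : ∀ x y, f x y = true → ∃ dec : M₀ × M₁ → Option (ZMod 2),
      (∀ b w, dec (alice x b w, bob y w) = none ∨ dec (alice x b w, bob y w) = some b) ∧
      ∀ b, (Finset.univ.filter fun w => dec (alice x b w, bob y w) = none).card * 16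
        ≤ 9 * Fintype.card Ω)
    (hs : ∀ x y, f x y = false →
      ∑ m, |gadgetDist ω alice bob x y 0 m - gadgetDist ω alice bob x y 1 m| ≤ 1 / 8) (k : ℕ) :
    HasCDSTwo f ((1 / 2 : ℝ) ^ k) ((1 / 2 : ℝ) ^ k)
      ((9 * (k + 2)) * (12 * (k + 2)) + 12 * (k + 2) + 12 * (k + 2) * ω) := by
  obtain ⟨D, hD⟩ := rampProtocol_correct (q := 9 * (k + 2)) (L := 12 * (k + 2)) hΩ alice bob
    (by omega) hc
  obtain ⟨Sim, hSim, hS⟩ := rampProtocol_secure (q := 9 * (k + 2)) (L := 12 * (k + 2)) hΩ alice bob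
    hs
  -- Per unit of k + 2, with q = 9 and L = 12, both 2^(-9) (25/16)^12 and 2^9 (17/32)^12 are below
  -- 1/2; the two spare units absorb the prefactors.
  have e1 : 4 * (((2 : ℝ) ^ (9 * (k + 2)))⁻¹ * (25 / 16) ^ (12 * (k + 2))) ≤ (1 / 2) ^ k := by
    rw [← inv_pow, pow_mul, pow_mul (25 / 16 : ℝ), ← mul_pow]
    calc 4 * ((2 : ℝ)⁻¹ ^ 9 * (25 / 16) ^ 12) ^ (k + 2) ≤ 4 * (1 / 2) ^ (k + 2) := by
          gcongr
          norm_num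
      _ = _ := by rw [pow_add]; norm_num; ring
  have e2 : 2 * (2 : ℝ) ^ (9 * (k + 2)) * (17 / 32) ^ (12 * (k + 2)) ≤ (1 / 2) ^ k := by
    rw [pow_mul, pow_mul (17 / 32 : ℝ), mul_assoc, ← mul_pow]
    calc 2 * ((2 : ℝ) ^ 9 * (17 / 32) ^ 12) ^ (k + 2) ≤ 2 * (1 / 2) ^ (k + 2) := by
          gcongr
          norm_num
      _ ≤ _ := by
          rw [pow_add]
          have : (0 : ℝ) < (1 / 2) ^ k := by positivity
          norm_num
          linarith
  exact ⟨_, ⟨D, fun s x y hxy => le_trans (by linarith) (hD s x y hxy)⟩, Sim, hSim,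
    fun s x y hxy => (hS s x y hxy).trans e2⟩

end

noncomputable section

set_option linter.unusedSectionVars false

-- A coupling bound: each random string on which the coupled messages differ costs at most 2 in
-- one-norm.
open Classical in
theorem sum_abs_card_sub_le {Ω M : Type} [Fintype Ω] [Fintype M] (A B : Ω → M)
    (Φ : Equiv.Perm Ω) :
    ∑ m, |((Finset.univ.filter fun w => A w = m).card : ℝ)
      - ((Finset.univ.filter fun w => B w = m).card : ℝ)|
      ≤ 2 * ((Finset.univ.filter fun w => A w ≠ B (Φ w)).card : ℝ) := by
  have h1 : ∀ m, |((Finset.univ.filter fun w => A w = m).card : ℝ)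
      - ((Finset.univ.filter fun w => B w = m).card : ℝ)|
      ≤ ∑ w, |(if A w = m then (1 : ℝ) else 0) - if B (Φ w) = m then 1 else 0| := by
    intro m
    have h2 : ((Finset.univ.filter fun w => B w = m).card : ℝ)
        = ∑ w, if B (Φ w) = m then (1 : ℝ) else 0 := by
      rw [Equiv.sum_comp Φ fun w => if B w = m then (1 : ℝ) else 0, Finset.sum_boole]
    rw [h2, ← Finset.sum_boole, ← Finset.sum_sub_distrib]
    exact Finset.abs_sum_le_sum_abs _ _
  refine (Finset.sum_le_sum fun m _ => h1 m).trans ?_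
  rw [Finset.sum_comm, ← Finset.sum_boole, Finset.mul_sum]
  refine Finset.sum_le_sum fun w _ => ?_
  by_cases h : A w = B (Φ w)
  · simp [h]
  · rw [if_pos h]
    calc _ ≤ ∑ m, ((if A w = m then (1 : ℝ) else 0) + if B (Φ w) = m then 1 else 0) :=
          Finset.sum_le_sum fun m _ => by split_ifs <;> norm_num
      _ = 2 * 1 := by
          rw [Finset.sum_add_distrib]
          simp only [Finset.sum_ite_eq, Finset.mem_univ, if_true]
          norm_num

/-! ### Two copies: from certificates to erasures -/

section Pair
variable {n : ℕ} {Ω M₀ M₁ : Type} [Fintype Ω] [Fintype M₀] [Fintype M₁]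
  (alice : Bits n → Bool → Ω → M₀) (bob : Bits n → Ω → M₁)

/-- Two copies of the protocol, for the secret and its negation, turn certificates for one value
into decoding with erasures. -/
def pairAlice (x : Bits n) (b : ZMod 2) (w : Ω × Ω) :
    M₀ × M₀ :=
  (alice x (decide (b = 1)) w.1, alice x (decide (b = 0)) w.2)

/-- Bob's messages for the two copies. -/
def pairBob (y : Bits n) (w : Ω × Ω) :
    M₁ × M₁ :=
  (bob y w.1, bob y w.2)

open Classical in
theorem exists_pair_decoder {x y : Bits n} (hcert : ∃ cert : M₀ × M₁ → Prop,
      (∀ w, ¬ cert (alice x true w, bob y w)) ∧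
      (Finset.univ.filter fun w => ¬ cert (alice x false w, bob y w)).card * 16
        ≤ 9 * Fintype.card Ω) :
    ∃ dec : (M₀ × M₀) ×
        (M₁ × M₁) → Option (ZMod 2),
      (∀ b (w : Ω × Ω),
        dec (pairAlice alice x b w, pairBob bob y w) = none ∨
        dec (pairAlice alice x b w, pairBob bob y w) = some b) ∧
      ∀ b, (Finset.univ.filter fun w : Ω × Ω =>
        dec (pairAlice alice x b w, pairBob bob y w) = none).card * 16
        ≤ 9 * Fintype.card (Ω × Ω) := by
  obtain ⟨cert, hc1, hc2⟩ := hcert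
  replace hc2 : (Finset.univ.filter fun w => ¬ cert (alice x false w, bob y w)).card * 16
      ≤ 9 * Fintype.card Ω := by convert hc2
  -- For b = 0 the first copy carries `false`, for b = 1 the second does; the other copy carries
  -- `true` and is never certified, so no wrong answer occurs.
  refine ⟨fun M => if cert (M.1.1, M.2.1) then some 0 else if cert (M.1.2, M.2.2) then some 1
    else none, fun b w => ?_, fun b => ?_⟩
  · rcases zmod_two_cases b with rfl | rfl
    · have h := hc1 w.2
      simp only [pairAlice, pairBob, decide_true, if_neg h]
      split_ifs <;> simp
    · have h := hc1 w.1
      simp only [pairAlice, pairBob, decide_true, if_neg h]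
      split_ifs <;> simp
  · have hd : decide ((0 : ZMod 2) = 1) = false := by decide
    have hd' : decide ((1 : ZMod 2) = 0) = false := by decide
    rcases zmod_two_cases b with rfl | rfl
    · have h : (Finset.univ.filter fun w : Ω × Ω =>
          (if cert ((pairAlice alice x 0 w).1, (pairBob bob y w).1) then some (0 : ZMod 2)
            else if cert ((pairAlice alice x 0 w).2, (pairBob bob y w).2) then some 1 else none) = none)
          ⊆ (Finset.univ.filter fun w => ¬ cert (alice x false w, bob y w)) ×ˢ
            Finset.univ := by
        intro w hw
        have hw := (Finset.mem_filter.1 hw).2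
        refine Finset.mem_product.2 ⟨Finset.mem_filter.2 ⟨Finset.mem_univ _, fun hcw => ?_⟩,
          Finset.mem_univ _⟩
        simp only [pairAlice, pairBob, hd] at hw
        rw [if_pos hcw] at hw
        simp at hw
      refine (Nat.mul_le_mul_right 16 (Finset.card_le_card h)).trans ?_
      rw [Finset.card_product, Finset.card_univ, Fintype.card_prod (Ω),
        mul_right_comm, ← mul_assoc]
      exact Nat.mul_le_mul_right _ hc2
    · have h : (Finset.univ.filter fun w : Ω × Ω =>
          (if cert ((pairAlice alice x 1 w).1, (pairBob bob y w).1) then some (0 : ZMod 2)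
            else if cert ((pairAlice alice x 1 w).2, (pairBob bob y w).2) then some 1 else none) = none)
          ⊆ Finset.univ ×ˢ
            (Finset.univ.filter fun w => ¬ cert (alice x false w, bob y w)) := by
        intro w hw
        have hw := (Finset.mem_filter.1 hw).2
        refine Finset.mem_product.2 ⟨Finset.mem_univ _, Finset.mem_filter.2 ⟨Finset.mem_univ _,
          fun hcw => ?_⟩⟩
        simp only [pairAlice, pairBob, hd'] at hw
        rw [if_pos hcw] at hw
        split_ifs at hw
      refine (Nat.mul_le_mul_right 16 (Finset.card_le_card h)).trans ?_
      rw [Finset.card_product, Finset.card_univ, Fintype.card_prod (Ω),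
        mul_assoc, mul_left_comm 9]
      exact Nat.mul_le_mul_left _ hc2

open Classical in
theorem sum_abs_gadgetDist_pair_le {ω : ℕ}
    (hΩ : Fintype.card (Ω × Ω) = 2 ^ ω)
    {x y : Bits n} (hperm : ∃ φ : Equiv.Perm Ω,
      (Finset.univ.filter fun w =>
        (alice x false w, bob y w) ≠ (alice x true (φ w), bob y (φ w))).card * 32
        ≤ Fintype.card Ω) :
    ∑ μ, |gadgetDist ω (pairAlice alice) (pairBob bob) x y 0 μ
      - gadgetDist ω (pairAlice alice) (pairBob bob) x y 1 μ|
      ≤ 1 / 8 := by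
  obtain ⟨φ, hφ⟩ := hperm
  have hd : decide ((0 : ZMod 2) = 1) = false := by decide
  have hd' : decide ((1 : ZMod 2) = 0) = false := by decide
  let bad := Finset.univ.filter fun w : Ω => (alice x false w, bob y w)
        ≠ (alice x true (φ w), bob y (φ w))
  have hbad : (bad.card : ℝ) * 32 ≤ Fintype.card (Ω) := by
    have : bad.card * 32 ≤ Fintype.card Ω := by convert hφ
    exact_mod_cast this
  -- Changing b from 0 to 1 turns `false` into `true` in the first copy and `true` into `false` in
  -- the second, hence the inverse there. The bad fraction is at most 2/32, which gives 1/8 in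
  -- one-norm.
  let Φ : Equiv.Perm (Ω × Ω) := φ.prodCongr φ.symm
  have h1 := sum_abs_card_sub_le
    (fun w => (pairAlice alice x 0 w, pairBob bob y w))
    (fun w => (pairAlice alice x 1 w, pairBob bob y w)) Φ
  have h2 : (Finset.univ.filter fun w : Ω × Ω =>
      (pairAlice alice x 0 w, pairBob bob y w) ≠ (pairAlice alice x 1 (Φ w), pairBob bob y (Φ w)))
      ⊆ (bad ×ˢ Finset.univ) ∪ (Finset.univ ×ˢ bad.map φ.toEmbedding) := by
    intro w hw
    by_contra hn
    rw [Finset.mem_union, not_or] at hn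
    obtain ⟨hn1, hn2⟩ := hn
    apply (Finset.mem_filter.1 hw).2
    have e1 : (alice x false w.1, bob y w.1)
        = (alice x true (φ w.1), bob y (φ w.1)) := by
      by_contra h
      exact hn1 (Finset.mem_product.2 ⟨Finset.mem_filter.2 ⟨Finset.mem_univ _, h⟩,
        Finset.mem_univ _⟩)
    have e2 : (alice x false (φ.symm w.2), bob y (φ.symm w.2))
        = (alice x true w.2, bob y w.2) := by
      by_contra h
      refine hn2 (Finset.mem_product.2 ⟨Finset.mem_univ _, Finset.mem_map.2 ⟨φ.symm w.2,
        Finset.mem_filter.2 ⟨Finset.mem_univ _, ?_⟩, by simp⟩⟩)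
      rwa [Equiv.apply_symm_apply]
    simp only [Prod.mk.injEq] at e1 e2
    simp only [pairAlice, pairBob, hd, hd', decide_true, Φ, Equiv.prodCongr_apply, Prod.map,
      e1.1, e1.2, e2.1, e2.2]
  have h3 := (Finset.card_le_card h2).trans (Finset.card_union_le _ _)
  rw [Finset.card_product, Finset.card_product, Finset.card_map, Finset.card_univ] at h3
  have h4 := (Nat.cast_le (α := ℝ)).2 h3
  push_cast at h4
  have h5 : ((2 : ℝ) ^ ω) = Fintype.card (Ω) * Fintype.card (Ω) := by
    rw [Fintype.card_prod (Ω)] at hΩ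
    exact_mod_cast hΩ.symm
  have h6 := mul_le_mul_of_nonneg_right hbad (Nat.cast_nonneg (α := ℝ)
    (Fintype.card (Ω)))
  have h7 : ∀ μ, |gadgetDist ω (pairAlice alice) (pairBob bob) x y
      0 μ - gadgetDist ω (pairAlice alice) (pairBob bob) x y 1 μ|
      = |((Finset.univ.filter fun w : Ω × Ω =>
          (pairAlice alice x 0 w, pairBob bob y w) = μ).card : ℝ)
        - ((Finset.univ.filter fun w : Ω × Ω =>
          (pairAlice alice x 1 w, pairBob bob y w) = μ).card : ℝ)| / 2 ^ ω := by
    intro μ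
    unfold gadgetDist
    rw [← sub_div, abs_div, abs_of_pos (show (0 : ℝ) < 2 ^ ω by positivity)]
    congr!
  rw [Finset.sum_congr rfl fun μ _ => h7 μ, ← Finset.sum_div, div_le_iff₀ (by positivity), h5]
  refine le_trans (le_of_eq (by congr!)) (h1.trans ((mul_le_mul_of_nonneg_left
    (le_trans (le_of_eq (by congr!)) h4) (by norm_num)).trans ?_))
  linarith

end Pair

open Classical in
/-- Amplification of a protocol with one-sided certificates. -/
theorem hasCDSTwo_of_certificates {n ω : ℕ} {f : Bits n → Bits n → Bool} {Ω M₀ M₁ : Type}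
    [Fintype Ω] [Fintype M₀] [Fintype M₁] (hΩ : Fintype.card Ω = 2 ^ ω)
    (alice : Bits n → Bool → Ω → M₀) (bob : Bits n → Ω → M₁)
    (hc : ∀ x y, f x y = true → ∃ cert : M₀ × M₁ → Prop,
      (∀ w, ¬ cert (alice x true w, bob y w)) ∧
      (Finset.univ.filter fun w => ¬ cert (alice x false w, bob y w)).card * 16
        ≤ 9 * Fintype.card Ω)
    (hs : ∀ x y, f x y = false → ∃ φ : Equiv.Perm Ω,
      (Finset.univ.filter fun w =>
        (alice x false w, bob y w) ≠ (alice x true (φ w), bob y (φ w))).card * 32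
        ≤ Fintype.card Ω) (k : ℕ) :
    HasCDSTwo f ((1 / 2 : ℝ) ^ k) ((1 / 2 : ℝ) ^ k)
      ((9 * (k + 2)) * (12 * (k + 2)) + 12 * (k + 2) + 12 * (k + 2) * (2 * ω)) := by
  have hΩ2 : Fintype.card (Ω × Ω) = 2 ^ (2 * ω) := by
    rw [Fintype.card_prod, hΩ, ← pow_add, two_mul]
  refine hasCDSTwo_of_gadget hΩ2 (pairAlice alice) (pairBob bob) (fun x y hxy => ?_)
    (fun x y hxy => sum_abs_gadgetDist_pair_le alice bob hΩ2 (hs x y hxy)) k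
  obtain ⟨dec, hd⟩ := exists_pair_decoder alice bob (hc x y hxy)
  refine ⟨dec, hd.1, fun b => ?_⟩
  convert hd.2 b

theorem card_shareRand (m a b c : ℕ) [NeZero (2 ^ b)] [NeZero (2 ^ c)] :
    Fintype.card (ShareRand m (2 ^ a) (2 ^ b) (2 ^ c))
      = 2 ^ (a + b + 2 * m * (c + 1) + 8 * m * (c + 1)) := by
  have h : Fintype.card (ShareGroup (2 ^ c)) = 2 ^ (c + 1) := by
    rw [Fintype.card_prod, ZMod.card, ZMod.card, pow_succ]
  rw [Fintype.card_prod, Fintype.card_prod, Fintype.card_prod, Fintype.card_fun, Fintype.card_fun,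
    Fintype.card_fun, Fintype.card_fun, h, ZMod.card, Fintype.card_fin, Fintype.card_bool,
    Fintype.card_sum, Fintype.card_fin]
  simp only [← pow_mul, ← pow_add]
  congr 1
  ring

theorem hasCDSTwo_nqr₂_of_le {m R K N ω : ℕ} [NeZero K] [NeZero N] (hR : 16 ≤ R)
    (hRM : 64 * 2 ^ m ≤ R) (hKM : 64 * (2 ^ m * R ^ 2) ≤ K) (hN : 2 ^ m * R ^ 2 + 2 ^ m * K ≤ N)
    (hΩ : Fintype.card (ShareRand m R K N) = 2 ^ ω) (k : ℕ) :
    HasCDSTwo (NQR₂ m) ((1 / 2 : ℝ) ^ k) ((1 / 2 : ℝ) ^ k)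
      ((9 * (k + 2)) * (12 * (k + 2)) + 12 * (k + 2) + 12 * (k + 2) * (2 * ω)) := by
  classical
  refine hasCDSTwo_of_certificates hΩ (shareAlice (m := m) (R := R) (K := K) (N := N))
    (shareBob (m := m) (R := R) (K := K) (N := N)) (fun x y hxy => ?_) (fun x y hxy => ?_) k
  · obtain ⟨cert, h1, h2⟩ := exists_certificate (K := K) hR hN hxy
    refine ⟨cert, h1, le_trans (le_of_eq ?_) h2⟩
    congr!
  · obtain ⟨φ, hφ⟩ := exists_share_perm (N := N) hRM hKM hxy
    refine ⟨φ, le_trans (le_of_eq ?_) hφ⟩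
    congr!

/-- CDS of two bits for `NQR₂`. -/
theorem hasCDSTwo_nqr₂ (m k : ℕ) :
    HasCDSTwo (NQR₂ m) ((1 / 2 : ℝ) ^ k) ((1 / 2 : ℝ) ^ k)
      ((9 * (k + 2)) * (12 * (k + 2)) + 12 * (k + 2)
        + 12 * (k + 2) * (2 * (40 * m ^ 2 + 204 * m + 24))) := by
  -- Powers of two, so that the randomness is a whole number of bits: R = 2^(m+6), K = 2^(3m+18), N
  -- = 2^(4m+19), each chosen to meet the bound imposed by its predecessors.
  have : NeZero (2 ^ (3 * m + 18)) := ⟨by positivity⟩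
  have : NeZero (2 ^ (4 * m + 19)) := ⟨by positivity⟩
  have hR : 16 ≤ 2 ^ (m + 6) := by
    calc 16 ≤ 2 ^ 6 := by norm_num
      _ ≤ _ := Nat.pow_le_pow_right (by norm_num) (by omega)
  have hRM : 64 * 2 ^ m ≤ 2 ^ (m + 6) := by rw [pow_add]; omega
  have hKM : 64 * (2 ^ m * (2 ^ (m + 6)) ^ 2) ≤ 2 ^ (3 * m + 18) := by
    rw [show 64 = 2 ^ 6 by norm_num, ← pow_mul, ← pow_add, ← pow_add]
    exact Nat.pow_le_pow_right (by norm_num) (by omega)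
  have hN : 2 ^ m * (2 ^ (m + 6)) ^ 2 + 2 ^ m * 2 ^ (3 * m + 18) ≤ 2 ^ (4 * m + 19) := by
    have e1 : 2 ^ m * (2 ^ (m + 6)) ^ 2 = 2 ^ (3 * m + 12) := by
      rw [← pow_mul, ← pow_add]; congr 1; ring
    have e2 : 2 ^ m * 2 ^ (3 * m + 18) = 2 ^ (4 * m + 18) := by
      rw [← pow_add]; congr 1; ring
    have e3 : 2 ^ (4 * m + 19) = 2 ^ (4 * m + 18) + 2 ^ (4 * m + 18) := by
      rw [← mul_two, ← pow_succ]
    have e4 : 2 ^ (3 * m + 12) ≤ 2 ^ (4 * m + 18) :=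
      Nat.pow_le_pow_right (by norm_num) (by omega)
    rw [e1, e2, e3]
    exact Nat.add_le_add_right e4 _
  refine hasCDSTwo_nqr₂_of_le hR hRM hKM hN ?_ k
  rw [card_shareRand]
  congr 1
  ring

end

noncomputable section

set_option linter.unusedSectionVars false

/-! ### Budgets -/

theorem HasCDSTwo.comp {n n' ρ : ℕ} {g : Bits n → Bits n → Bool} {ε δ : ℝ}
    (h : HasCDSTwo g ε δ ρ) (φ : Bits n' → Bits n) :
    HasCDSTwo (fun x y => g (φ x) (φ y)) ε δ ρ := by
  obtain ⟨P, ⟨D, hD⟩, Sim, hSim, hS⟩ := h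
  exact ⟨{ M₀ := P.M₀, M₁ := P.M₁, alice := fun x => P.alice (φ x), bob := fun y => P.bob (φ y) },
    ⟨fun m₀ x m₁ y => D m₀ (φ x) m₁ (φ y), fun s x y hxy => hD s _ _ hxy⟩,
    fun x y => Sim (φ x) (φ y), fun x y => hSim _ _, fun s x y hxy => hS s _ _ hxy⟩

theorem HasCDS.mono {n ρ : ℕ} {f : Bits n → Bits n → Bool} {ε ε' δ δ' : ℝ} (h : HasCDS f ε δ ρ)
    (hε : ε ≤ ε') (hδ : δ ≤ δ') : HasCDS f ε' δ' ρ := by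
  obtain ⟨P, ⟨D, hD⟩, Sim, hSim, hS⟩ := h
  exact ⟨P, ⟨D, fun s x y hxy => (by linarith : 1 - ε' ≤ 1 - ε).trans (hD s x y hxy)⟩, Sim, hSim,
    fun s x y hxy => (hS s x y hxy).trans hδ⟩

theorem HasCDQS.mono {n ρ : ℕ} {f : Bits n → Bits n → Bool} {ε ε' δ δ' : ℝ}
    (h : HasCDQS f ε δ ρ) (hε : ε ≤ ε') (hδ : δ ≤ δ') : HasCDQS f ε' δ' ρ := by
  obtain ⟨P, ⟨D, hD, hD'⟩, Sim, hSim, hS⟩ := h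
  exact ⟨P, ⟨D, hD, fun x y hxy => (hD' x y hxy).trans (ENNReal.ofReal_le_ofReal hε)⟩, Sim, hSim,
    fun x y hxy => (hS x y hxy).trans (ENNReal.ofReal_le_ofReal hδ)⟩

theorem HasCDSTwo.tasks {n ρ k : ℕ} {f : Bits n → Bits n → Bool}
    (h : HasCDSTwo f ((1 / 2 : ℝ) ^ (k + 5)) ((1 / 2 : ℝ) ^ (k + 5)) ρ) (hk : 1 ≤ k) {B C : ℕ}
    (hB : ρ + 2 ≤ B) (hC : 1 ≤ C) :
    (∃ ρ ≤ B, HasCDS f ((1 / 2 : ℝ) ^ k) (k * (1 / 2 : ℝ) ^ k) ρ) ∧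
    (∃ ρ ≤ B, HasCDQS f ((1 / 2 : ℝ) ^ k) (k * (1 / 2 : ℝ) ^ k) ρ) ∧
    (∃ E ≤ B, HasRouting f (C * (k * (1 / 2 : ℝ) ^ k)) E) := by
  have e0 : (0 : ℝ) < (1 / 2) ^ k := by positivity
  -- Five extra units give a factor 1/32, more than enough for the losses 2ε and 8δ of the quantum
  -- reductions.
  have e1 : (1 / 2 : ℝ) ^ (k + 5) = (1 / 2) ^ k / 32 := by rw [pow_add]; norm_num; ring
  have hk' : (1 : ℝ) ≤ k := by exact_mod_cast hk
  have hC' : (1 : ℝ) ≤ C := by exact_mod_cast hC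
  have e2 : (1 / 2 : ℝ) ^ k ≤ k * (1 / 2) ^ k := le_mul_of_one_le_left e0.le hk'
  have e3 : k * (1 / 2 : ℝ) ^ k ≤ C * (k * (1 / 2) ^ k) :=
    le_mul_of_one_le_left (by positivity) hC'
  rw [e1] at h
  exact ⟨⟨ρ, by omega, h.hasCDS.mono (by linarith) (by linarith)⟩,
    ⟨ρ + 2, hB, h.hasCDQS.mono (by linarith) (by linarith)⟩,
    ⟨ρ + 2, hB, h.hasRouting (by linarith) (by linarith)⟩⟩

theorem exists_hasCDSTwo_nqr₂ (m k : ℕ) (hk : 1 ≤ k) :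
    ∃ ρ, ρ + 2 ≤ 60000 * (k ^ 2 + k * m ^ 2) ∧
      HasCDSTwo (NQR₂ m) ((1 / 2 : ℝ) ^ (k + 5)) ((1 / 2 : ℝ) ^ (k + 5)) ρ := by
  refine ⟨_, ?_, hasCDSTwo_nqr₂ m (k + 5)⟩
  have h1 : m ≤ m ^ 2 := Nat.le_self_pow two_ne_zero m
  have h2 : k ≤ k ^ 2 := Nat.le_self_pow two_ne_zero k
  have h3 : k * m ≤ k * m ^ 2 := Nat.mul_le_mul_left k h1
  have h4 : m ≤ k * m := Nat.le_mul_of_pos_left m hk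
  have h5 : m ^ 2 ≤ k * m ^ 2 := Nat.le_mul_of_pos_left _ hk
  have e : 9 * (k + 5 + 2) * (12 * (k + 5 + 2)) + 12 * (k + 5 + 2)
        + 12 * (k + 5 + 2) * (2 * (40 * m ^ 2 + 204 * m + 24)) + 2
      = 108 * k ^ 2 + 2100 * k + 9410 + 960 * (k * m ^ 2) + 6720 * m ^ 2 + 4896 * (k * m)
        + 34272 * m := by ring
  rw [e]
  omega

/-! ### Constant functions -/

theorem diamondDist_self_le {a b : Type} [Fintype a] [Fintype b] [DecidableEq a] [DecidableEq b]
    (Φ : Op a →ₗ[ℂ] Op b) {ε : ℝ} (hε : 0 ≤ ε) : diamondDist Φ Φ ≤ ENNReal.ofReal ε :=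
  diamondDist_le_sum_abs Φ Φ (fun i : Empty => i.elim) (fun i => i.elim) (fun i => i.elim)
    (by simp) (by simpa using hε)

theorem isChannel_relabel {a b : Type} [Fintype a] [Fintype b] [DecidableEq a] [DecidableEq b]
    (e : a ≃ b) : IsChannel (relabel e) := by
  rw [relabel_eq]
  refine isChannel_krausMap _ ?_
  ext i j
  simp [Matrix.mul_apply, Matrix.one_apply, apply_ite (starRingEnd ℂ), Equiv.symm_apply_eq]
  simp only [eq_comm]

theorem hasCDS_true {n : ℕ} {f : Bits n → Bits n → Bool} (hf : ∀ x y, f x y = true) {ε δ : ℝ}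
    (hε : 0 ≤ ε) : HasCDS f ε δ 0 := by
  refine ⟨{ M₀ := Bool, M₁ := Unit, alice := fun _ s _ => s, bob := fun _ _ => () },
    ⟨fun m₀ _ _ _ => m₀, fun s x y _ => ?_⟩, fun _ _ => Pi.single (true, ()) 1,
    fun _ _ => single_mem_stdSimplex ℝ _, fun s x y h => by simp [hf] at h⟩
  simpa [probBits] using hε

theorem hasCDQS_true {n : ℕ} {f : Bits n → Bits n → Bool} (hf : ∀ x y, f x y = true) {ε δ : ℝ}
    (hε : 0 ≤ ε) : HasCDQS f ε δ 0 := by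
  refine ⟨{ M₀ := Fin 2 × Bits 0, M₁ := Bits 0, alice := fun _ => LinearMap.id,
            bob := fun _ => LinearMap.id, alice_channel := fun _ => isChannel_id,
            bob_channel := fun _ => isChannel_id },
    ⟨fun _ _ => relabel ((Equiv.prodUnique _ _).trans (Equiv.prodUnique _ _)),
      fun _ _ => isChannel_relabel _, fun x y _ => ?_⟩,
    fun _ _ => Matrix.diagonal (Pi.single ((0, default), default) 1), fun _ _ => ⟨?_, ?_⟩,
    fun x y h => by simp [hf] at h⟩
  · refine le_trans (le_of_eq ?_) (diamondDist_self_le (LinearMap.id : Op (Fin 2) →ₗ[ℂ] _) hε)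
    congr 1
    ext1 X
    ext i j
    change X i j * sharedBits 0 (default, default) (default, default) = X i j
    simp [sharedBits]
  · refine Matrix.PosSemidef.diagonal ?_
    exact Pi.single_nonneg.2 zero_le_one
  · simp [Matrix.trace_diagonal]

theorem hasRouting_true {n : ℕ} {f : Bits n → Bits n → Bool} (hf : ∀ x y, f x y = true) {ε : ℝ}
    (hε : 0 ≤ ε) : HasRouting f ε 0 := by
  refine ⟨{ M₀ := Fin 2 × Bits 0, M₀' := Unit, M₁ := Bits 0, M₁' := Unit,
            alice := fun _ => relabel (Equiv.prodUnique _ _).symm,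
            bob := fun _ => relabel (Equiv.prodUnique _ _).symm,
            alice_channel := fun _ => isChannel_relabel _,
            bob_channel := fun _ => isChannel_relabel _ },
    ⟨fun _ _ => relabel ((Equiv.prodUnique _ _).trans (Equiv.prodUnique _ _)),
      fun _ _ => isChannel_relabel _, fun x y _ => ?_⟩,
    fun _ _ => krausMap (Matrix.of fun i _ => if i = 0 then 1 else 0),
    fun _ _ => isChannel_krausMap _ ?_, fun x y h => by simp [hf] at h⟩
  · refine le_trans (le_of_eq ?_) (diamondDist_self_le (LinearMap.id : Op (Fin 2) →ₗ[ℂ] _) hε)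
    congr 1
    ext1 X
    ext i j
    change ∑ k : Unit × Unit, X i j * eprPairs 0 (default, default) (default, default) = X i j
    simp [eprPairs]
  · ext i j
    simp [Matrix.mul_apply, Matrix.one_apply, Subsingleton.elim i j]

/-- With no digits, w = u = 0, and the empty set is authorized. The budget is 0 for m = 0, so the
secret is then sent in the clear. -/
theorem nqr₂_zero (x y : Bits (4 * 0)) : NQR₂ 0 x y = true := by
  refine (nqr₂_eq_true_iff x y).2 ⟨_, NQRMinimal.zero Fin.elim0 Fin.elim0 ?_ ?_, ?_⟩
  · simp [bitsVal]
  · simp [bitsVal]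
  · rintro p (⟨i, _⟩ | ⟨i, _⟩) <;> exact i.elim0

/-! ### Padding -/

/-- The quadratically padded family. -/
def paddedNQR (n : ℕ) (x y : Bits n) : Bool :=
  NQR₂ (Nat.sqrt n / 4)
    (fun i => x (Fin.castLE ((Nat.mul_div_le _ 4).trans (Nat.sqrt_le_self n)) i))
    (fun i => y (Fin.castLE ((Nat.mul_div_le _ 4).trans (Nat.sqrt_le_self n)) i))

theorem exists_padding {n m : ℕ} (h : Nat.sqrt n / 4 = m) :
    ∃ pad : Bits (4 * m) → Bits n, ∀ x y, NQR₂ m x y = paddedNQR n (pad x) (pad y) := by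
  subst h
  refine ⟨fun x i => if hi : (i : ℕ) < 4 * (Nat.sqrt n / 4) then x ⟨i, hi⟩ else false,
    fun x y => ?_⟩
  simp [paddedNQR]

theorem inP₂_nqr₂_of_paddedNQR (h : InP₂ (fun n => n) paddedNQR) :
    InP₂ (fun m => 4 * m) NQR₂ := by
  obtain ⟨F, q, α, β, hF, hα, hβ, hf⟩ := h
  have hs : ∀ m, Nat.sqrt ((4 * m) ^ 2) / 4 = m := fun m => by
    rw [Nat.sqrt_eq', Nat.mul_div_cancel_left _ (by norm_num)]
  choose pad hpad using fun m => exists_padding (hs m)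
  -- The padded input has length (4m)². The padding is part of the arbitrary local functions, so
  -- only the length bound changes.
  refine ⟨F, q.comp (Polynomial.X ^ 2), fun m x => α _ (pad m x), fun m y => β _ (pad m y), hF,
    fun m x => ?_, fun m y => ?_, fun m x y => ?_⟩
  · simpa using hα _ (pad m x)
  · simpa using hβ _ (pad m y)
  · rw [hpad, hf]

end

/-! ### The main theorem -/

theorem mainTheorem3 :
    (∃ C : ℕ, ∀ m k : ℕ, 1 ≤ k →
      (∃ ρ ≤ C * ((4 * m) * (k ^ 2 + k * (4 * m))),
        HasCDS (NQR₂ m) ((1 / 2 : ℝ) ^ k) (k * (1 / 2 : ℝ) ^ k) ρ) ∧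
      (∃ ρ ≤ C * ((4 * m) * (k ^ 2 + k * (4 * m))),
        HasCDQS (NQR₂ m) ((1 / 2 : ℝ) ^ k) (k * (1 / 2 : ℝ) ^ k) ρ) ∧
      (∃ E ≤ C * ((4 * m) * (k ^ 2 + k * (4 * m))),
        HasRouting (NQR₂ m) (C * (k * (1 / 2 : ℝ) ^ k)) E)) ∧
    (¬ InP₂ (fun m => 4 * m) NQR₂ →
      ∃ f : ∀ n : ℕ, Bits n → Bits n → Bool, ¬ InP₂ (fun n => n) f ∧
        ∃ C : ℕ, ∀ n k : ℕ, 1 ≤ k →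
          (∃ ρ ≤ C * (k ^ 2 + k * n),
            HasCDS (f n) ((1 / 2 : ℝ) ^ k) (k * (1 / 2 : ℝ) ^ k) ρ) ∧
          (∃ ρ ≤ C * (k ^ 2 + k * n),
            HasCDQS (f n) ((1 / 2 : ℝ) ^ k) (k * (1 / 2 : ℝ) ^ k) ρ) ∧
          (∃ E ≤ C * (k ^ 2 + k * n),
            HasRouting (f n) (C * (k * (1 / 2 : ℝ) ^ k)) E)) := by
  refine ⟨⟨60000, fun m k hk => ?_⟩, fun hP => ⟨paddedNQR, mt inP₂_nqr₂_of_paddedNQR hP, 60000,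
    fun n k hk => ?_⟩⟩
  · rcases Nat.eq_zero_or_pos m with rfl | hm
    · exact ⟨⟨0, Nat.zero_le _, hasCDS_true nqr₂_zero (by positivity)⟩,
        ⟨0, Nat.zero_le _, hasCDQS_true nqr₂_zero (by positivity)⟩,
        ⟨0, Nat.zero_le _, hasRouting_true nqr₂_zero (by positivity)⟩⟩
    · obtain ⟨ρ, hρ, h⟩ := exists_hasCDSTwo_nqr₂ m k hk
      refine h.tasks hk (hρ.trans (Nat.mul_le_mul_left _ ?_)) (by norm_num)
      have h1 : k ^ 2 ≤ m * k ^ 2 := Nat.le_mul_of_pos_left _ hm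
      have e : 4 * m * (k ^ 2 + k * (4 * m)) = 4 * (m * k ^ 2) + 16 * (k * m ^ 2) := by ring
      rw [e]
      omega
  · obtain ⟨ρ, hρ, h⟩ := exists_hasCDSTwo_nqr₂ (Nat.sqrt n / 4) k hk
    refine (h.comp fun (x : Bits n) i =>
      x (Fin.castLE ((Nat.mul_div_le _ 4).trans (Nat.sqrt_le_self n)) i)).tasks hk
      (hρ.trans (Nat.mul_le_mul_left _ (Nat.add_le_add_left (Nat.mul_le_mul_left _ ?_) _)))
      (by norm_num)
    -- Here m = ⌊√n⌋ / 4 satisfies m² ≤ n, which turns the quadratic cost into a linear one.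
    exact (Nat.pow_le_pow_left (Nat.div_le_self _ 4) 2).trans (Nat.sqrt_le' n)
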